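/- Let $\gamma:\mathbb{R}/L\mathbb{Z}\to\mathbb{R}^3$ be an arclength parametrization of a smooth knot $K$ of length $L$. A cord $(s,t)\in K\times K=(\mathbb{R}/L\mathbb{Z})^2$ (with the flat product metric) is the straight segment from $\gamma(s)$ to $\gamma(t)$. Let $E(s,t)=\frac12|\gamma(s)-\gamma(t)|^2$, let $\Delta\subset K\times K$ be the diagonal, and let $S\subset K\times K$ be the set of cords that meet $K$ in their interior. Assume that $K$ is generic in the following sense: its curvature vanishes nowhere; all critical points of $E$ off $\Delta$ are nondegenerate and none of them lies in $S$; $S$ is an immersed curve with boundary, whose boundary consists of finitely many cords tangent to $K$ at one endpoint and whose self-intersections are transverse and are the finitely many cords that meet $K$ twice in their interior (no cord does so more often); for every cord tangent to $K$ at one endpoint, the tangent of $K$ at the other endpoint is not contained in the osculating plane at the point of tangency; and $-\nabla E$ does not point into $S$ at the boundary points of $S$. Let $f:K\times K\to\mathbb{R}$ be a sufficiently $C^{n}$-small smooth function (for a suitable $n$), supported in a sufficiently small neighborhood of $\Delta$, that has exactly two critical points on $\Delta$, a minimum and a maximum of $f|_\Delta$, and for which $E+f$ is a Morse function. Let $\eta>0$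 be sufficiently small, and let $\mathcal{G}$ be the space, with the $C^\infty$ topology, of smooth functions $g$ on $K\times K$ that vanish on the $\eta$-neighborhood of the union of $\Delta$ and the set of critical points of $E+f$. For $g\in\mathcal{G}$ put $E_g=E+f+g$, and let $W_g$ be the union of the unstable manifolds, for the flow of $-\nabla E_g$, of the critical points of $E_g$ of index $1$. Then, for a generic sufficiently small $g$, i.e. for all $g$ in a residual subset of $\mathcal{G}$ that are sufficiently small in $C^{n}$ for a suitable $n$, the following holds. Let $c\in W_g$. Let $c$ flow along $-\nabla E_g$. Whenever a cord $(s,t)$ met in this way contains a point $\gamma(r)$ of the knot in its interior, split it into the two cords $(s,r)$ and $(r,t)$; the original cord and both pieces flow on along $-\nabla E_g$ and are split again in the same way whenever they meet $K$ in their interior, and so on. In this whole process only finitely many splittings occur. -/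

import Mathlib

open Set Filter Topology
open scoped ContDiff

noncomputable section

namespace CordSplitting

/-- Euclidean three-space, the ambient space of the knot. -/
abbrev Space := EuclideanSpace ℝ (Fin 3)

/-- The universal cover of the space of cords. For a knot with arclength parametrization `γ` of
period `L`, the point `(s, t)` stands for the straight cord from `γ s` to `γ t`; the space of cords
`K × K = (ℝ/Lℤ)²` is the quotient by `Lℤ × Lℤ`, with the flat (product) metric. Functions on
`K × K` are doubly `L`-periodic functions on `Plane`, and subsets, flow lines and (un)stable
manifolds are described by their preimages. -/
abbrev Plane := EuclideanSpace ℝ (Fin 2)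

/-! ### Functions on the torus, Morse theory -/

/-- `L`-periodicity in both variables. -/
def IsDoublyPeriodic (L : ℝ) (F : Plane → ℝ) : Prop :=
  ∀ (p : Plane) (j k : ℤ), F (p + !₂[j * L, k * L]) = F p

/-- `F` and its derivatives up to order `n` are smaller than `ε` everywhere. -/
def CnSmall (n : ℕ) (ε : ℝ) (F : Plane → ℝ) : Prop :=
  ∀ i ≤ n, ∀ p, ‖iteratedFDeriv ℝ i F p‖ < ε

/-- The set of critical points. -/
def Crit (F : Plane → ℝ) : Set Plane := {p | gradient F p = 0}

/-- The Hessian of `F` at `p`, as a bilinear form. -/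
def hessian (F : Plane → ℝ) (p v w : Plane) : ℝ := fderiv ℝ (fderiv ℝ F) p v w

/-- Nondegeneracy of the Hessian of `F` at `p`. -/
def HessianNondegenerate (F : Plane → ℝ) (p : Plane) : Prop :=
  ∀ v, (∀ w, hessian F p v w = 0) → v = 0

/-- `F` is a Morse function. -/
def IsMorse (F : Plane → ℝ) : Prop := ∀ p ∈ Crit F, HessianNondegenerate F p

/-- The Morse index of `F` at `p` is `k`: the largest dimension of a subspace on which the Hessian
is negative definite. -/
def HasMorseIndex (F : Plane → ℝ) (p : Plane) (k : ℕ) : Prop :=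
  IsGreatest {n : ℕ | ∃ V : Submodule ℝ Plane, Module.finrank ℝ V = n ∧
    ∀ v ∈ V, v ≠ 0 → hessian F p v v < 0} k

/-- The critical points of index `k`. -/
def CritIndex (F : Plane → ℝ) (k : ℕ) : Set Plane := {p ∈ Crit F | HasMorseIndex F p k}

/-- `x` is a (complete) flow line of the negative gradient `-∇F`. -/
def IsFlowLine (F : Plane → ℝ) (x : ℝ → Plane) : Prop :=
  ∀ s, HasDerivAt x (-gradient F (x s)) s

/-- The unstable manifold of `k` for the flow of `-∇F`. -/
def unstableManifold (F : Plane → ℝ) (k : Plane) : Set Plane :=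
  {c | ∃ x, IsFlowLine F x ∧ x 0 = c ∧ Tendsto x atBot (𝓝 k)}

/-- The union of the unstable manifolds of all critical points of index 1. -/
def unstableUnion (F : Plane → ℝ) : Set Plane := ⋃ k ∈ CritIndex F 1, unstableManifold F k

/-! ### Knots and cords -/

/-- `γ` is an arclength parametrization of a smooth knot of length `L`. -/
structure IsKnot (L : ℝ) (γ : ℝ → Space) : Prop where
  pos : 0 < L
  smooth : ContDiff ℝ ∞ γ
  periodic : ∀ s, γ (s + L) = γ s
  unitSpeed : ∀ s, ‖deriv γ s‖ = 1
  injective : ∀ s t, γ s = γ t → ∃ k : ℤ, t = s + k * L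

/-- The energy of a cord, half its squared length. -/
def energy (γ : ℝ → Space) (p : Plane) : ℝ := (1 / 2) * ‖γ (p 0) - γ (p 1)‖ ^ 2

/-- The diagonal of `K × K`, the cords of length zero. -/
def diagonal (L : ℝ) : Set Plane := {p | ∃ k : ℤ, p 1 = p 0 + k * L}

/-- The parameters at which the knot meets the interior of the cord `p`. -/
def crossings (γ : ℝ → Space) (p : Plane) : Set ℝ :=
  {r | γ (p 0) ≠ γ (p 1) ∧ γ r ∈ openSegment ℝ (γ (p 0)) (γ (p 1))}

/-- The set `S` of cords that meet the knot in their interior. -/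
def cordsMeetingKnot (γ : ℝ → Space) : Set Plane := {p | (crossings γ p).Nonempty}

/-- The cords in `S` together with a choice of one crossing. A cord that meets the knot twice
in its interior gives two points here; this is the curve of which `S` is the immersed image. -/
def markedCords (γ : ℝ → Space) : Set (Plane × ℝ) := {q | q.2 ∈ crossings γ q.1}

/-- `(σ, ρ)` parametrizes a neighbourhood of `q` in the curve of marked cords; its projection `σ`
to the space of cords is a regular smooth arc. -/
def IsArc (γ : ℝ → Space) (q : Plane × ℝ) (σ : ℝ → Plane) (ρ : ℝ → ℝ) : Prop :=
  ContDiff ℝ ∞ σ ∧ (∀ u, deriv σ u ≠ 0) ∧ σ 0 = q.1 ∧ ρ 0 = q.2 ∧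
    IsEmbedding (fun u : ℝ => (σ u, ρ u)) ∧
    ∃ V : Set (Plane × ℝ), IsOpen V ∧
      range (fun u : ℝ => (σ u, ρ u)) = markedCords γ ∩ V

/-- The boundary points of the curve of marked cords. -/
def markedBoundary (γ : ℝ → Space) : Set (Plane × ℝ) := closure (markedCords γ) \ markedCords γ

/-- `(σ, ρ)`, restricted to parameters `u ≥ 0`, parametrizes a neighbourhood of the boundary point
`q` in the closure of the curve of marked cords. -/
def IsBoundaryArc (γ : ℝ → Space) (q : Plane × ℝ) (σ : ℝ → Plane) (ρ : ℝ → ℝ) : Prop :=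
  ContDiff ℝ ∞ σ ∧ (∀ u, deriv σ u ≠ 0) ∧ σ 0 = q.1 ∧ ρ 0 = q.2 ∧
    IsEmbedding (fun u : Ici (0 : ℝ) => (σ u, ρ u)) ∧
    ∃ V : Set (Plane × ℝ), IsOpen V ∧
      (fun u : ℝ => (σ u, ρ u)) '' Ici 0 = closure (markedCords γ) ∩ V

/-- A cord of positive length that is tangent to the knot at its startpoint. -/
def TangentAtStart (γ : ℝ → Space) (p : Plane) : Prop :=
  γ (p 0) ≠ γ (p 1) ∧ ∃ a : ℝ, γ (p 1) - γ (p 0) = a • deriv γ (p 0)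

/-- A cord of positive length that is tangent to the knot at its endpoint. -/
def TangentAtEnd (γ : ℝ → Space) (p : Plane) : Prop :=
  γ (p 0) ≠ γ (p 1) ∧ ∃ a : ℝ, γ (p 1) - γ (p 0) = a • deriv γ (p 1)

/-- A fundamental domain for the space of cords. -/
def fundamentalDomain (L : ℝ) : Set Plane := {p | p 0 ∈ Ico 0 L ∧ p 1 ∈ Ico 0 L}

/-- Generic knots. -/
structure IsGenericKnot (L : ℝ) (γ : ℝ → Space) : Prop extends IsKnot L γ where
  /-- The curvature vanishes nowhere. -/
  curvature : ∀ s, deriv (deriv γ) s ≠ 0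
  /-- All binormal cords of positive length are nondegenerate critical points of the energy. (The
  diagonal is automatically a Bott nondegenerate critical manifold.) -/
  nondegenerate : ∀ p ∈ Crit (energy γ), p ∉ diagonal L → HessianNondegenerate (energy γ) p
  /-- `S` is an immersed curve ... -/
  arc : ∀ q ∈ markedCords γ, ∃ σ ρ, IsArc γ q σ ρ
  /-- ... with boundary ... -/
  boundaryArc : ∀ q ∈ markedBoundary γ, ∃ σ ρ, IsBoundaryArc γ q σ ρ
  /-- ... consisting of cords tangent to the knot at one endpoint, ... -/
  boundaryTangent : ∀ q ∈ markedBoundary γ, TangentAtStart γ q.1 ∨ TangentAtEnd γ q.1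
  /-- ... finitely many of them, ... -/
  boundaryFinite : {p ∈ fundamentalDomain L | ∃ r, (p, r) ∈ markedBoundary γ}.Finite
  /-- ... each in the nondegenerate position in which the knot, near the other endpoint of the cord,
  is transverse to the osculating plane at the point of tangency. -/
  tangentStart : ∀ p, TangentAtStart γ p →
    LinearIndependent ℝ ![deriv γ (p 0), deriv (deriv γ) (p 0), deriv γ (p 1)]
  tangentEnd : ∀ p, TangentAtEnd γ p →
    LinearIndependent ℝ ![deriv γ (p 1), deriv (deriv γ) (p 1), deriv γ (p 0)]
  /-- The self-intersections of `S` are the cords that meet the knot twice in their interior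
  (never more often); there are finitely many, ... -/
  crossingsLe : ∀ p, (crossings γ p ∩ Ico 0 L).encard ≤ 2
  doubleFinite : {p ∈ fundamentalDomain L | (crossings γ p ∩ Ico 0 L).encard = 2}.Finite
  /-- ... and they are transverse. -/
  doubleTransverse : ∀ p, ∀ r₁ ∈ Ico 0 L, ∀ r₂ ∈ Ico 0 L, r₁ ≠ r₂ → ∀ σ₁ ρ₁ σ₂ ρ₂,
    IsArc γ (p, r₁) σ₁ ρ₁ → IsArc γ (p, r₂) σ₂ ρ₂ →
      LinearIndependent ℝ ![deriv σ₁ 0, deriv σ₂ 0]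
  /-- `-∇E` does not point into `S` at the boundary points of `S`. -/
  notInward : ∀ q ∈ markedBoundary γ, ∀ σ ρ, IsBoundaryArc γ q σ ρ →
    ∀ a > 0, -gradient (energy γ) q.1 ≠ a • deriv σ 0
  /-- No binormal cord meets the knot in its interior. -/
  critNotMeeting : ∀ p ∈ Crit (energy γ), p ∉ cordsMeetingKnot γ

/-! ### Perturbations of the energy -/

/-- A perturbation `f`, supported in the `δ`-neighbourhood of the diagonal, that turns the
Morse-Bott function `E` into a Morse function, with exactly two critical points on the diagonal, a
minimum and a maximum of `f` along the diagonal. -/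
structure IsMorsification (L : ℝ) (γ : ℝ → Space) (δ : ℝ) (f : Plane → ℝ) : Prop where
  smooth : ContDiff ℝ ∞ f
  periodic : IsDoublyPeriodic L f
  support : ∀ p, p ∉ Metric.thickening δ (diagonal L) → f p = 0
  morse : IsMorse (energy γ + f)
  diagonalCrit : ∃ m M : ℝ, (¬ ∃ k : ℤ, M = m + k * L) ∧
    (∀ s : ℝ, gradient f !₂[s, s] = 0 ↔ (∃ k : ℤ, s = m + k * L) ∨ ∃ k : ℤ, s = M + k * L) ∧
    ∀ s : ℝ, f !₂[m, m] ≤ f !₂[s, s] ∧ f !₂[s, s] ≤ f !₂[M, M]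

/-- The smooth functions on `K × K` that vanish on `N`. -/
def Perturbation (L : ℝ) (N : Set Plane) : Type :=
  {g : Plane → ℝ // ContDiff ℝ ∞ g ∧ IsDoublyPeriodic L g ∧ ∀ p ∈ N, g p = 0}

/-- The `C^∞` topology: uniform convergence of all derivatives. -/
instance (L : ℝ) (N : Set Plane) : TopologicalSpace (Perturbation L N) :=
  ⨅ i : ℕ, TopologicalSpace.induced
    (fun g => UniformFun.ofFun (fun p : Plane => iteratedFDeriv ℝ i g.1 p)) inferInstance

/-! ### Splitting of cords -/

/-- One splitting of a cord along a flow line, and one of the two resulting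
pieces: the cord is split at the time `time ≥ 0`, at the point of the knot with parameter
`crossing`, and the first or the second piece is taken. -/
structure SplitStep where
  time : ℝ
  crossing : ℝ
  second : Bool

/-- The two pieces (first and second, in the direction of the cord) into which the cord `p` is split
at the knot point with parameter `r`. -/
def piece (p : Plane) (r : ℝ) (second : Bool) : Plane :=
  if second then !₂[r, p 1] else !₂[p 0, r]

/-- The histories of the splitting process that starts with the cord `c`: `c` flows along `-∇F`
(forever); whenever it meets the knot in its interior it may be split there, and each of the two
pieces flows on along `-∇F` and is subject to the same process. Every single splitting that
occurs in the process is the last step of exactly two histories, one for each piece. -/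
def IsHistory (L : ℝ) (γ : ℝ → Space) (F : Plane → ℝ) : Plane → List SplitStep → Prop
  | _, [] => True
  | c, a :: l => 0 ≤ a.time ∧ ∃ x : ℝ → Plane, IsFlowLine F x ∧ x 0 = c ∧
      a.crossing ∈ crossings γ (x a.time) ∩ Ico 0 L ∧
      IsHistory L γ F (piece (x a.time) a.crossing a.second) l

end CordSplitting

end

/-!
Write `S` for the set of cords that meet the knot in their interior, and `F` for the perturbed
energy. The splitting process of a cord is a tree whose vertices are cords, each cord having as
successors the pieces that arise while it flows on. The tree is finite, since its depth is bounded
and every vertex has finitely many successors.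

*Bounded depth.* Two consecutive splittings lower `F` by a definite amount
(`IsGenericKnot.exists_two_step_drop`). A splitting lowers the energy by at least half the squared
length of the discarded piece (`energy_piece_le`), so only pairs of splittings that both discard
short pieces matter. A cord that meets the knot close to one of its ends is almost tangent to the
knot there, by compactness and because the curvature does not vanish. After the splitting, the flow
pulls this end further along the knot, away from its old position (`IsGenericKnot.exists_pull`). The
next splitting, if it discards a short piece as well, cannot happen nearby: at the other end, it
would lead in the limit to a cord tangent to the knot at both ends
(`IsGenericKnot.exists_radius_opposite`), and at the same end it would contradict the fact that the
tangent of the knot at the far end of a tangent cord is transverse to the osculating plane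
(`IsGenericKnot.exists_radius_same`). Hence the cord has to move by a definite distance first, along
which the gradient is bounded below, and it loses energy.

*Finitely many successors.* On `S` the gradient is bounded below, so a flow line is in `S` only
during a bounded time (`exists_time_bound`). If it met the knot infinitely often, the crossings
would accumulate, either at a boundary point of `S` or at a point at which the flow line is tangent
to `S` (`exists_isTarget_isolating`, `finite_firstSteps`). The curve of marked cords is covered by
countably many arcs, and so countably many sets of cords are to be avoided by all cords of the
process: the translates of a boundary point, and the tangencies of the flow with an arc
(`exists_countable_isolating`).

*Genericity.* The unstable manifold of a critical point of index 1 consists of the critical point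
and two orbits. Both contain points near the critical point which do not depend on the perturbation,
as long as it vanishes there (`exists_countable_base`): the Hessian is negative on the difference of
any two different points of the local unstable manifold (`exists_radius_hessian_neg`), and since the
index is 1, these points are told apart by a linear form, so that two solutions that emanate from
the critical point on the same side lie on the same orbit (`exists_radius_common_point`). So it
suffices that, for each point `b` of a countable set, each target `C`, each number `m` of
splittings, each bound `T` for the time of the flows and each bound `d` from below for the distance
of a crossing from the ends of the cord, the perturbations for which `b` reaches `C` after `m`
splittings form a closed set (`isClosed_bad`) whose complement is dense among the small
perturbations (`IsTarget.subset_closure_notMem_bad`).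

Density is proved by induction on `m`. After a first perturbation, fewer than `m` splittings lead
neither to the target, nor to a cord that can be split into a piece in the target, nor to a
tangency. Then there are finitely many cords after `m` splittings. By the one-dimensional Sard
theorem, a further perturbation makes the target locally finite (`exists_finitelyTangent`). The
finitely many points of the target that are still met are then removed one after the other
(`IsTarget.exists_remove_hit`): shortly before the flow line arrives at such a point, it is steered
aside by a bump function (`exists_steering`) whose support is disjoint from the earlier part of the
process and from the arc that defines the target. The gradient flow reacts to a bump `a • χ * y`,
where `y` vanishes exactly along the flow line, by moving to the side where `y` is negative, from
which it cannot return.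
-/

noncomputable section

namespace CordSplitting

/-! ### The period lattice and functions on the torus -/

/-- The lattice `Lℤ × Lℤ` of periods of the space of cords. -/
def lattice (L : ℝ) : AddSubgroup Plane where
  carrier := {v | ∃ j k : ℤ, v = !₂[j * L, k * L]}
  zero_mem' := ⟨0, 0, by ext i; fin_cases i <;> simp⟩
  add_mem' := by
    rintro _ _ ⟨j, k, rfl⟩ ⟨j', k', rfl⟩
    exact ⟨j + j', k + k', by ext i; fin_cases i <;> simp <;> ring⟩
  neg_mem' := by
    rintro _ ⟨j, k, rfl⟩
    exact ⟨-j, -k, by ext i; fin_cases i <;> simp⟩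

theorem mem_lattice_iff {L : ℝ} {v : Plane} :
    v ∈ lattice L ↔ (∃ j : ℤ, v 0 = j * L) ∧ ∃ k : ℤ, v 1 = k * L := by
  constructor
  · rintro ⟨j, k, rfl⟩
    exact ⟨⟨j, by simp⟩, ⟨k, by simp⟩⟩
  · rintro ⟨⟨j, hj⟩, ⟨k, hk⟩⟩
    exact ⟨j, k, by ext i; fin_cases i <;> simp [hj, hk]⟩

theorem vec_mem_lattice (L : ℝ) (j k : ℤ) : (!₂[j * L, k * L] : Plane) ∈ lattice L := ⟨j, k, rfl⟩

theorem continuous_coord (i : Fin 2) : Continuous fun p : Plane => p i := by fun_prop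

theorem continuous_mk : Continuous fun q : ℝ × ℝ => (!₂[q.1, q.2] : Plane) := by
  apply (PiLp.continuous_toLp 2 (fun _ : Fin 2 => ℝ)).comp
  apply continuous_pi
  intro i
  fin_cases i <;> simp <;> fun_prop

theorem norm_coord_le (p : Plane) (i : Fin 2) : |p i| ≤ ‖p‖ := by
  simpa using PiLp.norm_apply_le p i

theorem isClosed_multiples (L : ℝ) (hL : 0 < L) : IsClosed {x : ℝ | ∃ k : ℤ, x = k * L} := by
  have h : {x : ℝ | ∃ k : ℤ, x = k * L} = (fun x => x / L) ⁻¹' (range ((↑) : ℤ → ℝ)) := by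
    ext x
    constructor
    · rintro ⟨k, rfl⟩
      exact ⟨k, by field_simp⟩
    · rintro ⟨k, hk⟩
      exact ⟨k, by simp only at hk; rw [hk]; field_simp⟩
  rw [h]
  exact Int.isClosedEmbedding_coe_real.isClosed_range.preimage (by fun_prop)

theorem isClosed_lattice {L : ℝ} (hL : 0 < L) : IsClosed (lattice L : Set Plane) := by
  have h : (lattice L : Set Plane) = {p | p 0 ∈ {x : ℝ | ∃ k : ℤ, x = k * L}} ∩
      {p | p 1 ∈ {x : ℝ | ∃ k : ℤ, x = k * L}} := by
    ext p
    exact mem_lattice_iff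
  rw [h]
  exact ((isClosed_multiples L hL).preimage (continuous_coord 0)).inter
    ((isClosed_multiples L hL).preimage (continuous_coord 1))

theorem lattice_discrete {L : ℝ} (hL : 0 < L) {v : Plane} (hv : v ∈ lattice L) (h : ‖v‖ < L) :
    v = 0 := by
  obtain ⟨⟨j, hj⟩, ⟨k, hk⟩⟩ := mem_lattice_iff.1 hv
  have key : ∀ m : ℤ, |(m : ℝ) * L| < L → m = 0 := by
    intro m hm
    rw [abs_mul, abs_of_pos hL] at hm
    have : |(m : ℝ)| < 1 := by nlinarith
    have h2 : |m| < 1 := by exact_mod_cast this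
    exact Int.abs_lt_one_iff.1 h2
  have h0 := key j (by rw [← hj]; exact (norm_coord_le v 0).trans_lt h)
  have h1 := key k (by rw [← hk]; exact (norm_coord_le v 1).trans_lt h)
  ext i
  fin_cases i
  · simp [hj, h0]
  · simp [hk, h1]

/-- The closed fundamental square. -/
def square (L : ℝ) : Set Plane := {p | p 0 ∈ Icc 0 L ∧ p 1 ∈ Icc 0 L}

theorem isCompact_square (L : ℝ) : IsCompact (square L) := by
  have h : square L = (fun q : ℝ × ℝ => (!₂[q.1, q.2] : Plane)) '' (Icc 0 L ×ˢ Icc 0 L) := by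
    ext p
    constructor
    · rintro ⟨h0, h1⟩
      exact ⟨(p 0, p 1), ⟨h0, h1⟩, by ext i; fin_cases i <;> simp⟩
    · rintro ⟨⟨a, b⟩, ⟨h0, h1⟩, rfl⟩
      exact ⟨by simpa using h0, by simpa using h1⟩
  rw [h]
  exact (isCompact_Icc.prod isCompact_Icc).image continuous_mk

theorem exists_shift_mem_Ico {L : ℝ} (hL : 0 < L) (x : ℝ) : ∃ k : ℤ, x + k * L ∈ Ico 0 L := by
  obtain ⟨k, hk, -⟩ := existsUnique_add_zsmul_mem_Ico hL x 0
  exact ⟨k, by simpa using hk⟩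

theorem exists_lattice_add_mem_fundamentalDomain {L : ℝ} (hL : 0 < L) (p : Plane) :
    ∃ v ∈ lattice L, p + v ∈ fundamentalDomain L := by
  obtain ⟨j, hj⟩ := exists_shift_mem_Ico hL (p 0)
  obtain ⟨k, hk⟩ := exists_shift_mem_Ico hL (p 1)
  exact ⟨_, vec_mem_lattice L j k, by simpa using hj, by simpa using hk⟩

theorem fundamentalDomain_subset_square (L : ℝ) : fundamentalDomain L ⊆ square L :=
  fun _ h => ⟨Ico_subset_Icc_self h.1, Ico_subset_Icc_self h.2⟩

/-- A set of cords that is invariant under the period lattice. -/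
def IsInvariant (L : ℝ) (A : Set Plane) : Prop := ∀ p ∈ A, ∀ v ∈ lattice L, p + v ∈ A

theorem IsInvariant.add_mem_iff {L : ℝ} {A : Set Plane} (hA : IsInvariant L A) {p v : Plane}
    (hv : v ∈ lattice L) : p + v ∈ A ↔ p ∈ A :=
  ⟨fun h => by simpa using hA _ h _ ((lattice L).neg_mem hv), fun h => hA _ h _ hv⟩

theorem IsInvariant.union {L : ℝ} {A B : Set Plane} (hA : IsInvariant L A)
    (hB : IsInvariant L B) : IsInvariant L (A ∪ B) := fun p hp v hv =>
  hp.imp (fun h => hA p h v hv) fun h => hB p h v hv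

theorem IsInvariant.closure {L : ℝ} {A : Set Plane} (hA : IsInvariant L A) :
    IsInvariant L (closure A) := by
  intro p hp v hv
  exact map_mem_closure (f := fun q => q + v) (by fun_prop) hp fun q hq => hA q hq v hv

theorem IsInvariant.thickening {L : ℝ} {A : Set Plane} (hA : IsInvariant L A) (η : ℝ) :
    IsInvariant L (Metric.thickening η A) := by
  intro p hp v hv
  obtain ⟨q, hq, h⟩ := Metric.mem_thickening_iff.1 hp
  exact Metric.mem_thickening_iff.2 ⟨q + v, hA q hq v hv, by simpa using h⟩

/-- A smooth function on the torus, as a doubly periodic function on the plane. -/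
structure IsTorusFun (L : ℝ) (F : Plane → ℝ) : Prop where
  smooth : ContDiff ℝ ∞ F
  periodic : IsDoublyPeriodic L F

theorem IsDoublyPeriodic.add_lattice {L : ℝ} {F : Plane → ℝ} (hF : IsDoublyPeriodic L F)
    {v : Plane} (hv : v ∈ lattice L) (p : Plane) : F (p + v) = F p := by
  obtain ⟨j, k, rfl⟩ := hv
  exact hF p j k

theorem IsTorusFun.add {L : ℝ} {F G : Plane → ℝ} (hF : IsTorusFun L F) (hG : IsTorusFun L G) :
    IsTorusFun L (F + G) :=
  ⟨hF.smooth.add hG.smooth, fun p j k => by simp [hF.periodic p j k, hG.periodic p j k]⟩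

theorem IsTorusFun.const_smul {L : ℝ} {F : Plane → ℝ} (hF : IsTorusFun L F) (a : ℝ) :
    IsTorusFun L (a • F) :=
  ⟨contDiff_const.smul hF.smooth, fun p j k => by simp [hF.periodic p j k]⟩

theorem gradient_apply (F : Plane → ℝ) (p : Plane) (i : Fin 2) :
    gradient F p i = fderiv ℝ F p (EuclideanSpace.single i 1) := by
  rw [← inner_gradient_left, EuclideanSpace.inner_single_right]
  simp

theorem gradient_add {F G : Plane → ℝ} {p : Plane} (hF : DifferentiableAt ℝ F p)
    (hG : DifferentiableAt ℝ G p) : gradient (F + G) p = gradient F p + gradient G p := by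
  simp [gradient, fderiv_add hF hG]

theorem gradient_const_smul {F : Plane → ℝ} {p : Plane} (a : ℝ) (hF : DifferentiableAt ℝ F p) :
    gradient (a • F) p = a • gradient F p := by
  simp [gradient, fderiv_const_smul hF]

theorem norm_gradient (F : Plane → ℝ) (p : Plane) : ‖gradient F p‖ = ‖fderiv ℝ F p‖ := by
  simp [gradient]

theorem contDiff_gradient {F : Plane → ℝ} (hF : ContDiff ℝ ∞ F) : ContDiff ℝ ∞ (gradient F) := by
  rw [contDiff_euclidean]
  intro i
  simp only [gradient_apply]
  exact (hF.fderiv_right (by simp)).clm_apply contDiff_const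

theorem gradient_shift {F : Plane → ℝ} {v : Plane} (h : ∀ p, F (p + v) = F p) (p : Plane) :
    gradient F (p + v) = gradient F p := by
  have h1 : fderiv ℝ (fun q => F (q + v)) p = fderiv ℝ F (p + v) := fderiv_comp_add_right v
  have h2 : (fun q => F (q + v)) = F := funext h
  rw [h2] at h1
  simp [gradient, h1]

theorem IsTorusFun.gradient_add_lattice {L : ℝ} {F : Plane → ℝ} (hF : IsTorusFun L F)
    {v : Plane} (hv : v ∈ lattice L) (p : Plane) : gradient F (p + v) = gradient F p :=
  gradient_shift (hF.periodic.add_lattice hv) p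

/-- A continuous doubly periodic map is bounded. -/
theorem exists_bound_of_periodic {E : Type*} [NormedAddCommGroup E] {L : ℝ} (hL : 0 < L)
    {φ : Plane → E} (hc : Continuous φ) (hp : ∀ v ∈ lattice L, ∀ p, φ (p + v) = φ p) :
    ∃ B > 0, ∀ p, ‖φ p‖ ≤ B := by
  obtain ⟨B, hB⟩ := (isCompact_square L).exists_bound_of_continuousOn hc.continuousOn
  refine ⟨max B 1, by positivity, fun p => ?_⟩
  obtain ⟨v, hv, hpv⟩ := exists_lattice_add_mem_fundamentalDomain hL p
  rw [← hp v hv p]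
  exact (hB _ (fundamentalDomain_subset_square L hpv)).trans (le_max_left _ _)

theorem iteratedFDeriv_shift {F : Plane → ℝ} {v : Plane} (h : ∀ p, F (p + v) = F p) (i : ℕ)
    (p : Plane) : iteratedFDeriv ℝ i F (p + v) = iteratedFDeriv ℝ i F p := by
  have h1 := iteratedFDeriv_comp_add_right (𝕜 := ℝ) (f := F) i v p
  have h2 : (fun q => F (q + v)) = F := funext h
  rw [h2] at h1
  exact h1.symm

theorem IsTorusFun.exists_bound_iteratedFDeriv {L : ℝ} (hL : 0 < L) {F : Plane → ℝ}
    (hF : IsTorusFun L F) (i : ℕ) : ∃ B > 0, ∀ p, ‖iteratedFDeriv ℝ i F p‖ ≤ B :=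
  exists_bound_of_periodic hL (hF.smooth.continuous_iteratedFDeriv (by exact_mod_cast le_top))
    fun _ hv p => iteratedFDeriv_shift (hF.periodic.add_lattice hv) i p

theorem IsTorusFun.exists_bound {L : ℝ} (hL : 0 < L) {F : Plane → ℝ}
    (hF : IsTorusFun L F) : ∃ B > 0, ∀ p, |F p| ≤ B :=
  exists_bound_of_periodic hL hF.smooth.continuous
    fun _ hv p => hF.periodic.add_lattice hv p

theorem IsTorusFun.exists_bound_gradient {L : ℝ} (hL : 0 < L) {F : Plane → ℝ}
    (hF : IsTorusFun L F) : ∃ B > 0, ∀ p, ‖gradient F p‖ ≤ B :=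
  exists_bound_of_periodic hL (contDiff_gradient hF.smooth).continuous
    fun _ hv p => hF.gradient_add_lattice hv p

theorem IsTorusFun.exists_lipschitz {L : ℝ} (hL : 0 < L) {F : Plane → ℝ}
    (hF : IsTorusFun L F) : ∃ K, LipschitzWith K (gradient F) := by
  have hg := contDiff_gradient hF.smooth
  obtain ⟨B, hB0, hB⟩ := exists_bound_of_periodic hL (φ := fderiv ℝ (gradient F))
    (hg.continuous_fderiv (by simp)) (fun v hv p => by
      have h1 : fderiv ℝ (fun q => gradient F (q + v)) p = fderiv ℝ (gradient F) (p + v) :=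
        fderiv_comp_add_right v
      have h2 : (fun q => gradient F (q + v)) = gradient F :=
        funext fun q => hF.gradient_add_lattice hv q
      rw [h2] at h1
      exact h1.symm)
  refine ⟨⟨B, hB0.le⟩, lipschitzWith_of_nnnorm_fderiv_le (hg.differentiable (by simp)) fun p => ?_⟩
  exact hB p

/-! ### The gradient flow -/

theorem exists_flowLine {v : Plane → Plane} (hv : ContDiff ℝ 1 v) {K : NNReal}
    (hK : LipschitzWith K v) {B : ℝ} (hB : ∀ p, ‖v p‖ ≤ B) (p : Plane) :
    ∃ x : ℝ → Plane, x 0 = p ∧ ∀ t, HasDerivAt x (v (x t)) t := by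
  have hB0 : 0 ≤ B := (norm_nonneg _).trans (hB 0)
  have key : ∀ a, ∃ γ : ℝ → Plane, γ 0 = p ∧
      IsMIntegralCurveOn (I := modelWithCornersSelf ℝ Plane) (M := Plane) γ v (Ioo (-a) a) := by
    intro a
    rcases le_or_gt a 0 with ha | ha
    · refine ⟨fun _ => p, rfl, ?_⟩
      intro t ht
      exact absurd ht (by simp [Ioo_eq_empty (by linarith : ¬ -a < a)])
    have h0 : (0 : ℝ) ∈ Icc (-a) a := ⟨by linarith, ha.le⟩
    have hpl : IsPicardLindelof (fun _ : ℝ => v) (⟨0, h0⟩ : Icc (-a) a) p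
        ⟨B * a, by positivity⟩ 0 ⟨B, hB0⟩ K := by
      refine ⟨fun t _ => hK.lipschitzOnWith, fun x _ => continuousOn_const,
        fun t _ x _ => hB x, ?_⟩
      simp
      rfl
    obtain ⟨x, hx0, hx⟩ := hpl.exists_eq_forall_mem_Icc_hasDerivWithinAt₀
    refine ⟨x, hx0, fun t ht => ?_⟩
    have h1 := (hx t (Ioo_subset_Icc_self ht)).hasDerivAt (Icc_mem_nhds ht.1 ht.2)
    exact (hasMFDerivAt_iff_hasFDerivAt.2 h1.hasFDerivAt).hasMFDerivWithinAt
  obtain ⟨x, hx0, hx⟩ := (exists_isMIntegralCurve_iff_exists_isMIntegralCurveOn_Ioo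
    (I := modelWithCornersSelf ℝ Plane) (M := Plane)
    (contMDiff_vectorSpace_iff_contDiff.2 hv) p).2 key
  refine ⟨x, hx0, fun t => ?_⟩
  have h : HasFDerivAt x ((1 : ℝ →L[ℝ] ℝ).smulRight (v (x t))) t :=
    hasMFDerivAt_iff_hasFDerivAt.1 (hx t)
  simpa using h.hasDerivAt

open Classical in
/-- The flow of `-∇F`. Off the functions whose gradient flow is complete it takes the value `p`. -/
def flow (F : Plane → ℝ) (t : ℝ) (p : Plane) : Plane :=
  if h : ∃ x : ℝ → Plane, x 0 = p ∧ IsFlowLine F x then h.choose t else p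

theorem IsTorusFun.exists_flowLine {L : ℝ} (hL : 0 < L) {F : Plane → ℝ} (hF : IsTorusFun L F)
    (p : Plane) : ∃ x : ℝ → Plane, x 0 = p ∧ IsFlowLine F x := by
  obtain ⟨K, hK⟩ := hF.exists_lipschitz hL
  obtain ⟨B, -, hB⟩ := hF.exists_bound_gradient hL
  exact CordSplitting.exists_flowLine (v := fun p => -gradient F p)
    ((contDiff_gradient hF.smooth).neg.of_le (by simp)) hK.neg (B := B) (by simpa using hB) p

theorem IsTorusFun.isFlowLine_flow {L : ℝ} (hL : 0 < L) {F : Plane → ℝ} (hF : IsTorusFun L F)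
    (p : Plane) : IsFlowLine F fun t => flow F t p := by
  have h := hF.exists_flowLine hL p
  have : (fun t => flow F t p) = h.choose := by
    ext t : 1
    simp [flow, h]
  rw [this]
  exact h.choose_spec.2

theorem IsTorusFun.flow_zero {L : ℝ} (hL : 0 < L) {F : Plane → ℝ} (hF : IsTorusFun L F)
    (p : Plane) : flow F 0 p = p := by
  have h := hF.exists_flowLine hL p
  simp [flow, h]
  exact h.choose_spec.1

theorem IsFlowLine.continuous {F : Plane → ℝ} {x : ℝ → Plane} (hx : IsFlowLine F x) :
    Continuous x :=
  continuous_iff_continuousAt.2 fun t => (hx t).continuousAt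

theorem IsFlowLine.shift {F : Plane → ℝ} {x : ℝ → Plane} (hx : IsFlowLine F x) (s : ℝ) :
    IsFlowLine F fun t => x (t + s) := fun t => by
  simpa using (hx (t + s)).comp_add_const t s

theorem IsTorusFun.eq_of_isFlowLine {L : ℝ} (hL : 0 < L) {F : Plane → ℝ} (hF : IsTorusFun L F)
    {x y : ℝ → Plane} (hx : IsFlowLine F x) (hy : IsFlowLine F y) {t₀ : ℝ} (h : x t₀ = y t₀) :
    x = y := by
  obtain ⟨K, hK⟩ := hF.exists_lipschitz hL
  exact ODE_solution_unique_univ (v := fun _ p => -gradient F p) (s := fun _ => univ) (K := K)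
    (fun _ => hK.neg.lipschitzOnWith) (fun t => ⟨hx t, trivial⟩) (fun t => ⟨hy t, trivial⟩) h

theorem IsTorusFun.eq_flow {L : ℝ} (hL : 0 < L) {F : Plane → ℝ} (hF : IsTorusFun L F)
    {x : ℝ → Plane} (hx : IsFlowLine F x) (t : ℝ) : x t = flow F t (x 0) :=
  congrFun (hF.eq_of_isFlowLine hL hx (hF.isFlowLine_flow hL (x 0)) (t₀ := 0)
    (hF.flow_zero hL _).symm) t

theorem IsTorusFun.flow_flow {L : ℝ} (hL : 0 < L) {F : Plane → ℝ} (hF : IsTorusFun L F)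
    (s t : ℝ) (p : Plane) : flow F s (flow F t p) = flow F (s + t) p := by
  have h := hF.eq_flow hL ((hF.isFlowLine_flow hL p).shift t) s
  simp only [zero_add] at h
  exact h.symm

/-- Two solutions of the gradient equation of `F` on `[a, b]` with the same initial value agree. -/
theorem IsTorusFun.eqOn_Icc {L : ℝ} (hL : 0 < L) {F : Plane → ℝ} (hF : IsTorusFun L F)
    {x y : ℝ → Plane} {a b : ℝ} (hx : ∀ t ∈ Icc a b, HasDerivAt x (-gradient F (x t)) t)
    (hy : ∀ t ∈ Icc a b, HasDerivAt y (-gradient F (y t)) t) (h : x a = y a) :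
    EqOn x y (Icc a b) := by
  obtain ⟨K, hK⟩ := hF.exists_lipschitz hL
  exact ODE_solution_unique_of_mem_Icc_right (v := fun _ p => -gradient F p) (s := fun _ => univ)
    (K := K) (fun _ _ => hK.neg.lipschitzOnWith)
    (fun t ht => (hx t ht).continuousAt.continuousWithinAt)
    (fun t ht => (hx t (Ico_subset_Icc_self ht)).hasDerivWithinAt) (fun _ _ => trivial)
    (fun t ht => (hy t ht).continuousAt.continuousWithinAt)
    (fun t ht => (hy t (Ico_subset_Icc_self ht)).hasDerivWithinAt) (fun _ _ => trivial) h

theorem hasDerivAt_comp_flowLine {F : Plane → ℝ} {x : ℝ → Plane} {t : ℝ} {w : Plane}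
    (hx : HasDerivAt x w t) (hF : DifferentiableAt ℝ F (x t)) :
    HasDerivAt (fun s => F (x s)) (inner ℝ (gradient F (x t)) w) t := by
  have := hF.hasFDerivAt.comp_hasDerivAt t hx
  rwa [← inner_gradient_left] at this

theorem IsFlowLine.hasDerivAt_energy {F : Plane → ℝ} (hF : Differentiable ℝ F) {x : ℝ → Plane}
    (hx : IsFlowLine F x) (t : ℝ) :
    HasDerivAt (fun s => F (x s)) (-‖gradient F (x t)‖ ^ 2) t := by
  have := hasDerivAt_comp_flowLine (hx t) (hF (x t))
  simpa [inner_neg_right] using this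

theorem IsFlowLine.antitone_energy {F : Plane → ℝ} (hF : Differentiable ℝ F) {x : ℝ → Plane}
    (hx : IsFlowLine F x) : Antitone fun s => F (x s) :=
  antitone_of_hasDerivAt_nonpos (fun t => hx.hasDerivAt_energy hF t) fun t => by
    simp

/-- The energy decreases strictly along a flow line that does not consist of a critical point. -/
theorem IsFlowLine.strictAnti_energy {L : ℝ} (hL : 0 < L) {F : Plane → ℝ} (hF : IsTorusFun L F)
    {x : ℝ → Plane} (hx : IsFlowLine F x) {t₀ : ℝ} (h : gradient F (x t₀) ≠ 0) :
    StrictAnti fun s => F (x s) := by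
  have hd : Differentiable ℝ F := hF.smooth.differentiable (by simp)
  refine strictAnti_of_hasDerivAt_neg (fun t => hx.hasDerivAt_energy hd t) fun t => ?_
  have : gradient F (x t) ≠ 0 := by
    intro h0
    have hc : IsFlowLine F fun _ => x t := fun s => by
      simpa [h0] using hasDerivAt_const s (x t)
    have := hF.eq_of_isFlowLine hL hx hc (t₀ := t) rfl
    apply h
    rw [congrFun this t₀, h0]
  have := norm_pos_iff.2 this
  simp only [Left.neg_neg_iff]
  positivity

theorem IsFlowLine.injective {L : ℝ} (hL : 0 < L) {F : Plane → ℝ} (hF : IsTorusFun L F)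
    {x : ℝ → Plane} (hx : IsFlowLine F x) {t₀ : ℝ} (h : gradient F (x t₀) ≠ 0) :
    Function.Injective x := fun s t hst =>
  (hx.strictAnti_energy hL hF h).injective (by simp [hst])

theorem IsFlowLine.dist_le {F : Plane → ℝ} {x : ℝ → Plane} (hx : IsFlowLine F x) {V : ℝ}
    (hV : ∀ p, ‖gradient F p‖ ≤ V) (s t : ℝ) : ‖x t - x s‖ ≤ V * |t - s| := by
  have := Convex.norm_image_sub_le_of_norm_hasDerivWithin_le (s := univ) (f := x)
    (f' := fun t => -gradient F (x t)) (C := V)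
    (fun t _ => (hx t).hasDerivWithinAt) (fun t _ => by simpa using hV (x t)) convex_univ
    (mem_univ s) (mem_univ t)
  simpa using this

theorem IsFlowLine.neg {F : Plane → ℝ} {x : ℝ → Plane} (hx : IsFlowLine F x) :
    IsFlowLine (-F) fun t => x (-t) := fun t => by
  have h := (hx (-t)).scomp t (hasDerivAt_neg t)
  have h2 : gradient (-F) (x (-t)) = -gradient F (x (-t)) := by
    simp [gradient, fderiv_neg]
  rw [h2]
  simpa [Function.comp_def] using h

/-- Gronwall's estimate for two flow lines of nearby functions. -/
theorem IsFlowLine.dist_le_gronwall {F G : Plane → ℝ} {K : NNReal}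
    (hK : LipschitzWith K (gradient F)) {x y : ℝ → Plane} (hx : IsFlowLine F x)
    (hy : IsFlowLine G y) {ε : ℝ} (h : ∀ p, ‖gradient G p - gradient F p‖ ≤ ε) (t : ℝ) :
    dist (x t) (y t) ≤ gronwallBound (dist (x 0) (y 0)) K ε |t| := by
  have main : ∀ (F G : Plane → ℝ) (x y : ℝ → Plane), LipschitzWith K (gradient F) →
      IsFlowLine F x → IsFlowLine G y → (∀ p, ‖gradient G p - gradient F p‖ ≤ ε) →
      ∀ t ≥ 0, dist (x t) (y t) ≤ gronwallBound (dist (x 0) (y 0)) K ε t := by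
    intro F G x y hK hx hy h t ht
    have := dist_le_of_approx_trajectories_ODE (v := fun _ p => -gradient F p) (f := x) (g := y)
      (f' := fun t => -gradient F (x t)) (g' := fun t => -gradient G (y t)) (a := 0) (b := t)
      (εf := 0) (εg := ε) (δ := dist (x 0) (y 0)) (fun _ => hK.neg)
      hx.continuous.continuousOn (fun t _ => (hx t).hasDerivWithinAt) (fun _ _ => by simp)
      hy.continuous.continuousOn (fun t _ => (hy t).hasDerivWithinAt)
      (fun t _ => by rw [dist_neg_neg, dist_eq_norm]; exact h _) le_rfl t ⟨ht, le_rfl⟩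
    simpa using this
  rcases le_total 0 t with ht | ht
  · rw [abs_of_nonneg ht]
    exact main F G x y hK hx hy h t ht
  · rw [abs_of_nonpos ht]
    have hn : ∀ (F : Plane → ℝ) p, gradient (-F) p = -gradient F p := by
      intro F p
      simp [gradient, fderiv_neg]
    have := main (-F) (-G) (fun t => x (-t)) (fun t => y (-t))
      (by rw [show gradient (-F) = fun p => -gradient F p from funext (hn F)]; exact hK.neg)
      hx.neg hy.neg
      (fun p => by
      rw [hn, hn, ← norm_neg]
      simpa [sub_eq_add_neg, add_comm] using h p) (-t) (by linarith)
    simpa using this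

/-! ### The space of perturbations -/

namespace Perturbation

variable {L : ℝ} {N : Set Plane}

theorem isTorusFun (g : Perturbation L N) : IsTorusFun L g.1 := ⟨g.2.1, g.2.2.1⟩

theorem eventually_iteratedFDeriv_lt (g : Perturbation L N) (i : ℕ) {ε : ℝ} (hε : 0 < ε) :
    ∀ᶠ g' in 𝓝 g, ∀ p, ‖iteratedFDeriv ℝ i g'.1 p - iteratedFDeriv ℝ i g.1 p‖ < ε := by
  have h1 : Tendsto (fun g' : Perturbation L N =>
      UniformFun.ofFun (fun p : Plane => iteratedFDeriv ℝ i g'.1 p)) (𝓝 g)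
      (𝓝 (UniformFun.ofFun (fun p : Plane => iteratedFDeriv ℝ i g.1 p))) := by
    have : Continuous (fun g' : Perturbation L N =>
      UniformFun.ofFun (fun p : Plane => iteratedFDeriv ℝ i g'.1 p)) :=
      continuous_iInf_dom (i := i) continuous_induced_dom
    exact this.continuousAt
  rw [UniformFun.tendsto_iff_tendstoUniformly, Metric.tendstoUniformly_iff] at h1
  filter_upwards [h1 ε hε] with g' h p
  have := h p
  rw [dist_comm, dist_eq_norm] at this
  simpa using this

/-- Moving a perturbation in the direction of another one. -/
def move (g h : Perturbation L N) (a : ℝ) : Perturbation L N :=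
  ⟨g.1 + a • h.1, (g.isTorusFun.add (h.isTorusFun.const_smul a)).smooth,
    (g.isTorusFun.add (h.isTorusFun.const_smul a)).periodic, fun p hp => by
      simp [g.2.2.2 p hp, h.2.2.2 p hp]⟩

theorem tendsto_move (hL : 0 < L) (g h : Perturbation L N) :
    Tendsto (move g h) (𝓝 0) (𝓝 g) := by
  rw [nhds_iInf, tendsto_iInf]
  intro i
  rw [nhds_induced, tendsto_comap_iff, UniformFun.tendsto_iff_tendstoUniformly,
    Metric.tendstoUniformly_iff]
  intro ε hε
  obtain ⟨B, hB0, hB⟩ := h.isTorusFun.exists_bound_iteratedFDeriv hL i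
  filter_upwards [Metric.ball_mem_nhds (0 : ℝ) (show 0 < ε / B by positivity)] with a ha p
  have ha' : |a| * B < ε := by
    rw [mem_ball_zero_iff, Real.norm_eq_abs, lt_div_iff₀ hB0] at ha
    exact ha
  have hi : ((i : ℕ∞) : WithTop ℕ∞) ≤ ∞ := by exact_mod_cast le_top
  have e : iteratedFDeriv ℝ i (g.1 + a • h.1) p =
      iteratedFDeriv ℝ i g.1 p + a • iteratedFDeriv ℝ i h.1 p := by
    have hh : ContDiffAt ℝ i h.1 p := h.2.1.contDiffAt.of_le hi
    have hh' : ContDiffAt ℝ i (a • h.1) p := contDiffAt_const.smul hh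
    rw [iteratedFDeriv_add_apply (g.2.1.contDiffAt.of_le hi) hh',
      iteratedFDeriv_const_smul_apply hh]
  have : dist (iteratedFDeriv ℝ i g.1 p) (iteratedFDeriv ℝ i (g.1 + a • h.1) p) < ε := by
    rw [e, dist_eq_norm, sub_add_cancel_left, norm_neg, norm_smul]
    exact (mul_le_mul_of_nonneg_left (hB p) (norm_nonneg a)).trans_lt ha'
  exact this

theorem tendsto_move_right (hL : 0 < L) (g h : Perturbation L N) :
    Tendsto (move g h) (𝓝[>] 0) (𝓝 g) :=
  (tendsto_move hL g h).mono_left nhdsWithin_le_nhds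

theorem eventually_gradient_lt (g : Perturbation L N) {ε : ℝ} (hε : 0 < ε) :
    ∀ᶠ g' in 𝓝 g, ∀ p, ‖gradient g'.1 p - gradient g.1 p‖ < ε := by
  filter_upwards [g.eventually_iteratedFDeriv_lt 1 hε] with g' h p
  have h1 : gradient g'.1 p - gradient g.1 p = gradient (g'.1 - g.1) p := by
    simp [gradient, fderiv_sub (g'.2.1.differentiable (by simp) p)
      (g.2.1.differentiable (by simp) p)]
  rw [h1, norm_gradient, ← norm_iteratedFDeriv_one,
    iteratedFDeriv_sub_apply (g'.2.1.contDiffAt.of_le (by simp))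
      (g.2.1.contDiffAt.of_le (by simp))]
  exact h p

variable {F₀ : Plane → ℝ}

theorem isTorusFun_add (hF : IsTorusFun L F₀) (g : Perturbation L N) : IsTorusFun L (F₀ + g.1) :=
  hF.add g.isTorusFun

theorem gradient_add_eq (hF : IsTorusFun L F₀) (g : Perturbation L N) (p : Plane) :
    gradient (F₀ + g.1) p = gradient F₀ p + gradient g.1 p :=
  gradient_add (hF.smooth.differentiable (by simp) p) (g.2.1.differentiable (by simp) p)

theorem continuous_gradient (hF : IsTorusFun L F₀) :
    Continuous fun q : Perturbation L N × Plane => gradient (F₀ + q.1.1) q.2 := by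
  rw [continuous_iff_continuousAt]
  rintro ⟨g, p⟩
  rw [ContinuousAt, Metric.tendsto_nhds]
  intro ε hε
  have hc : Continuous (gradient (F₀ + g.1)) :=
    (contDiff_gradient (isTorusFun_add hF g).smooth).continuous
  have h1 := (continuous_snd.tendsto (g, p)).eventually
      (Metric.tendsto_nhds.1 (hc.tendsto p) (ε / 2) (by positivity))
  have h2 := (continuous_fst.tendsto (g, p)).eventually
    (g.eventually_gradient_lt (show 0 < ε / 2 by positivity))
  filter_upwards [h1, h2] with q h1 h2
  have h3 : dist (gradient (F₀ + q.1.1) q.2) (gradient (F₀ + g.1) q.2) < ε / 2 := by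
    rw [gradient_add_eq hF, gradient_add_eq hF, dist_eq_norm, add_sub_add_left_eq_sub]
    exact h2 _
  linarith [dist_triangle (gradient (F₀ + q.1.1) q.2) (gradient (F₀ + g.1) q.2)
    (gradient (F₀ + g.1) p)]

/-- The flow depends continuously on the function, the time and the starting point. -/
theorem continuous_flow (hL : 0 < L) (hF : IsTorusFun L F₀) :
    Continuous fun q : Perturbation L N × ℝ × Plane => flow (F₀ + q.1.1) q.2.1 q.2.2 := by
  rw [continuous_iff_continuousAt]
  rintro ⟨g, t, p⟩
  rw [ContinuousAt, Metric.tendsto_nhds]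
  intro η hη
  have hg := isTorusFun_add hF g
  obtain ⟨K', hK'⟩ := hg.exists_lipschitz hL
  set K : NNReal := K' + 1
  have hK : LipschitzWith K (gradient (F₀ + g.1)) := hK'.weaken (by simp [K])
  have hK0 : (0 : ℝ) < K := by positivity
  set C : ℝ := Real.exp (K * (|t| + 1)) * (1 + 1 / K) with hC
  have hC0 : 0 < C := by positivity
  set ε : ℝ := η / (2 * C) with hε
  have hε0 : 0 < ε := by positivity
  have hx := hg.isFlowLine_flow hL p
  have ht : Tendsto (fun q : Perturbation L N × ℝ × Plane => q.2.1) (𝓝 (g, t, p)) (𝓝 t) :=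
    (continuous_fst.comp continuous_snd).tendsto (g, t, p)
  have hp : Tendsto (fun q : Perturbation L N × ℝ × Plane => q.2.2) (𝓝 (g, t, p)) (𝓝 p) :=
    (continuous_snd.comp continuous_snd).tendsto (g, t, p)
  have h1 := ht.eventually
    (Metric.tendsto_nhds.1 (hx.continuous.tendsto t) (η / 2) (by positivity))
  have h2 := (continuous_fst.tendsto (g, t, p)).eventually (g.eventually_gradient_lt hε0)
  have h3 := hp.eventually (Metric.ball_mem_nhds p hε0)
  have h4 := (ht.abs).eventually (Iio_mem_nhds (show |t| < |t| + 1 by simp))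
  filter_upwards [h1, h2, h3, h4] with q h1 h2 h3 h4
  have hq := isTorusFun_add hF q.1
  have hy := hq.isFlowLine_flow hL q.2.2
  have h5 := hx.dist_le_gronwall hK hy (ε := ε) (fun p => by
    rw [gradient_add_eq hF, gradient_add_eq hF, add_sub_add_left_eq_sub]
    exact (h2 p).le) q.2.1
  rw [hg.flow_zero hL, hq.flow_zero hL, gronwallBound_of_K_ne_0 hK0.ne'] at h5
  have h6 : Real.exp (K * |q.2.1|) ≤ Real.exp (K * (|t| + 1)) :=
    Real.exp_le_exp.2 (mul_le_mul_of_nonneg_left (le_of_lt h4) hK0.le)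
  have h7 : dist (flow (F₀ + g.1) q.2.1 p) (flow (F₀ + q.1.1) q.2.1 q.2.2) ≤ η / 2 := by
    refine h5.trans ?_
    beta_reduce
    have : η / 2 = ε * Real.exp (K * (|t| + 1)) + ε / K * Real.exp (K * (|t| + 1)) := by
      rw [hε, hC]
      field_simp
    rw [this]
    have h3 : dist p q.2.2 ≤ ε := by
      rw [dist_comm]
      exact le_of_lt h3
    have : Real.exp (K * |q.2.1|) - 1 ≤ Real.exp (K * (|t| + 1)) := by linarith
    gcongr
  rw [dist_comm] at h7
  linarith [dist_triangle (flow (F₀ + q.1.1) q.2.1 q.2.2) (flow (F₀ + g.1) q.2.1 p)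
    (flow (F₀ + g.1) t p)]

/-- The perturbations whose derivatives up to order one stay uniformly below `ε`. -/
def small (L : ℝ) (N : Set Plane) (ε : ℝ) : Set (Perturbation L N) :=
  {g | ∃ ε' < ε, ∀ i ≤ 1, ∀ p, ‖iteratedFDeriv ℝ i g.1 p‖ ≤ ε'}

theorem isOpen_small (ε : ℝ) : IsOpen (small L N ε) := by
  rw [isOpen_iff_mem_nhds]
  rintro g ⟨ε', hε', h⟩
  have h0 : 0 < (ε - ε') / 2 := by linarith
  filter_upwards [g.eventually_iteratedFDeriv_lt 0 h0, g.eventually_iteratedFDeriv_lt 1 h0]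
    with g' h1 h2
  refine ⟨(ε + ε') / 2, by linarith, fun i hi p => ?_⟩
  have h3 := h i hi p
  have h4 : ‖iteratedFDeriv ℝ i g'.1 p - iteratedFDeriv ℝ i g.1 p‖ < (ε - ε') / 2 := by
    interval_cases i
    · exact h1 p
    · exact h2 p
  have h5 := norm_add_le (iteratedFDeriv ℝ i g'.1 p - iteratedFDeriv ℝ i g.1 p)
    (iteratedFDeriv ℝ i g.1 p)
  rw [sub_add_cancel] at h5
  linarith

theorem mem_small_of_cnSmall {g : Perturbation L N} {ε : ℝ} (hε : 0 < ε)
    (h : CnSmall 1 (ε / 2) g.1) : g ∈ small L N ε :=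
  ⟨ε / 2, by linarith, fun i hi p => (h i hi p).le⟩

theorem abs_lt_of_mem_small {g : Perturbation L N} {ε : ℝ} (h : g ∈ small L N ε) (p : Plane) :
    |g.1 p| < ε := by
  obtain ⟨ε', hε', h⟩ := h
  have := h 0 (by simp) p
  rw [norm_iteratedFDeriv_zero] at this
  exact this.trans_lt hε'

theorem norm_gradient_lt_of_mem_small {g : Perturbation L N} {ε : ℝ} (h : g ∈ small L N ε)
    (p : Plane) : ‖gradient g.1 p‖ < ε := by
  obtain ⟨ε', hε', h⟩ := h
  have := h 1 le_rfl p
  rw [norm_iteratedFDeriv_one, ← norm_gradient] at this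
  exact this.trans_lt hε'

end Perturbation

/-! ### Divided differences and collinear points of the knot -/

namespace IsKnot

variable {L : ℝ} {γ : ℝ → Space}

theorem periodic_int (h : IsKnot L γ) (s : ℝ) (k : ℤ) : γ (s + k * L) = γ s := by
  have : Function.Periodic γ L := h.periodic
  simpa using this.int_mul k s

theorem deriv_periodic_int (h : IsKnot L γ) (s : ℝ) (k : ℤ) :
    deriv γ (s + k * L) = deriv γ s := by
  rw [← deriv_comp_add_const]
  congr 1
  ext1 t
  exact h.periodic_int t k

theorem deriv_deriv_periodic_int (h : IsKnot L γ) (s : ℝ) (k : ℤ) :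
    deriv (deriv γ) (s + k * L) = deriv (deriv γ) s := by
  rw [← deriv_comp_add_const]
  congr 1
  ext1 t
  exact h.deriv_periodic_int t k

theorem continuous (h : IsKnot L γ) : Continuous γ := h.smooth.continuous

theorem differentiable (h : IsKnot L γ) : Differentiable ℝ γ := h.smooth.differentiable (by simp)

theorem contDiff_deriv (h : IsKnot L γ) : ContDiff ℝ ∞ (deriv γ) :=
  (contDiff_infty_iff_deriv.1 h.smooth).2

theorem contDiff_deriv_deriv (h : IsKnot L γ) : ContDiff ℝ ∞ (deriv (deriv γ)) :=
  (contDiff_infty_iff_deriv.1 h.contDiff_deriv).2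

theorem hasDerivAt (h : IsKnot L γ) (s : ℝ) : HasDerivAt γ (deriv γ s) s :=
  (h.differentiable s).hasDerivAt

theorem hasDerivAt_deriv (h : IsKnot L γ) (s : ℝ) : HasDerivAt (deriv γ) (deriv (deriv γ) s) s :=
  (h.contDiff_deriv.differentiable (by simp) s).hasDerivAt

theorem inner_deriv_deriv (h : IsKnot L γ) (s : ℝ) :
    inner ℝ (deriv γ s) (deriv (deriv γ) s) = 0 := by
  have h1 := (h.hasDerivAt_deriv s).inner ℝ (h.hasDerivAt_deriv s)
  have h2 : (fun t => inner ℝ (deriv γ t) (deriv γ t)) = fun _ => (1 : ℝ) := by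
    ext t
    rw [real_inner_self_eq_norm_sq, h.unitSpeed, one_pow]
  rw [h2] at h1
  have h3 := h1.unique (hasDerivAt_const s (1 : ℝ))
  rw [real_inner_comm (deriv γ s)] at h3
  linarith

theorem exists_bound (h : IsKnot L γ) {E : Type*} [NormedAddCommGroup E] {φ : ℝ → E}
    (hc : Continuous φ) (hp : ∀ s (k : ℤ), φ (s + k * L) = φ s) : ∃ B > 0, ∀ s, ‖φ s‖ ≤ B := by
  obtain ⟨B, hB⟩ := (isCompact_Icc (a := (0 : ℝ)) (b := L)).exists_bound_of_continuousOn
    hc.continuousOn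
  refine ⟨max B 1, by positivity, fun s => ?_⟩
  obtain ⟨k, hk⟩ := exists_shift_mem_Ico h.pos s
  rw [← hp s k]
  exact (hB _ (Ico_subset_Icc_self hk)).trans (le_max_left _ _)

/-- The velocity and the acceleration of the knot are Lipschitz. -/
theorem exists_lipschitz (h : IsKnot L γ) : ∃ B ≥ 1,
    (∀ a b, ‖deriv γ b - deriv γ a‖ ≤ B * |b - a|) ∧
    (∀ s, ‖deriv (deriv γ) s‖ ≤ B) ∧
    ∀ a b, ‖deriv (deriv γ) b - deriv (deriv γ) a‖ ≤ B * |b - a| := by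
  obtain ⟨B₁, -, hB₁⟩ := h.exists_bound h.contDiff_deriv_deriv.continuous h.deriv_deriv_periodic_int
  obtain ⟨B₂, -, hB₂⟩ := h.exists_bound
    ((contDiff_infty_iff_deriv.1 h.contDiff_deriv_deriv).2.continuous) (fun s k => by
      rw [← deriv_comp_add_const]
      congr 1
      ext1 t
      exact h.deriv_deriv_periodic_int t k)
  refine ⟨max 1 (max B₁ B₂), le_max_left _ _, fun a b => ?_, fun s => (hB₁ s).trans (by simp),
    fun a b => ?_⟩
  · have := Convex.norm_image_sub_le_of_norm_deriv_le (f := deriv γ) (s := univ)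
      (C := max 1 (max B₁ B₂)) (fun t _ => (h.hasDerivAt_deriv t).differentiableAt)
      (fun t _ => (hB₁ t).trans (by simp)) convex_univ (mem_univ a) (mem_univ b)
    simpa using this
  · have := Convex.norm_image_sub_le_of_norm_deriv_le (f := deriv (deriv γ)) (s := univ)
      (C := max 1 (max B₁ B₂)) (fun t _ => h.contDiff_deriv_deriv.differentiable (by simp) t)
      (fun t _ => (hB₂ t).trans (by simp)) convex_univ (mem_univ a) (mem_univ b)
    simpa using this

theorem norm_sub_le (h : IsKnot L γ) (a b : ℝ) : ‖γ b - γ a‖ ≤ |b - a| := by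
  have := Convex.norm_image_sub_le_of_norm_deriv_le (f := γ) (s := univ)
      (C := 1) (fun t _ => h.differentiable t)
      (fun t _ => (h.unitSpeed t).le) convex_univ (mem_univ a) (mem_univ b)
  simpa using this

end IsKnot

/-- The divided difference `(γ r - γ s) / (r - s)`, extended by the velocity to `r = s`. -/
def secant (γ : ℝ → Space) (s r : ℝ) : Space := ∫ θ in (0 : ℝ)..1, deriv γ (s + θ * (r - s))

theorem sub_eq_smul_secant {L : ℝ} {γ : ℝ → Space} (h : IsKnot L γ) (s r : ℝ) :
    γ r - γ s = (r - s) • secant γ s r := by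
  have h1 : ∀ θ : ℝ, HasDerivAt (fun θ : ℝ => γ (s + θ * (r - s)))
      ((r - s) • deriv γ (s + θ * (r - s))) θ := by
    intro θ
    have h0 : HasDerivAt (fun θ : ℝ => s + θ * (r - s)) (r - s) θ := by
      simpa using ((hasDerivAt_id θ).mul_const (r - s)).const_add s
    exact (h.hasDerivAt (s + θ * (r - s))).scomp θ h0
  have hc : Continuous fun θ : ℝ => deriv γ (s + θ * (r - s)) :=
    h.contDiff_deriv.continuous.comp (by fun_prop)
  have h2 := intervalIntegral.integral_eq_sub_of_hasDerivAt (a := 0) (b := 1)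
    (fun θ _ => h1 θ) ((hc.const_smul (r - s)).intervalIntegrable 0 1)
  rw [intervalIntegral.integral_smul] at h2
  simp only [one_mul, zero_mul, add_zero, add_sub_cancel] at h2
  rw [secant, h2]

theorem intervalIntegrable_secant {L : ℝ} {γ : ℝ → Space} (h : IsKnot L γ) (s r : ℝ) :
    IntervalIntegrable (fun θ : ℝ => deriv γ (s + θ * (r - s))) MeasureTheory.volume 0 1 :=
  (h.contDiff_deriv.continuous.comp (by fun_prop)).intervalIntegrable 0 1

theorem abs_convex_combination_le {θ a b c : ℝ} (h0 : 0 ≤ θ) (h1 : θ ≤ 1) (ha : |a| ≤ c)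
    (hb : |b| ≤ c) : |a + θ * (b - a)| ≤ c := by
  rw [abs_le] at *
  constructor <;> nlinarith

theorem norm_secant_sub_le {L : ℝ} {γ : ℝ → Space} (h : IsKnot L γ) {B : ℝ}
    (hB0 : 0 ≤ B) (hB : ∀ a b, ‖deriv γ b - deriv γ a‖ ≤ B * |b - a|) {s r u ρ : ℝ}
    (hs : |s - u| ≤ ρ) (hr : |r - u| ≤ ρ) : ‖secant γ s r - deriv γ u‖ ≤ B * ρ := by
  have h1 : secant γ s r - deriv γ u =
      ∫ θ in (0 : ℝ)..1, (deriv γ (s + θ * (r - s)) - deriv γ u) := by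
    rw [intervalIntegral.integral_sub (intervalIntegrable_secant h s r) (by simp)]
    simp [secant]
  rw [h1]
  have := intervalIntegral.norm_integral_le_of_norm_le_const (a := 0) (b := 1) (C := B * ρ)
    (f := fun θ : ℝ => deriv γ (s + θ * (r - s)) - deriv γ u) (fun θ hθ => by
      rw [uIoc_of_le zero_le_one] at hθ
      refine (hB _ _).trans (mul_le_mul_of_nonneg_left ?_ hB0)
      have := abs_convex_combination_le hθ.1.le hθ.2 hs hr
      rwa [show s + θ * (r - s) - u = s - u + θ * (r - u - (s - u)) by ring])
  simpa using this

/-- The second divided difference of the knot is close to half its acceleration. -/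
theorem norm_secant_sub_secant_le {L : ℝ} {γ : ℝ → Space} (h : IsKnot L γ) {B : ℝ}
    (hB0 : 0 ≤ B) (hB : ∀ a b, ‖deriv (deriv γ) b - deriv (deriv γ) a‖ ≤ B * |b - a|)
    {s r s' r' u ρ : ℝ} (hs : |s - u| ≤ ρ) (hr : |r - u| ≤ ρ) (hs' : |s' - u| ≤ ρ)
    (hr' : |r' - u| ≤ ρ) :
    ‖secant γ s' r' - secant γ s r - (((s' - s) + (r' - r)) / 2) • deriv (deriv γ) u‖ ≤
      B * ρ * (|s' - s| + |r' - r|) := by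
  have hρ : 0 ≤ ρ := (abs_nonneg _).trans hs
  have hmv : ∀ a b, |a - u| ≤ ρ → |b - u| ≤ ρ →
      ‖deriv γ b - deriv γ a - (b - a) • deriv (deriv γ) u‖ ≤ B * ρ * |b - a| := by
    intro a b ha hb
    have := Convex.norm_image_sub_le_of_norm_hasDerivWithin_le (s := Metric.closedBall u ρ)
      (f := fun t => deriv γ t - t • deriv (deriv γ) u)
      (f' := fun t => deriv (deriv γ) t - (1 : ℝ) • deriv (deriv γ) u) (C := B * ρ)
      (x := a) (y := b)
      (fun t _ => ((h.hasDerivAt_deriv t).sub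
        ((hasDerivAt_id t).smul_const _)).hasDerivWithinAt)
      (fun t ht => by
        rw [one_smul]
        refine (hB u t).trans (mul_le_mul_of_nonneg_left ?_ hB0)
        rwa [Metric.mem_closedBall, Real.dist_eq] at ht)
      (convex_closedBall u ρ) (by rwa [Metric.mem_closedBall, Real.dist_eq])
      (by rwa [Metric.mem_closedBall, Real.dist_eq])
    rw [Real.norm_eq_abs] at this
    have e : deriv γ b - deriv γ a - (b - a) • deriv (deriv γ) u =
        deriv γ b - b • deriv (deriv γ) u - (deriv γ a - a • deriv (deriv γ) u) := by
      rw [sub_smul]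
      abel
    rw [e]
    exact this
  have hlin : ∫ θ in (0 : ℝ)..1, ((s' - s) + θ * ((r' - r) - (s' - s))) =
      ((s' - s) + (r' - r)) / 2 := by
    rw [intervalIntegral.integral_add (by simp)
      ((by fun_prop : Continuous fun θ : ℝ => θ * ((r' - r) - (s' - s))).intervalIntegrable _ _),
      intervalIntegral.integral_mul_const, integral_id]
    simp
    ring
  have hi : IntervalIntegrable (fun θ : ℝ =>
      ((s' - s) + θ * ((r' - r) - (s' - s))) • deriv (deriv γ) u) MeasureTheory.volume 0 1 :=
    (by fun_prop : Continuous fun θ : ℝ =>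
      ((s' - s) + θ * ((r' - r) - (s' - s))) • deriv (deriv γ) u).intervalIntegrable _ _
  have h1 : secant γ s' r' - secant γ s r - (((s' - s) + (r' - r)) / 2) • deriv (deriv γ) u =
      ∫ θ in (0 : ℝ)..1, (deriv γ (s' + θ * (r' - s')) - deriv γ (s + θ * (r - s)) -
        ((s' - s) + θ * ((r' - r) - (s' - s))) • deriv (deriv γ) u) := by
    rw [intervalIntegral.integral_sub ((intervalIntegrable_secant h s' r').sub
      (intervalIntegrable_secant h s r)) hi, intervalIntegral.integral_sub
      (intervalIntegrable_secant h s' r') (intervalIntegrable_secant h s r),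
      intervalIntegral.integral_smul_const, hlin]
    rfl
  rw [h1]
  have := intervalIntegral.norm_integral_le_of_norm_le_const (a := 0) (b := 1)
    (C := B * ρ * (|s' - s| + |r' - r|))
    (f := fun θ : ℝ => deriv γ (s' + θ * (r' - s')) - deriv γ (s + θ * (r - s)) -
        ((s' - s) + θ * ((r' - r) - (s' - s))) • deriv (deriv γ) u) (fun θ hθ => by
      rw [uIoc_of_le zero_le_one] at hθ
      have ha := abs_convex_combination_le hθ.1.le hθ.2 hs hr
      have hb := abs_convex_combination_le hθ.1.le hθ.2 hs' hr'
      have e : s' - s + θ * (r' - r - (s' - s)) =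
        (s' + θ * (r' - s')) - (s + θ * (r - s)) := by ring
      rw [e]
      refine (hmv (s + θ * (r - s)) (s' + θ * (r' - s')) ?_ ?_).trans
        (mul_le_mul_of_nonneg_left ?_ (by positivity))
      · rwa [show s + θ * (r - s) - u = s - u + θ * (r - u - (s - u)) by ring]
      · rwa [show s' + θ * (r' - s') - u = s' - u + θ * (r' - u - (s' - u)) by ring]
      · rw [← e]
        refine abs_convex_combination_le hθ.1.le hθ.2 ?_ ?_
        · linarith [abs_nonneg (r' - r)]
        · linarith [abs_nonneg (s' - s)])
  simpa using this

/-- A vector `P` close to `T`, of norm almost one, has no multiple close to `(δ / 2) • N`, where `N`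
is orthogonal to `T`. -/
theorem false_of_secant_close {E : Type*} [NormedAddCommGroup E] [InnerProductSpace ℝ E]
    {T N P : E} {κ δ μ : ℝ} (hTN : inner ℝ T N = 0) (hκ : 0 < κ) (hNk : κ ≤ ‖N‖)
    (hPn : 7 / 8 ≤ ‖P‖) (hPT : ‖P - T‖ ≤ 1 / 8) (hδ : 0 < δ)
    (hPQ : ‖μ • P - (δ / 2) • N‖ ≤ κ / 8 * δ) : False := by
  have h1 : |inner ℝ P N| ≤ 1 / 8 * ‖N‖ := by
    have e : inner ℝ P N = inner ℝ (P - T) N := by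
      rw [inner_sub_left, hTN, sub_zero]
    rw [e]
    refine (abs_real_inner_le_norm _ _).trans ?_
    gcongr
  have h2 : |μ| * ‖P‖ ≤ δ / 2 * ‖N‖ + κ / 8 * δ := by
    rw [← Real.norm_eq_abs, ← norm_smul]
    have := norm_le_norm_add_norm_sub' (μ • P) ((δ / 2) • N)
    rw [norm_smul (δ / 2), Real.norm_eq_abs, abs_of_pos (by linarith)] at this
    linarith
  have h3 : |μ * inner ℝ P N - δ / 2 * ‖N‖ ^ 2| ≤ κ / 8 * δ * ‖N‖ := by
    have e : μ * inner ℝ P N - δ / 2 * ‖N‖ ^ 2 = inner ℝ (μ • P - (δ / 2) • N) N := by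
      rw [inner_sub_left, real_inner_smul_left, real_inner_smul_left, real_inner_self_eq_norm_sq]
    rw [e]
    refine (abs_real_inner_le_norm _ _).trans ?_
    gcongr
  have hN0 : 0 < ‖N‖ := by linarith
  have h4 : δ / 2 * ‖N‖ ^ 2 - κ / 8 * δ * ‖N‖ ≤ |μ| * (1 / 8 * ‖N‖) := by
    have h5 : μ * inner ℝ P N ≤ |μ| * (1 / 8 * ‖N‖) :=
      (le_abs_self _).trans (by rw [abs_mul]; gcongr)
    linarith [(abs_le.1 h3).1]
  have h6 : |μ| * (7 / 8) ≤ δ * ‖N‖ * (5 / 8) := by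
    have : |μ| * (7 / 8) ≤ |μ| * ‖P‖ := by gcongr
    have : κ / 8 * δ ≤ ‖N‖ / 8 * δ := by gcongr
    linarith
  have h7 : κ / 8 * δ * ‖N‖ ≤ ‖N‖ / 8 * δ * ‖N‖ := by gcongr
  have h8 : 0 < δ * ‖N‖ ^ 2 := by positivity
  have h9 : |μ| * (7 / 8) * ‖N‖ ≤ δ * ‖N‖ * (5 / 8) * ‖N‖ := by gcongr
  nlinarith

namespace IsGenericKnot

variable {L : ℝ} {γ : ℝ → Space}

theorem exists_curvature_bound (hK : IsGenericKnot L γ) :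
    ∃ κ > 0, ∀ s, κ ≤ ‖deriv (deriv γ) s‖ := by
  obtain ⟨κ, hκ, h⟩ := (isCompact_Icc (a := (0 : ℝ)) (b := L)).exists_forall_le' (a := 0)
    (f := fun s => ‖deriv (deriv γ) s‖) hK.contDiff_deriv_deriv.continuous.norm.continuousOn
    (fun s _ => norm_pos_iff.2 (hK.curvature s))
  refine ⟨κ, hκ, fun s => ?_⟩
  obtain ⟨k, hk⟩ := exists_shift_mem_Ico hK.pos s
  rw [← hK.deriv_deriv_periodic_int s k]
  exact h _ (Ico_subset_Icc_self hk)

/-- Consecutive differences of three ordered points of a short arc are not parallel: otherwise the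
second divided difference, which is close to half the acceleration, would be parallel to the
velocity. -/
theorem exists_not_collinear_of_lt (hK : IsGenericKnot L γ) : ∃ ρ > 0, ∀ u a b c,
    |a - u| ≤ ρ → |b - u| ≤ ρ → |c - u| ≤ ρ → a < b → b < c →
      ¬ ∃ v : Space, ∃ x y : ℝ, γ b - γ a = x • v ∧ γ c - γ b = y • v := by
  obtain ⟨κ, hκ, hκ'⟩ := hK.exists_curvature_bound
  obtain ⟨B, hB1, hB, hBs, hB'⟩ := hK.toIsKnot.exists_lipschitz
  have hB0 : 0 ≤ B := by linarith
  -- `ρ` is chosen so that secants are within `1/8` of the velocity at `u` and their differences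
  -- are, to relative accuracy `1/8`, half the acceleration there
  set ρ : ℝ := min (κ / (8 * B)) (1 / (8 * B)) with hρ
  have hρ0 : 0 < ρ := by positivity
  have hρ1 : B * ρ ≤ κ / 8 := by
    have : ρ ≤ κ / (8 * B) := min_le_left _ _
    rw [le_div_iff₀ (by positivity)] at this
    linarith
  have hρ2 : B * ρ ≤ 1 / 8 := by
    have : ρ ≤ 1 / (8 * B) := min_le_right _ _
    rw [le_div_iff₀ (by positivity)] at this
    linarith
  refine ⟨ρ, hρ0, ?_⟩
  rintro u a b c ha hb hc hab hbc ⟨v, x, y, hx, hy⟩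
  set N := deriv (deriv γ) u with hN
  set P := secant γ a b with hP
  set Q := secant γ b c with hQ
  have hNk : κ ≤ ‖N‖ := hκ' u
  have hPT := norm_secant_sub_le hK.toIsKnot hB0 hB ha hb
  have hPQ := norm_secant_sub_secant_le hK.toIsKnot hB0 hB' ha hb hb hc
  rw [← hP] at hPT
  rw [← hP, ← hQ, ← hN, abs_of_pos (sub_pos.2 hab), abs_of_pos (sub_pos.2 hbc),
    show (b - a + (c - b)) = c - a by ring] at hPQ
  have hca : 0 < c - a := by linarith
  have hPn : 7 / 8 ≤ ‖P‖ := by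
    have h1 := hK.unitSpeed u
    have h2 := norm_sub_norm_le (deriv γ u) P
    rw [norm_sub_rev] at h2
    linarith
  -- `Q` is a multiple of `P`
  rw [sub_eq_smul_secant hK.toIsKnot] at hx hy
  rw [← hP] at hx
  rw [← hQ] at hy
  have hx0 : x ≠ 0 := by
    rintro rfl
    rw [zero_smul, smul_eq_zero] at hx
    rcases hx with h | h
    · linarith
    · rw [h, norm_zero] at hPn
      linarith
  obtain ⟨μ, hμ⟩ : ∃ μ : ℝ, Q = P + μ • P := by
    refine ⟨(c - b)⁻¹ * (y * (x⁻¹ * (b - a))) - 1, ?_⟩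
    have h1 : v = (x⁻¹ * (b - a)) • P := by
      rw [mul_smul, hx, smul_smul, inv_mul_cancel₀ hx0, one_smul]
    have h2 : Q = (c - b)⁻¹ • ((c - b) • Q) := by
      rw [smul_smul, inv_mul_cancel₀ (by linarith), one_smul]
    rw [h2, hy, h1, sub_smul, one_smul, smul_smul, smul_smul]
    simp [mul_assoc]
  have hQP : Q - P = μ • P := by rw [hμ]; simp
  rw [hQP] at hPQ
  have h3 : B * ρ * (c - a) ≤ κ / 8 * (c - a) := by gcongr
  exact false_of_secant_close (hK.toIsKnot.inner_deriv_deriv u) hκ hNk hPn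
    (hPT.trans hρ2) hca (hPQ.trans h3)

/-- Three different points of a short arc of the knot are not collinear, since the curvature does
not vanish. -/
theorem exists_not_collinear (hK : IsGenericKnot L γ) : ∃ ρ > 0, ∀ u a b c,
    |a - u| ≤ ρ → |b - u| ≤ ρ → |c - u| ≤ ρ → a ≠ b → b ≠ c → a ≠ c →
      ¬ Collinear ℝ {γ a, γ b, γ c} := by
  obtain ⟨ρ, hρ, h⟩ := hK.exists_not_collinear_of_lt
  have key : ∀ u a b c, |a - u| ≤ ρ → |b - u| ≤ ρ → |c - u| ≤ ρ → a < b → b < c →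
      ¬ Collinear ℝ {γ a, γ b, γ c} := by
    intro u a b c ha hb hc hab hbc hcol
    obtain ⟨v, hv⟩ := (collinear_iff_of_mem (p₀ := γ b) (by simp)).1 hcol
    obtain ⟨x, hx⟩ := hv (γ a) (by simp)
    obtain ⟨y, hy⟩ := hv (γ c) (by simp)
    refine h u a b c ha hb hc hab hbc ⟨v, -x, y, ?_, ?_⟩
    · rw [hx]
      simp
    · rw [hy]
      simp
  refine ⟨ρ, hρ, fun u a b c ha hb hc hab hbc hac => ?_⟩
  have e1 : ({γ a, γ c, γ b} : Set Space) = {γ a, γ b, γ c} := by grind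
  have e2 : ({γ b, γ a, γ c} : Set Space) = {γ a, γ b, γ c} := by grind
  have e3 : ({γ b, γ c, γ a} : Set Space) = {γ a, γ b, γ c} := by grind
  have e4 : ({γ c, γ a, γ b} : Set Space) = {γ a, γ b, γ c} := by grind
  have e5 : ({γ c, γ b, γ a} : Set Space) = {γ a, γ b, γ c} := by grind
  rcases lt_or_gt_of_ne hab with h1 | h1 <;> rcases lt_or_gt_of_ne hbc with h2 | h2 <;>
    rcases lt_or_gt_of_ne hac with h3 | h3
  · exact key u a b c ha hb hc h1 h2
  · linarith
  · rw [← e1]; exact key u a c b ha hc hb h3 h2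
  · rw [← e4]; exact key u c a b hc ha hb h3 h1
  · rw [← e2]; exact key u b a c hb ha hc h1 h3
  · rw [← e3]; exact key u b c a hb hc ha h2 h3
  · linarith
  · rw [← e5]; exact key u c b a hc hb ha h2 h1

/-- A line meets a compact arc of the knot finitely often. -/
theorem finite_collinear (hK : IsGenericKnot L γ) {a b : ℝ} {P Q : Space} (hPQ : P ≠ Q) :
    {t ∈ Icc a b | Collinear ℝ {P, Q, γ t}}.Finite := by
  obtain ⟨ρ, hρ, h⟩ := hK.exists_not_collinear
  by_contra hinf
  obtain ⟨u, -, hu⟩ := Set.Infinite.exists_accPt_of_subset_isCompact (show Set.Infinite _ from hinf)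
    isCompact_Icc (fun t ht => ht.1)
  have h1 : AccPt u (𝓟 ({t ∈ Icc a b | Collinear ℝ {P, Q, γ t}} ∩ Metric.closedBall u ρ)) := by
    exact hu.nhds_inter (Metric.closedBall_mem_nhds u hρ) |> fun h => by rwa [inter_comm] at h
  obtain ⟨T, hT, hT3⟩ := (Set.Infinite.of_accPt h1).exists_subset_ncard_eq 3
  obtain ⟨x, y, z, hxy, hxz, hyz, rfl⟩ := Set.ncard_eq_three.1 hT3.2
  have hx := hT (show x ∈ _ by simp)
  have hy := hT (show y ∈ _ by simp)
  have hz := hT (show z ∈ _ by simp)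
  refine h u x y z hx.2 hy.2 hz.2 hxy hyz hxz ?_
  have hl : ∀ t, Collinear ℝ {P, Q, γ t} → γ t ∈ line[ℝ, P, Q] := fun t ht =>
    ht.mem_affineSpan_of_mem_of_ne (by simp) (by simp) (by simp) hPQ
  exact collinear_triple_of_mem_affineSpan_pair (hl _ hx.1.2) (hl _ hy.1.2) (hl _ hz.1.2)

end IsGenericKnot

/-! ### Crossings and the energy of cords -/

/-- The knot point with parameter `r` lies in the interior of the cord from `γ s` to `γ t`. -/
def IsCrossing (γ : ℝ → Space) (s t r : ℝ) : Prop :=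
  γ s ≠ γ t ∧ γ r ∈ openSegment ℝ (γ s) (γ t)

theorem mem_crossings {γ : ℝ → Space} {p : Plane} {r : ℝ} :
    r ∈ crossings γ p ↔ IsCrossing γ (p 0) (p 1) r := Iff.rfl

namespace IsCrossing

variable {γ : ℝ → Space} {s t r : ℝ}

theorem symm (h : IsCrossing γ s t r) : IsCrossing γ t s r :=
  ⟨h.1.symm, by rw [openSegment_symm]; exact h.2⟩

theorem exists_ratio (h : IsCrossing γ s t r) : ∃ θ ∈ Ioo (0 : ℝ) 1,
    γ r - γ s = θ • (γ t - γ s) ∧ γ t - γ r = (1 - θ) • (γ t - γ s) := by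
  have h2 := h.2
  rw [openSegment_eq_image'] at h2
  obtain ⟨θ, hθ, h3⟩ := h2
  have h4 : γ r = γ s + θ • (γ t - γ s) := h3.symm
  refine ⟨θ, hθ, ?_, ?_⟩
  · rw [h4]
    simp
  · rw [h4, sub_smul, one_smul]
    abel

theorem iff_sbtw : IsCrossing γ s t r ↔ Sbtw ℝ (γ s) (γ r) (γ t) := by
  rw [sbtw_iff_mem_image_Ioo_and_ne, ← openSegment_eq_image_lineMap, IsCrossing, and_comm]

theorem iff_dist : IsCrossing γ s t r ↔
    dist (γ s) (γ r) + dist (γ r) (γ t) = dist (γ s) (γ t) ∧ 0 < dist (γ s) (γ r) ∧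
      0 < dist (γ r) (γ t) := by
  rw [iff_sbtw, Sbtw, dist_add_dist_eq_iff, dist_pos, dist_pos, ne_comm]

theorem collinear (h : IsCrossing γ s t r) : Collinear ℝ {γ s, γ r, γ t} :=
  (iff_sbtw.1 h).wbtw.collinear

theorem shift {L : ℝ} (hK : IsKnot L γ) (h : IsCrossing γ s t r) (i j k : ℤ) :
    IsCrossing γ (s + i * L) (t + j * L) (r + k * L) := by
  simpa only [IsCrossing, hK.periodic_int] using h

end IsCrossing

theorem isInvariant_cordsMeetingKnot {L : ℝ} {γ : ℝ → Space} (hK : IsKnot L γ) :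
    IsInvariant L (cordsMeetingKnot γ) := by
  rintro p ⟨r, hr⟩ v hv
  obtain ⟨⟨j, hj⟩, ⟨k, hk⟩⟩ := mem_lattice_iff.1 hv
  refine ⟨r, ?_⟩
  rw [mem_crossings] at hr ⊢
  have := hr.shift hK j k 0
  simpa [hj, hk] using this

/-- The marked cords whose crossing point has distance at least `d` from both ends of the cord. -/
def markedFar (γ : ℝ → Space) (d : ℝ) : Set (Plane × ℝ) :=
  {q | dist (γ (q.1 0)) (γ q.2) + dist (γ q.2) (γ (q.1 1)) = dist (γ (q.1 0)) (γ (q.1 1)) ∧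
    d ≤ dist (γ (q.1 0)) (γ q.2) ∧ d ≤ dist (γ q.2) (γ (q.1 1))}

theorem isClosed_markedFar {γ : ℝ → Space} (hγ : Continuous γ) (d : ℝ) :
    IsClosed (markedFar γ d) := by
  have h0 : Continuous fun q : Plane × ℝ => γ (q.1 0) :=
    hγ.comp ((continuous_coord 0).comp continuous_fst)
  have h1 : Continuous fun q : Plane × ℝ => γ (q.1 1) :=
    hγ.comp ((continuous_coord 1).comp continuous_fst)
  have h2 : Continuous fun q : Plane × ℝ => γ q.2 := hγ.comp continuous_snd
  exact (isClosed_eq ((h0.dist h2).add (h2.dist h1)) (h0.dist h1)).inter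
    ((isClosed_le continuous_const (h0.dist h2)).inter
      (isClosed_le continuous_const (h2.dist h1)))

theorem markedFar_subset {γ : ℝ → Space} {d : ℝ} (hd : 0 < d) :
    markedFar γ d ⊆ markedCords γ := fun _ hq =>
  mem_crossings.2 (IsCrossing.iff_dist.2 ⟨hq.1, hd.trans_le hq.2.1, hd.trans_le hq.2.2⟩)

theorem mem_cordsMeetingKnot_of_mem_markedCords {γ : ℝ → Space} {q : Plane × ℝ}
    (hq : q ∈ markedCords γ) : q.1 ∈ cordsMeetingKnot γ := ⟨q.2, hq⟩

theorem markedFar_anti {γ : ℝ → Space} {d d' : ℝ} (h : d ≤ d') :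
    markedFar γ d' ⊆ markedFar γ d := fun _ hq =>
  ⟨hq.1, h.trans hq.2.1, h.trans hq.2.2⟩

theorem exists_mem_markedFar {γ : ℝ → Space} {q : Plane × ℝ} (hq : q ∈ markedCords γ) :
    ∃ d > 0, q ∈ markedFar γ d := by
  obtain ⟨h1, h2, h3⟩ := IsCrossing.iff_dist.1 (mem_crossings.1 hq)
  exact ⟨_, lt_min h2 h3, h1, min_le_left _ _, min_le_right _ _⟩

theorem IsKnot.markedFar_shift {L : ℝ} {γ : ℝ → Space} (hK : IsKnot L γ) {d : ℝ}
    {p : Plane} {r : ℝ} {v : Plane} (hv : v ∈ lattice L) (k : ℤ) :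
    (p + v, r + k * L) ∈ markedFar γ d ↔ (p, r) ∈ markedFar γ d := by
  obtain ⟨⟨i, hi⟩, ⟨j, hj⟩⟩ := mem_lattice_iff.1 hv
  simp [markedFar, hi, hj, hK.periodic_int]

theorem energy_eq {γ : ℝ → Space} (p : Plane) {i j : Fin 2} (hij : i ≠ j) :
    energy γ p = 1 / 2 * ‖γ (p i) - γ (p j)‖ ^ 2 := by
  fin_cases i <;> fin_cases j
  · simp at hij
  · rfl
  · simp only [energy]
    rw [norm_sub_rev]
    rfl
  · simp at hij

theorem IsKnot.contDiff_energy {L : ℝ} {γ : ℝ → Space} (hK : IsKnot L γ) :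
    ContDiff ℝ ∞ (energy γ) := by
  have h : ∀ i : Fin 2, ContDiff ℝ ∞ fun p : Plane => γ (p i) := fun i =>
    hK.smooth.comp (by fun_prop)
  exact contDiff_const.mul (((h 0).sub (h 1)).norm_sq ℝ)

theorem IsKnot.isTorusFun_energy {L : ℝ} {γ : ℝ → Space} (hK : IsKnot L γ) :
    IsTorusFun L (energy γ) :=
  ⟨hK.contDiff_energy, fun p j k => by simp [energy, hK.periodic_int]⟩

theorem IsKnot.gradient_energy {L : ℝ} {γ : ℝ → Space} (hK : IsKnot L γ) (p : Plane)
    {i j : Fin 2} (hij : i ≠ j) :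
    gradient (energy γ) p i = inner ℝ (γ (p i) - γ (p j)) (deriv γ (p i)) := by
  rw [gradient_apply]
  have hd : HasFDerivAt (energy γ) (fderiv ℝ (energy γ) p) p :=
    (hK.contDiff_energy.differentiable (by simp) p).hasFDerivAt
  set e : Plane := EuclideanSpace.single i 1 with he
  have hl : HasDerivAt (fun u : ℝ => p + u • e) e 0 := by
    simpa using ((hasDerivAt_id (0 : ℝ)).smul_const e).const_add p
  have h1 : HasDerivAt (fun u : ℝ => energy γ (p + u • e)) (fderiv ℝ (energy γ) p e) 0 := by
    have hd' : HasFDerivAt (energy γ) (fderiv ℝ (energy γ) p) (p + (0 : ℝ) • e) := by simpa using hd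
    exact hd'.comp_hasDerivAt 0 hl
  have h2 : (fun u : ℝ => energy γ (p + u • e)) =
      fun u : ℝ => 1 / 2 * ‖γ (p i + u) - γ (p j)‖ ^ 2 := by
    ext u
    rw [energy_eq _ hij]
    simp [he, hij.symm]
  have h3 : HasDerivAt (fun u : ℝ => γ (p i + u) - γ (p j)) (deriv γ (p i)) 0 := by
    have := (hK.hasDerivAt (p i + 0)).comp_const_add (p i) 0
    simp only [add_zero] at this
    exact this.sub_const _
  have h4 := (h3.norm_sq).const_mul (1 / 2 : ℝ)
  rw [h2] at h1
  have h5 := h1.unique h4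
  rw [h5]
  simp

theorem norm_gradient_ge (F : Plane → ℝ) (p : Plane) (i : Fin 2) :
    |gradient F p i| ≤ ‖gradient F p‖ := norm_coord_le _ i

namespace IsKnot

variable {L : ℝ} {γ : ℝ → Space}

/-- Pairs of parameters in a period that stay at distance at least `ρ` modulo the period. -/
theorem isCompact_apart (L ρ : ℝ) :
    IsCompact ((Icc 0 L ×ˢ Icc 0 L) ∩ {q : ℝ × ℝ | ∀ k : ℤ, ρ ≤ |q.2 + k * L - q.1|}) := by
  refine (isCompact_Icc.prod isCompact_Icc).inter_right ?_
  have e : {q : ℝ × ℝ | ∀ k : ℤ, ρ ≤ |q.2 + k * L - q.1|} =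
      ⋂ k : ℤ, {q : ℝ × ℝ | ρ ≤ |q.2 + k * L - q.1|} := by
    ext q
    simp
  rw [e]
  exact isClosed_iInter fun k => isClosed_le continuous_const (by fun_prop)

theorem exists_dist_ge (hK : IsKnot L γ) {ρ : ℝ} (hρ : 0 < ρ) :
    ∃ d > 0, ∀ q ∈ (Icc 0 L ×ˢ Icc 0 L) ∩ {q : ℝ × ℝ | ∀ k : ℤ, ρ ≤ |q.2 + k * L - q.1|},
      d ≤ dist (γ q.1) (γ q.2) := by
  have hc : Continuous fun q : ℝ × ℝ => dist (γ q.1) (γ q.2) :=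
    (hK.continuous.comp continuous_fst).dist (hK.continuous.comp continuous_snd)
  have hpos : ∀ q ∈ (Icc 0 L ×ˢ Icc 0 L) ∩ {q : ℝ × ℝ | ∀ k : ℤ, ρ ≤ |q.2 + k * L - q.1|},
      0 < dist (γ q.1) (γ q.2) := by
    intro q hq
    rw [dist_pos]
    intro he
    obtain ⟨k, hk⟩ := hK.injective _ _ he
    have h1 : ρ ≤ |q.2 + ((-k : ℤ) : ℝ) * L - q.1| := hq.2 (-k)
    have h2 : q.2 + ((-k : ℤ) : ℝ) * L - q.1 = 0 := by
      rw [hk]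
      push_cast
      ring
    rw [h2, abs_zero] at h1
    linarith
  exact (isCompact_apart L ρ).exists_forall_le' hc.continuousOn hpos

/-- Knot points that are close in space have close parameters, up to a period. -/
theorem exists_dist_lt (hK : IsKnot L γ) {ρ : ℝ} (hρ : 0 < ρ) :
    ∃ d > 0, ∀ s r, dist (γ s) (γ r) < d → ∃ k : ℤ, |r + k * L - s| < ρ := by
  obtain ⟨d, hd, h⟩ := hK.exists_dist_ge hρ
  refine ⟨d, hd, fun s r hsr => ?_⟩
  by_contra hne
  push Not at hne
  obtain ⟨i, hi⟩ := exists_shift_mem_Ico hK.pos s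
  obtain ⟨j, hj⟩ := exists_shift_mem_Ico hK.pos r
  have hk : ∀ k : ℤ, ρ ≤ |(r + j * L) + k * L - (s + i * L)| := fun k => by
    have h1 := hne (j + k - i)
    have h2 : r + ((j + k - i : ℤ) : ℝ) * L - s = (r + j * L) + k * L - (s + i * L) := by
      push_cast
      ring
    rwa [h2] at h1
  have h3 : d ≤ dist (γ (s + i * L)) (γ (r + j * L)) := h (s + i * L, r + j * L)
    ⟨⟨Ico_subset_Icc_self hi, Ico_subset_Icc_self hj⟩, hk⟩
  rw [hK.periodic_int, hK.periodic_int] at h3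
  linarith

/-- A crossing at a parameter close to that of the start of the cord forces the cord to be almost
tangent to the knot there, and it points in the direction of the crossing. -/
theorem exists_almost_tangent (hK : IsKnot L γ) : ∃ ρ > 0, ∀ s t r, IsCrossing γ s t r →
    |r - s| ≤ ρ →
    r ≠ s ∧ 3 / 4 * ‖γ t - γ s‖ * |r - s| ≤ (r - s) * inner ℝ (γ t - γ s) (deriv γ s) ∧
      3 / 4 * ‖γ t - γ r‖ * |r - s| ≤ (r - s) * inner ℝ (γ t - γ r) (deriv γ r) := by
  obtain ⟨B, hB1, hB, -, -⟩ := hK.exists_lipschitz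
  have hB0 : 0 < B := by linarith
  refine ⟨1 / (8 * B), by positivity, fun s t r h hsr => ?_⟩
  obtain ⟨θ, ⟨hθ0, hθ1⟩, h1, h2⟩ := h.exists_ratio
  have hBρ : B * (1 / (8 * B)) = 1 / 8 := by field_simp
  have hrs : r ≠ s := by
    rintro rfl
    rw [sub_self] at h1
    rcases smul_eq_zero.1 h1.symm with h3 | h3
    · linarith
    · exact h.1 (sub_eq_zero.1 h3).symm
  set P := secant γ s r with hP
  have hPs := norm_secant_sub_le hK hB0.le hB (s := s) (r := r) (u := s) (ρ := 1 / (8 * B))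
    (by simp only [sub_self, abs_zero]; positivity) hsr
  have hPr := norm_secant_sub_le hK hB0.le hB (s := s) (r := r) (u := r) (ρ := 1 / (8 * B))
    (by rwa [abs_sub_comm]) (by simp only [sub_self, abs_zero]; positivity)
  rw [← hP, hBρ] at hPs hPr
  rw [sub_eq_smul_secant hK, ← hP] at h1
  have key : ∀ u, ‖P - deriv γ u‖ ≤ 1 / 8 → ∀ w : Space, ∀ b > 0, w = (b * (r - s)) • P →
      3 / 4 * ‖w‖ * |r - s| ≤ (r - s) * inner ℝ w (deriv γ u) := by
    intro u hu w b hb hw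
    have hT := hK.unitSpeed u
    have hn : ‖P‖ ≤ 9 / 8 := by
      have := norm_le_norm_add_norm_sub' P (deriv γ u)
      linarith
    have hi : 7 / 8 ≤ inner ℝ P (deriv γ u) := by
      have e : inner ℝ P (deriv γ u) = 1 + inner ℝ (P - deriv γ u) (deriv γ u) := by
        rw [inner_sub_left, real_inner_self_eq_norm_sq, hT]
        ring
      have := abs_real_inner_le_norm (P - deriv γ u) (deriv γ u)
      rw [hT, mul_one] at this
      have := (abs_le.1 (this.trans hu)).1
      linarith
    rw [hw, real_inner_smul_left, norm_smul, Real.norm_eq_abs, abs_mul, abs_of_pos hb]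
    have e : (r - s) * (b * (r - s) * inner ℝ P (deriv γ u)) =
        b * |r - s| ^ 2 * inner ℝ P (deriv γ u) := by
      rw [sq_abs]
      ring
    rw [e]
    have h3 : 3 / 4 * ‖P‖ ≤ inner ℝ P (deriv γ u) := by linarith
    have h4 : 0 ≤ b * |r - s| ^ 2 := by positivity
    calc 3 / 4 * (b * |r - s| * ‖P‖) * |r - s| = b * |r - s| ^ 2 * (3 / 4 * ‖P‖) := by ring
      _ ≤ _ := by gcongr
  have hts : γ t - γ s = (θ⁻¹ * (r - s)) • P := by
    rw [mul_smul, h1, smul_smul, inv_mul_cancel₀ hθ0.ne', one_smul]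
  refine ⟨hrs, key s hPs _ θ⁻¹ (by positivity) hts, key r hPr _ ((1 - θ) * θ⁻¹) ?_ ?_⟩
  · have : 0 < 1 - θ := by linarith
    positivity
  · rw [h2, hts, smul_smul, mul_assoc]

end IsKnot

theorem le_abs_of_mul_abs_le {ℓ n w v : ℝ} (hw : w ≠ 0) (hl : ℓ ≤ n)
    (h : 3 / 4 * n * |w| ≤ w * v) : 3 / 4 * ℓ ≤ |v| := by
  have h1 : 3 / 4 * n * |w| ≤ |v| * |w| := by
    rw [← abs_mul, mul_comm v]
    exact h.trans (le_abs_self _)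
  have := le_of_mul_le_mul_right h1 (abs_pos.2 hw)
  linarith

namespace IsGenericKnot

variable {L : ℝ} {γ : ℝ → Space}

/-- Short cords do not meet the knot in their interior. -/
theorem exists_length_bound (hK : IsGenericKnot L γ) :
    ∃ ℓ > 0, ∀ s t r, IsCrossing γ s t r → ℓ ≤ dist (γ s) (γ t) := by
  obtain ⟨ρ, hρ, h⟩ := hK.exists_not_collinear
  obtain ⟨d, hd, hd'⟩ := hK.toIsKnot.exists_dist_lt hρ
  refine ⟨d, hd, fun s t r hc => ?_⟩
  by_contra hlt
  push Not at hlt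
  obtain ⟨h1, h2, h3⟩ := IsCrossing.iff_dist.1 hc
  obtain ⟨k, hk⟩ := hd' s t hlt
  obtain ⟨j, hj⟩ := hd' s r (by linarith)
  have hc' := hc.shift hK.toIsKnot 0 k j
  simp only [Int.cast_zero, zero_mul, add_zero] at hc'
  obtain ⟨h1, h2, h3⟩ := IsCrossing.iff_dist.1 hc'
  refine h s s (r + j * L) (t + k * L) (by simpa using hρ.le) hj.le hk.le ?_ ?_ ?_ hc'.collinear
  · intro he
    rw [← he] at h2
    simp at h2
  · intro he
    rw [he] at h3
    simp at h3
  · exact fun he => hc'.1 (by rw [← he])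

/-- Cords with a crossing close to one of their ends are almost tangent to the knot there, so that
the energy changes if this end is moved. -/
theorem exists_gradient_bound_near (hK : IsGenericKnot L γ) :
    ∃ d > 0, ∃ c > 0, ∀ (p : Plane) (i j : Fin 2), i ≠ j → ∀ r, IsCrossing γ (p i) (p j) r →
      dist (γ (p i)) (γ r) < d → c ≤ ‖gradient (energy γ) p‖ := by
  have hk := hK.toIsKnot
  obtain ⟨ℓ, hℓ, hlen⟩ := hK.exists_length_bound
  obtain ⟨ρ, hρ, htan⟩ := hk.exists_almost_tangent
  obtain ⟨d, hd, hd'⟩ := hk.exists_dist_lt hρ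
  refine ⟨d, hd, 3 / 4 * ℓ, by positivity, fun p i j hij r hr hlt => ?_⟩
  obtain ⟨k, hkr⟩ := hd' _ _ hlt
  have hr' := hr.shift hk 0 0 k
  simp only [Int.cast_zero, zero_mul, add_zero] at hr'
  obtain ⟨h1, h2, -⟩ := htan _ _ _ hr' hkr.le
  refine le_trans ?_ (norm_gradient_ge _ p i)
  rw [hk.gradient_energy p hij, ← neg_sub (γ (p j)), inner_neg_left, abs_neg]
  have hl := hlen _ _ _ hr
  rw [dist_comm, dist_eq_norm] at hl
  exact le_abs_of_mul_abs_le (sub_ne_zero.2 h1) hl h2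

/-- The energy has no critical points near the cords that meet the knot. -/
theorem exists_gradient_bound (hK : IsGenericKnot L γ) :
    ∃ c > 0, ∀ p ∈ cordsMeetingKnot γ, c ≤ ‖gradient (energy γ) p‖ := by
  have hk := hK.toIsKnot
  obtain ⟨d, hd, c', hc', hnear⟩ := hK.exists_gradient_bound_near
  have hcont : Continuous fun q : Plane × ℝ => ‖gradient (energy γ) q.1‖ :=
    ((contDiff_gradient hk.contDiff_energy).continuous.comp continuous_fst).norm
  have hcomp : IsCompact ((square L ×ˢ Icc 0 L) ∩ markedFar γ d) :=
    ((isCompact_square L).prod isCompact_Icc).inter_right (isClosed_markedFar hk.continuous d)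
  have hpos : ∀ q ∈ (square L ×ˢ Icc 0 L) ∩ markedFar γ d, 0 < ‖gradient (energy γ) q.1‖ :=
    fun q hq => norm_pos_iff.2 fun h0 => hK.critNotMeeting q.1 h0
      (mem_cordsMeetingKnot_of_mem_markedCords (markedFar_subset hd hq.2))
  obtain ⟨c, hc, hcb⟩ := hcomp.exists_forall_le' hcont.continuousOn hpos
  refine ⟨min c c', lt_min hc hc', ?_⟩
  rintro p ⟨r, hr⟩
  rw [mem_crossings] at hr
  by_cases h0 : dist (γ (p 0)) (γ r) < d
  · exact (min_le_right _ _).trans (hnear p 0 1 (by simp) r hr h0)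
  by_cases h1 : dist (γ r) (γ (p 1)) < d
  · exact (min_le_right _ _).trans (hnear p 1 0 (by simp) r hr.symm (by rwa [dist_comm]))
  push Not at h0 h1
  obtain ⟨v, hv, hpv⟩ := exists_lattice_add_mem_fundamentalDomain hK.pos p
  obtain ⟨k, hkr⟩ := exists_shift_mem_Ico hK.pos r
  rw [← hk.isTorusFun_energy.gradient_add_lattice hv p]
  have hfar : (p, r) ∈ markedFar γ d := ⟨(IsCrossing.iff_dist.1 hr).1, h0, h1⟩
  exact (min_le_left _ _).trans (hcb (p + v, r + k * L)
    ⟨⟨fundamentalDomain_subset_square L hpv, Ico_subset_Icc_self hkr⟩,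
      (hk.markedFar_shift hv k).2 hfar⟩)

end IsGenericKnot

/-! ### Two consecutive short splittings -/

theorem exists_norm_ge_of_linearIndependent {E : Type*} [NormedAddCommGroup E] [NormedSpace ℝ E]
    [FiniteDimensional ℝ E] {T N U : E} (h : LinearIndependent ℝ ![T, N, U]) :
    ∃ c > 0, ∀ x y z : ℝ, c * (|x| + |y| + |z|) ≤ ‖x • T + y • N + z • U‖ := by
  have hker : LinearMap.ker (Fintype.linearCombination ℝ ![T, N, U]) = ⊥ :=
    LinearMap.ker_eq_bot'.2 fun g hg => funext (Fintype.linearIndependent_iff.1 h g (by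
      simpa only [Fintype.linearCombination_apply] using hg))
  obtain ⟨K, hK, hK'⟩ := LinearMap.exists_antilipschitzWith _ hker
  have hK0 : (0 : ℝ) < K := by exact_mod_cast hK
  refine ⟨1 / (3 * K), by positivity, fun x y z => ?_⟩
  have h1 := hK'.le_mul_dist ![x, y, z] 0
  rw [map_zero, dist_zero_right, dist_zero_right] at h1
  have e : Fintype.linearCombination ℝ ![T, N, U] ![x, y, z] = x • T + y • N + z • U := by
    simp [Fintype.linearCombination_apply, Fin.sum_univ_three]
  rw [e] at h1
  have h2 : ∀ i, |(![x, y, z] : Fin 3 → ℝ) i| ≤ ‖![x, y, z]‖ := fun i =>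
    norm_le_pi_norm (![x, y, z] : Fin 3 → ℝ) i
  have hx : |x| ≤ _ := h2 0
  have hy : |y| ≤ _ := h2 1
  have hz : |z| ≤ _ := h2 2
  rw [div_mul_eq_mul_div, one_mul, div_le_iff₀ (by positivity)]
  linarith

theorem exists_subseq_shift {L : ℝ} (hL : 0 < L) (s t : ℕ → ℝ) :
    ∃ φ : ℕ → ℕ, StrictMono φ ∧ ∃ i j : ℕ → ℤ, ∃ s' t' : ℝ,
      Tendsto (fun n => s (φ n) + i n * L) atTop (𝓝 s') ∧
      Tendsto (fun n => t (φ n) + j n * L) atTop (𝓝 t') := by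
  choose i hi using fun n => exists_shift_mem_Ico hL (s n)
  choose j hj using fun n => exists_shift_mem_Ico hL (t n)
  obtain ⟨a, -, φ, hφ, ha⟩ := (isCompact_Icc.prod isCompact_Icc).tendsto_subseq
    (x := fun n => (s n + i n * L, t n + j n * L))
    (fun n => show _ ∈ Icc 0 L ×ˢ Icc 0 L from
      ⟨Ico_subset_Icc_self (hi n), Ico_subset_Icc_self (hj n)⟩)
  exact ⟨φ, hφ, fun n => i (φ n), fun n => j (φ n), a.1, a.2,
    (continuous_fst.tendsto a).comp ha, (continuous_snd.tendsto a).comp ha⟩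

theorem tendsto_of_abs_sub_lt {a b e : ℕ → ℝ} {x : ℝ} (ha : Tendsto a atTop (𝓝 x))
    (he : Tendsto e atTop (𝓝 0)) (h : ∀ n, |b n - a n| < e n) : Tendsto b atTop (𝓝 x) := by
  have h1 : Tendsto (fun n => b n - a n) atTop (𝓝 0) :=
    squeeze_zero_norm (fun n => (h n).le) he
  simpa using h1.add ha

theorem IsKnot.tendsto_secant {L : ℝ} {γ : ℝ → Space} (hK : IsKnot L γ) {s r : ℕ → ℝ} {u : ℝ}
    (hs : Tendsto s atTop (𝓝 u)) (hr : Tendsto r atTop (𝓝 u)) :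
    Tendsto (fun n => secant γ (s n) (r n)) atTop (𝓝 (deriv γ u)) := by
  obtain ⟨B, hB1, hB, -, -⟩ := hK.exists_lipschitz
  rw [tendsto_iff_norm_sub_tendsto_zero]
  have h1 : Tendsto (fun n => B * (|s n - u| + |r n - u|)) atTop (𝓝 0) := by
    have h2 : Tendsto (fun n => B * (|s n - u| + |r n - u|)) atTop
        (𝓝 (B * (|u - u| + |u - u|))) :=
      ((hs.sub_const u).abs.add (hr.sub_const u).abs).const_mul B
    simpa using h2
  refine squeeze_zero (fun n => norm_nonneg _) (fun n => ?_) h1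
  exact norm_secant_sub_le hK (by linarith) hB (by simp) (by simp)

namespace IsGenericKnot

variable {L : ℝ} {γ : ℝ → Space}

/-- If the crossings of a convergent sequence of cords converge to the start of the limit cord, then
this cord is tangent to the knot at its start. -/
theorem tangent_limit (hK : IsGenericKnot L γ) {s t r : ℕ → ℝ} {u v : ℝ}
    (hc : ∀ n, IsCrossing γ (s n) (t n) (r n)) (hs : Tendsto s atTop (𝓝 u))
    (hr : Tendsto r atTop (𝓝 u)) (ht : Tendsto t atTop (𝓝 v)) :
    ∃ a : ℕ → ℝ, (∀ n, γ (t n) - γ (s n) = a n • secant γ (s n) (r n)) ∧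
      (∀ n, 0 < a n * (r n - s n)) ∧
      Tendsto a atTop (𝓝 (inner ℝ (γ v - γ u) (deriv γ u))) ∧
      inner ℝ (γ v - γ u) (deriv γ u) ≠ (0 : ℝ) ∧
      γ v - γ u = (inner ℝ (γ v - γ u) (deriv γ u) : ℝ) • deriv γ u := by
  have hk := hK.toIsKnot
  obtain ⟨ℓ, hℓ, hlen⟩ := hK.exists_length_bound
  choose θ hθ h1 h2 using fun n => (hc n).exists_ratio
  have hP := hk.tendsto_secant hs hr
  have heq : ∀ n, γ (t n) - γ (s n) = ((θ n)⁻¹ * (r n - s n)) • secant γ (s n) (r n) := by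
    intro n
    rw [mul_smul, ← sub_eq_smul_secant hk, h1 n, smul_smul, inv_mul_cancel₀ (hθ n).1.ne', one_smul]
  have hne : ∀ n, r n - s n ≠ 0 := by
    intro n h0
    have := h1 n
    rw [sub_eq_zero.1 h0, sub_self] at this
    rcases smul_eq_zero.1 this.symm with h3 | h3
    · exact (hθ n).1.ne' h3
    · exact (hc n).1 (sub_eq_zero.1 h3).symm
  have hd : Tendsto (fun n => γ (t n) - γ (s n)) atTop (𝓝 (γ v - γ u)) :=
    ((hk.continuous.tendsto v).comp ht).sub ((hk.continuous.tendsto u).comp hs)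
  have ha : Tendsto (fun n => (θ n)⁻¹ * (r n - s n)) atTop
      (𝓝 (inner ℝ (γ v - γ u) (deriv γ u))) := by
    have h3 : Tendsto (fun n => (inner ℝ (γ (t n) - γ (s n)) (secant γ (s n) (r n)) : ℝ) /
        ‖secant γ (s n) (r n)‖ ^ 2) atTop
        (𝓝 ((inner ℝ (γ v - γ u) (deriv γ u) : ℝ) / ‖deriv γ u‖ ^ 2)) :=
      (hd.inner hP).div (hP.norm.pow 2) (by rw [hk.unitSpeed]; norm_num)
    rw [hk.unitSpeed, one_pow, div_one] at h3
    refine h3.congr' ?_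
    have h4 : ∀ᶠ n in atTop, ‖secant γ (s n) (r n)‖ ≠ 0 :=
      hP.norm.eventually_ne (by rw [hk.unitSpeed]; norm_num)
    filter_upwards [h4] with n hn
    rw [heq n, real_inner_smul_left, real_inner_self_eq_norm_sq]
    field_simp
  have hlim : γ v - γ u = (inner ℝ (γ v - γ u) (deriv γ u) : ℝ) • deriv γ u :=
    tendsto_nhds_unique (hd.congr heq) (ha.smul hP)
  refine ⟨fun n => (θ n)⁻¹ * (r n - s n), heq, fun n => ?_, ha, fun h0 => ?_, hlim⟩
  · have := inv_pos.2 (hθ n).1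
    have := sq_pos_of_ne_zero (hne n)
    calc (0 : ℝ) < (θ n)⁻¹ * (r n - s n) ^ 2 := by positivity
      _ = _ := by ring
  · rw [h0, zero_smul] at hlim
    have h5 : ℓ ≤ ‖γ v - γ u‖ := ge_of_tendsto' hd.norm fun n => by
      have := hlen _ _ _ (hc n)
      rwa [dist_comm, dist_eq_norm] at this
    rw [hlim, norm_zero] at h5
    linarith

/-- The general position of tangent cords, for a cord whose tangency is given by an equation. -/
theorem linearIndependent_limit (hK : IsGenericKnot L γ) {u v a : ℝ} (ha : a ≠ 0)
    (h : γ v - γ u = a • deriv γ u) :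
    LinearIndependent ℝ ![deriv γ u, deriv (deriv γ) u, deriv γ v] := by
  have h1 := hK.tangentStart !₂[u, v] ⟨?_, a, ?_⟩
  · simpa using h1
  · intro he
    have e : γ u = γ v := by simpa using he
    rw [e, sub_self] at h
    rcases smul_eq_zero.1 h.symm with h | h
    · exact ha h
    · have := hK.unitSpeed u
      rw [h, norm_zero] at this
      norm_num at this
  · simpa using h

/-- A cord with a crossing close to its start does not lie near a cord with a crossing close to
its end: in the limit there would be a cord tangent to the knot at both ends. -/
theorem exists_radius_opposite (hK : IsGenericKnot L γ) : ∃ ρ > 0, ∀ s t r s' t' r',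
    IsCrossing γ s t r → IsCrossing γ s' t' r' → |r - s| < ρ → |s' - s| < ρ → |t' - t| < ρ →
      ρ ≤ |r' - t'| := by
  have hk := hK.toIsKnot
  by_contra! hne
  choose s t r s' t' r' h1 h2 h3 h4 h5 h6 using fun n : ℕ =>
    hne (1 / ((n : ℝ) + 1)) Nat.one_div_pos_of_nat
  obtain ⟨φ, hφ, i, j, u, v, hs, ht⟩ := exists_subseq_shift hK.pos s t
  have he : Tendsto (fun n => 1 / ((φ n : ℝ) + 1)) atTop (𝓝 0) :=
    tendsto_one_div_add_atTop_nhds_zero_nat.comp hφ.tendsto_atTop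
  have hr : Tendsto (fun n => r (φ n) + i n * L) atTop (𝓝 u) :=
    tendsto_of_abs_sub_lt hs he fun n => by
      simpa only [add_sub_add_right_eq_sub] using h3 (φ n)
  have hs' : Tendsto (fun n => s' (φ n) + i n * L) atTop (𝓝 u) :=
    tendsto_of_abs_sub_lt hs he fun n => by
      simpa only [add_sub_add_right_eq_sub] using h4 (φ n)
  have ht' : Tendsto (fun n => t' (φ n) + j n * L) atTop (𝓝 v) :=
    tendsto_of_abs_sub_lt ht he fun n => by
      simpa only [add_sub_add_right_eq_sub] using h5 (φ n)
  have hr' : Tendsto (fun n => r' (φ n) + j n * L) atTop (𝓝 v) :=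
    tendsto_of_abs_sub_lt ht' he fun n => by
      simpa only [add_sub_add_right_eq_sub] using h6 (φ n)
  obtain ⟨-, -, -, -, ha, h7⟩ := hK.tangent_limit
    (fun n => (h1 (φ n)).shift hk (i n) (j n) (i n)) hs hr ht
  obtain ⟨-, -, -, -, hb, h8⟩ := hK.tangent_limit
    (fun n => ((h2 (φ n)).shift hk (i n) (j n) (j n)).symm) ht' hr' hs'
  have hli := hK.linearIndependent_limit ha h7
  set a : ℝ := inner ℝ (γ v - γ u) (deriv γ u)
  set b : ℝ := inner ℝ (γ u - γ v) (deriv γ v)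
  rw [Fintype.linearIndependent_iff] at hli
  have := hli ![a, 0, b] (by
    simp only [Fin.sum_univ_three, Matrix.cons_val]
    rw [← h7, ← h8]
    simp) 0
  exact ha this

/-- The linear estimate behind `exists_radius_same`. -/
theorem false_of_equations {E : Type*} [NormedAddCommGroup E] [NormedSpace ℝ E]
    {T N U D Q P P' : E} {c A β a a' ds dt dr : ℝ}
    (hA : 0 < A) (ha : A ≤ |a|) (hβ1 : 0 ≤ β) (hβ2 : β * (2 + 4 / A) < c)
    (hlin : ∀ x y z : ℝ, c * (|x| + |y| + |z|) ≤ ‖x • T + y • N + z • U‖)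
    (hs : 0 < ds * dr) (heq : dt • D - ds • Q = a' • P' - a • P) (hD : ‖U - D‖ ≤ β)
    (hQ : ‖Q - T‖ ≤ β) (hP : ‖P' - T‖ ≤ β)
    (hPP : ‖P' - P - ((ds + dr) / 2) • N‖ ≤ β * (|ds| + |dr|)) : False := by
  have hσ : |ds| + |dr| = 2 * |(ds + dr) / 2| := by
    rw [abs_div, abs_two, abs_add_eq_add_abs_iff _ _ |>.2]
    · ring
    · rcases pos_and_pos_or_neg_and_neg_of_mul_pos hs with h | h
      · exact Or.inl ⟨h.1.le, h.2.le⟩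
      · exact Or.inr ⟨h.1.le, h.2.le⟩
  have hds : 0 < |ds| := abs_pos.2 (left_ne_zero_of_mul hs.ne')
  have hdr : 0 ≤ |dr| := abs_nonneg _
  generalize (ds + dr) / 2 = σ at *
  have h1 := hlin (-(ds + (a' - a))) (-(a * σ)) dt
  have e : (-(ds + (a' - a))) • T + (-(a * σ)) • N + dt • U =
      dt • (U - D) + ds • (Q - T) + (a' - a) • (P' - T) + a • (P' - P - σ • N) := by
    have e2 : dt • (U - D) + ds • (Q - T) + (a' - a) • (P' - T) + a • (P' - P - σ • N) =
        (-(ds + (a' - a))) • T + (-(a * σ)) • N + dt • U -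
          ((dt • D - ds • Q) - (a' • P' - a • P)) := by
      module
    rw [e2, heq, sub_self, sub_zero]
  have h2 : ‖dt • (U - D) + ds • (Q - T) + (a' - a) • (P' - T) + a • (P' - P - σ • N)‖ ≤
      |dt| * β + |ds| * β + |a' - a| * β + |a| * (β * (2 * |σ|)) := by
    have hb : ∀ (x : ℝ) (w : E) (b : ℝ), ‖w‖ ≤ b → ‖x • w‖ ≤ |x| * b := fun x w b h => by
      rw [norm_smul, Real.norm_eq_abs]
      gcongr
    rw [hσ] at hPP
    exact (norm_add_le_of_le (norm_add_le_of_le (norm_add_le_of_le (hb _ _ _ hD) (hb _ _ _ hQ))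
      (hb _ _ _ hP)) (hb _ _ _ hPP))
  rw [e, abs_neg, abs_neg, abs_mul] at h1
  have h3 := h1.trans h2
  have h4 : |a' - a| ≤ |ds + (a' - a)| + |ds| := by
    have := abs_sub_abs_le_abs_sub (ds + (a' - a)) ds
    have := abs_add_le (ds + (a' - a)) (-ds)
    rw [abs_neg] at this
    rwa [add_neg_cancel_comm] at this
  have h5 : |ds| ≤ 2 / A * (|a| * |σ|) := by
    rw [div_mul_eq_mul_div, le_div_iff₀ hA]
    have : A * |σ| ≤ |a| * |σ| := by gcongr
    nlinarith
  have h6 : 0 < |a| * |σ| := mul_pos (hA.trans_le ha) (by linarith)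
  have hβc : β ≤ c := by
    have : β * 1 ≤ β * (2 + 4 / A) := by
      gcongr
      have : 0 < 4 / A := by positivity
      linarith
    linarith
  have h7 : |dt| * β + |ds| * β + |a' - a| * β + |a| * (β * (2 * |σ|)) ≤
      c * (|ds + (a' - a)| + |dt|) + β * (2 + 4 / A) * (|a| * |σ|) := by
    have i1 : |a' - a| * β ≤ (|ds + (a' - a)| + |ds|) * β := by gcongr
    have i2 : |ds| * β ≤ 2 / A * (|a| * |σ|) * β := by gcongr
    have i3 : |dt| * β ≤ |dt| * c := by gcongr
    have i4 : |ds + (a' - a)| * β ≤ |ds + (a' - a)| * c := by gcongr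
    have i5 : 4 / A = 2 / A + 2 / A := by ring
    rw [i5]
    linarith
  have h8 := mul_lt_mul_of_pos_right hβ2 h6
  linarith

/-- Two sequences of cords with the same limit as excluded by `exists_radius_same`: the difference
of the equations which say that the cords point along secants is, to first order, a linear relation
between the velocity and the acceleration at the point of tangency and the velocity at the far end.
-/
theorem false_of_limit (hK : IsGenericKnot L γ) {s t r s' t' r' : ℕ → ℝ} {u v : ℝ}
    (hc : ∀ n, IsCrossing γ (s n) (t n) (r n)) (hc' : ∀ n, IsCrossing γ (s' n) (t' n) (r' n))
    (hs : Tendsto s atTop (𝓝 u)) (hr : Tendsto r atTop (𝓝 u)) (ht : Tendsto t atTop (𝓝 v))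
    (hs' : Tendsto s' atTop (𝓝 u)) (hr' : Tendsto r' atTop (𝓝 u)) (ht' : Tendsto t' atTop (𝓝 v))
    (h0 : ∀ n, 0 ≤ (r n - s n) * (s' n - r n)) : False := by
  have hk := hK.toIsKnot
  obtain ⟨B, hB1, hB, -, hB'⟩ := hk.exists_lipschitz
  have hB0 : 0 ≤ B := by linarith
  obtain ⟨a, ha1, ha2, ha3, ha, huv⟩ := hK.tangent_limit hc hs hr ht
  obtain ⟨a', ha1', ha2', ha3', -, -⟩ := hK.tangent_limit hc' hs' hr' ht'
  obtain ⟨c, hc0, hlin⟩ := exists_norm_ge_of_linearIndependent (hK.linearIndependent_limit ha huv)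
  generalize (inner ℝ (γ v - γ u) (deriv γ u) : ℝ) = α at *
  have hα : 0 < |α| / 2 := by positivity
  have hρ : ∃ ρ : ℕ → ℝ, Tendsto ρ atTop (𝓝 0) ∧ (∀ n, |s n - u| ≤ ρ n) ∧
      (∀ n, |r n - u| ≤ ρ n) ∧ (∀ n, |t n - v| ≤ ρ n) ∧ (∀ n, |s' n - u| ≤ ρ n) ∧
      (∀ n, |r' n - u| ≤ ρ n) ∧ (∀ n, |t' n - v| ≤ ρ n) := by
    have lim : ∀ {x : ℕ → ℝ} {y : ℝ}, Tendsto x atTop (𝓝 y) →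
        Tendsto (fun n => |x n - y|) atTop (𝓝 0) := fun {x y} h => by
      simpa using (h.sub_const y).abs
    refine ⟨fun n => |s n - u| + |r n - u| + |t n - v| + (|s' n - u| + |r' n - u| + |t' n - v|),
      ?_, fun n => ?_, fun n => ?_, fun n => ?_, fun n => ?_, fun n => ?_, fun n => ?_⟩
    · simpa using (((lim hs).add (lim hr)).add (lim ht)).add
        (((lim hs').add (lim hr')).add (lim ht'))
    all_goals
      have := abs_nonneg (s n - u)
      have := abs_nonneg (r n - u)
      have := abs_nonneg (t n - v)
      have := abs_nonneg (s' n - u)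
      have := abs_nonneg (r' n - u)
      have := abs_nonneg (t' n - v)
      linarith
  obtain ⟨ρ, hρ0, i1, i2, i3, i4, i5, i6⟩ := hρ
  have e1 : ∀ᶠ n in atTop, |α| / 2 < |a n| := ha3.abs.eventually_const_lt (by linarith)
  have e2 : ∀ᶠ n in atTop, 0 < a n * a' n :=
    (ha3.mul ha3').eventually_const_lt (mul_self_pos.2 ha)
  have e3 : ∀ᶠ n in atTop, B * ρ n * (2 + 4 / (|α| / 2)) < c := by
    have h3 : Tendsto (fun n => B * ρ n * (2 + 4 / (|α| / 2))) atTop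
        (𝓝 (B * 0 * (2 + 4 / (|α| / 2)))) := (hρ0.const_mul B).mul_const _
    exact h3.eventually_lt_const (by simpa using hc0)
  obtain ⟨n, h1, h2, h3⟩ := (e1.and (e2.and e3)).exists
  have hpos : 0 < (s' n - s n) * (r' n - r n) := by
    have j1 : 0 < (r n - s n) * (r' n - s' n) := by
      have := mul_pos (ha2 n) (ha2' n)
      have j2 : 0 < (a n * a' n) * ((r n - s n) * (r' n - s' n)) := by linarith
      exact pos_of_mul_pos_right j2 h2.le
    have j0 := h0 n
    rcases pos_and_pos_or_neg_and_neg_of_mul_pos j1 with ⟨k1, k2⟩ | ⟨k1, k2⟩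
    · have := nonneg_of_mul_nonneg_right j0 k1
      exact mul_pos (by linarith) (by linarith)
    · have : s' n - r n ≤ 0 := by
        by_contra! hlt
        exact absurd j0 (not_le.2 (mul_neg_of_neg_of_pos k1 hlt))
      exact mul_pos_of_neg_of_neg (by linarith) (by linarith)
  have hρn : 0 ≤ ρ n := (abs_nonneg _).trans (i1 n)
  refine false_of_equations (D := secant γ (t n) (t' n)) (Q := secant γ (s n) (s' n))
    (P := secant γ (s n) (r n)) (P' := secant γ (s' n) (r' n)) (a := a n) (a' := a' n)
    (dt := t' n - t n) hα h1.le (mul_nonneg hB0 hρn) h3 hlin hpos ?_ ?_ ?_ ?_ ?_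
  · rw [← sub_eq_smul_secant hk, ← sub_eq_smul_secant hk, ← ha1 n, ← ha1' n]
    abel
  · rw [norm_sub_rev]
    exact norm_secant_sub_le hk hB0 hB (i3 n) (i6 n)
  · exact norm_secant_sub_le hk hB0 hB (i1 n) (i4 n)
  · exact norm_secant_sub_le hk hB0 hB (i4 n) (i5 n)
  · exact norm_secant_sub_secant_le hk hB0 hB' (i1 n) (i2 n) (i4 n) (i5 n)

/-- If a cord with a crossing close to its start is shortened to start at this crossing, then no
cord nearby which starts at a parameter on the far side of the crossing has a crossing close to its
start. This is where the knot is required to leave, at the far end of a tangent cord, the osculating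
plane at the point of tangency. -/
theorem exists_radius_same (hK : IsGenericKnot L γ) : ∃ ρ > 0, ∀ s t r s' t' r',
    IsCrossing γ s t r → IsCrossing γ s' t' r' → |r - s| < ρ → |s' - s| < ρ → |t' - t| < ρ →
      0 ≤ (r - s) * (s' - r) → ρ ≤ |r' - s'| := by
  have hk := hK.toIsKnot
  by_contra! hne
  choose s t r s' t' r' h1 h2 h3 h4 h5 h0 h6 using fun n : ℕ =>
    hne (1 / ((n : ℝ) + 1)) Nat.one_div_pos_of_nat
  obtain ⟨φ, hφ, i, j, u, v, hs, ht⟩ := exists_subseq_shift hK.pos s t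
  have he : Tendsto (fun n => 1 / ((φ n : ℝ) + 1)) atTop (𝓝 0) :=
    tendsto_one_div_add_atTop_nhds_zero_nat.comp hφ.tendsto_atTop
  have hr : Tendsto (fun n => r (φ n) + i n * L) atTop (𝓝 u) :=
    tendsto_of_abs_sub_lt hs he fun n => by
      simpa only [add_sub_add_right_eq_sub] using h3 (φ n)
  have hs' : Tendsto (fun n => s' (φ n) + i n * L) atTop (𝓝 u) :=
    tendsto_of_abs_sub_lt hs he fun n => by
      simpa only [add_sub_add_right_eq_sub] using h4 (φ n)
  have ht' : Tendsto (fun n => t' (φ n) + j n * L) atTop (𝓝 v) :=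
    tendsto_of_abs_sub_lt ht he fun n => by
      simpa only [add_sub_add_right_eq_sub] using h5 (φ n)
  have hr' : Tendsto (fun n => r' (φ n) + i n * L) atTop (𝓝 u) :=
    tendsto_of_abs_sub_lt hs' he fun n => by
      simpa only [add_sub_add_right_eq_sub] using h6 (φ n)
  have h0' : ∀ n, 0 ≤ (r (φ n) + i n * L - (s (φ n) + i n * L)) *
      (s' (φ n) + i n * L - (r (φ n) + i n * L)) := fun n => by
    simpa only [add_sub_add_right_eq_sub] using h0 (φ n)
  exact hK.false_of_limit (fun n => (h1 (φ n)).shift hk (i n) (j n) (i n))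
    (fun n => (h2 (φ n)).shift hk (i n) (j n) (i n)) hs hr ht hs' hr' ht' h0'

end IsGenericKnot

theorem IsFlowLine.add_lattice {L : ℝ} {F : Plane → ℝ} (hF : IsTorusFun L F) {x : ℝ → Plane}
    (hx : IsFlowLine F x) {v : Plane} (hv : v ∈ lattice L) : IsFlowLine F fun t => x t + v :=
  fun t => by
    rw [hF.gradient_add_lattice hv]
    exact (hx t).add_const v

theorem IsTorusFun.flow_add_lattice {L : ℝ} (hL : 0 < L) {F : Plane → ℝ} (hF : IsTorusFun L F)
    (t : ℝ) (p : Plane) {v : Plane} (hv : v ∈ lattice L) :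
    flow F t (p + v) = flow F t p + v := by
  have := hF.eq_flow hL ((hF.isFlowLine_flow hL p).add_lattice hF hv) t
  rw [hF.flow_zero hL] at this
  exact this.symm

/-! ### Energy lost between two splittings -/

/-- A flow line that leaves a ball on which one component of the gradient is bounded below loses a
definite amount of energy; if it does not leave the ball, this coordinate moves monotonically. -/
theorem IsFlowLine.drop_or_monotone {F : Plane → ℝ} (hF : Differentiable ℝ F) {y : ℝ → Plane}
    (hy : IsFlowLine F y) {c ρ σ : ℝ} (hc : 0 < c) (hσ : |σ| = 1) {i : Fin 2}
    (h : ∀ z, ‖z - y 0‖ ≤ ρ → c ≤ σ * -gradient F z i) {T : ℝ} (hT : 0 ≤ T) :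
    F (y T) ≤ F (y 0) - c * ρ ∨ (‖y T - y 0‖ ≤ ρ ∧ 0 ≤ σ * (y T i - y 0 i)) := by
  by_cases hout : ∃ t ∈ Icc 0 T, ρ ≤ ‖y t - y 0‖
  · left
    have hcl : IsCompact (Icc 0 T ∩ {t | ρ ≤ ‖y t - y 0‖}) :=
      isCompact_Icc.inter_right (isClosed_le continuous_const
        (hy.continuous.sub continuous_const).norm)
    obtain ⟨τ, ⟨hτ, hτρ⟩, hmin⟩ := hcl.exists_isLeast (by
      obtain ⟨t, h1, h2⟩ := hout
      exact ⟨t, h1, h2⟩)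
    have hin : ∀ t ∈ Ico 0 τ, ‖y t - y 0‖ ≤ ρ := fun t ht => by
      by_contra! hlt
      exact absurd (hmin ⟨⟨ht.1, ht.2.le.trans hτ.2⟩, hlt.le⟩) (not_le.2 ht.2)
    have hgr : ∀ t ∈ Ico 0 τ, c ≤ ‖gradient F (y t)‖ := fun t ht => by
      refine (h _ (hin t ht)).trans ((le_abs_self _).trans ?_)
      rw [abs_mul, hσ, one_mul, abs_neg]
      exact norm_coord_le _ i
    have hB : ∀ t, HasDerivAt (fun t => (F (y 0) - F (y t)) / c) (‖gradient F (y t)‖ ^ 2 / c) t :=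
      fun t => by
        have := ((hy.hasDerivAt_energy hF t).const_sub (F (y 0))).div_const c
        simpa using this
    have := image_norm_le_of_norm_deriv_right_le_deriv_boundary (f := fun t => y t - y 0)
      (f' := fun t => -gradient F (y t)) (a := 0) (b := τ)
      (B := fun t => (F (y 0) - F (y t)) / c) (B' := fun t => ‖gradient F (y t)‖ ^ 2 / c)
      (hy.continuous.sub continuous_const).continuousOn
      (fun t _ => ((hy t).sub_const _).hasDerivWithinAt) (by simp) hB
      (fun t ht => by
        rw [norm_neg, le_div_iff₀ hc, sq]
        have := hgr t ht
        gcongr) (right_mem_Icc.2 hτ.1)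
    have h1 : ρ ≤ (F (y 0) - F (y τ)) / c := le_trans hτρ this
    rw [le_div_iff₀ hc] at h1
    have h2 := hy.antitone_energy hF hτ.2
    simp only at h2
    linarith
  · right
    push Not at hout
    have hmono : MonotoneOn (fun t => σ * (y t i - y 0 i)) (Icc 0 T) := by
      have hd : ∀ t, HasDerivAt (fun t => σ * (y t i - y 0 i)) (σ * -gradient F (y t) i) t :=
        fun t => by
          have h1 : HasDerivAt (fun t => y t i) ((-gradient F (y t)) i) t :=
            (EuclideanSpace.proj i : Plane →L[ℝ] ℝ).hasFDerivAt.comp_hasDerivAt t (hy t)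
          exact (h1.sub_const _).const_mul σ
      refine monotoneOn_of_hasDerivWithinAt_nonneg (convex_Icc 0 T)
        (fun t _ => (hd t).continuousAt.continuousWithinAt) (fun t _ => (hd t).hasDerivWithinAt)
        fun t ht => ?_
      exact hc.le.trans (h _ (hout t (interior_subset ht)).le)
    refine ⟨(hout T ⟨hT, le_rfl⟩).le, ?_⟩
    have := hmono ⟨le_rfl, hT⟩ ⟨hT, le_rfl⟩ hT
    simpa using this

/-- The index of the end of a cord that is moved by a splitting. -/
def movedEnd (second : Bool) : Fin 2 := if second then 0 else 1

/-- The index of the end of a cord that is kept by a splitting. -/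
def keptEnd (second : Bool) : Fin 2 := if second then 1 else 0

theorem movedEnd_ne_keptEnd (β : Bool) : movedEnd β ≠ keptEnd β := by
  cases β <;> simp [movedEnd, keptEnd]

theorem piece_movedEnd (p : Plane) (r : ℝ) (β : Bool) : piece p r β (movedEnd β) = r := by
  cases β <;> simp [movedEnd, piece]

theorem piece_keptEnd (p : Plane) (r : ℝ) (β : Bool) :
    piece p r β (keptEnd β) = p (keptEnd β) := by
  cases β <;> simp [keptEnd, piece]

theorem IsCrossing.of_mem_crossings {γ : ℝ → Space} {p : Plane} {r : ℝ} (h : r ∈ crossings γ p)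
    {i j : Fin 2} (hij : i ≠ j) : IsCrossing γ (p i) (p j) r := by
  fin_cases i <;> fin_cases j
  · simp at hij
  · exact h
  · exact (mem_crossings.1 h).symm
  · simp at hij

/-- The energy lost in a splitting is at least half the squared length of the other piece. -/
theorem energy_piece_le {γ : ℝ → Space} {p : Plane} {r : ℝ} (h : r ∈ crossings γ p) (β : Bool) :
    energy γ (piece p r β) ≤ energy γ p - 1 / 2 * dist (γ (p (movedEnd β))) (γ r) ^ 2 := by
  rw [energy_eq _ (movedEnd_ne_keptEnd β), energy_eq p (movedEnd_ne_keptEnd β), piece_movedEnd,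
    piece_keptEnd]
  obtain ⟨h1, h2, h3⟩ := IsCrossing.iff_dist.1
    (IsCrossing.of_mem_crossings h (movedEnd_ne_keptEnd β))
  rw [← dist_eq_norm, ← dist_eq_norm, ← h1]
  nlinarith

namespace IsGenericKnot

variable {L : ℝ} {γ : ℝ → Space}

/-- After a splitting that cuts off a short piece, the flow moves the new end of the cord away from
the old one as long as it stays close to it. -/
theorem exists_pull (hK : IsGenericKnot L γ) : ∃ c > 0, ∃ ρ₀ > 0, ∀ (p q : Plane) (i j : Fin 2),
    i ≠ j → q j = p j → IsCrossing γ (p i) (p j) (q i) → |q i - p i| ≤ ρ₀ →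
      ∃ σ : ℝ, |σ| = 1 ∧ 0 < σ * (q i - p i) ∧
        ∀ z, ‖z - q‖ ≤ ρ₀ → c ≤ σ * -gradient (energy γ) z i := by
  have hk := hK.toIsKnot
  obtain ⟨ℓ, hℓ, hlen⟩ := hK.exists_length_bound
  obtain ⟨ρ, hρ, htan⟩ := hk.exists_almost_tangent
  obtain ⟨K, hKl⟩ := hk.isTorusFun_energy.exists_lipschitz hK.pos
  have hK0 : (0 : ℝ) ≤ K := K.2
  refine ⟨ℓ / 8, by positivity, min ρ (min (ℓ / 2) (ℓ / (4 * (K + 1)))), by positivity, ?_⟩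
  intro p q i j hij hqj hc hle
  obtain ⟨h1, -, h2⟩ := htan _ _ _ hc (hle.trans (min_le_left _ _))
  have hne : q i - p i ≠ 0 := sub_ne_zero.2 h1
  have hfar : ℓ / 2 ≤ ‖γ (p j) - γ (q i)‖ := by
    have i1 := hlen _ _ _ hc
    have i2 := hk.norm_sub_le (p i) (q i)
    have i3 : |q i - p i| ≤ ℓ / 2 := hle.trans ((min_le_right _ _).trans (min_le_left _ _))
    rw [← dist_eq_norm, dist_comm] at i2 ⊢
    have := dist_triangle (γ (p i)) (γ (q i)) (γ (p j))
    linarith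
  have hE : -gradient (energy γ) q i = inner ℝ (γ (p j) - γ (q i)) (deriv γ (q i)) := by
    rw [hk.gradient_energy q hij, hqj, ← inner_neg_left, neg_sub]
  rw [← hE] at h2
  refine ⟨SignType.sign (q i - p i), ?_, ?_, fun z hz => ?_⟩
  · rcases lt_or_gt_of_ne hne with h | h <;> simp [h]
  · rw [sign_mul_self]
    exact abs_pos.2 hne
  · have hq : 3 / 8 * ℓ ≤ SignType.sign (q i - p i) * -gradient (energy γ) q i := by
      have e : (q i - p i) * -gradient (energy γ) q i =
          (SignType.sign (q i - p i) * -gradient (energy γ) q i) * |q i - p i| := by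
        conv_lhs => rw [← sign_mul_abs (q i - p i)]
        ring
      rw [e] at h2
      have := le_of_mul_le_mul_right h2 (abs_pos.2 hne)
      linarith
    have hz2 : |gradient (energy γ) z i - gradient (energy γ) q i| ≤ ℓ / 4 := by
      have i1 := hKl.dist_le_mul z q
      rw [dist_eq_norm, dist_eq_norm] at i1
      have i2 := norm_coord_le (gradient (energy γ) z - gradient (energy γ) q) i
      have i3 : ‖z - q‖ ≤ ℓ / (4 * (K + 1)) :=
      hz.trans ((min_le_right _ _).trans (min_le_right _ _))
      rw [le_div_iff₀ (by positivity)] at i3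
      have i4 := norm_nonneg (z - q)
      simp only [PiLp.sub_apply] at i2
      nlinarith
    have hs : |SignType.sign (q i - p i) * (gradient (energy γ) z i - gradient (energy γ) q i)| ≤
        ℓ / 4 := by
      rcases lt_or_gt_of_ne hne with h | h
      · simpa [h, abs_sub_comm] using hz2
      · simpa [h] using hz2
    have := (abs_le.1 hs).2
    linarith

theorem fin_two_eq_or {i j k : Fin 2} (h : i ≠ j) : k = i ∨ k = j := by
  fin_cases i <;> fin_cases j <;> fin_cases k <;> simp_all

/-- Two consecutive splittings that both cut off short pieces are separated by a definite loss of
energy. -/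
theorem exists_drop_between (hK : IsGenericKnot L γ) : ∃ d > 0, ∃ θ > 0, ∃ κ > 0, ∀ F,
    IsTorusFun L F → (∀ p, ‖gradient F p - gradient (energy γ) p‖ ≤ θ) → ∀ p r β y T r' β',
      r ∈ crossings γ p → dist (γ (p (movedEnd β))) (γ r) < d → IsFlowLine F y →
      y 0 = piece p r β → 0 ≤ T → r' ∈ crossings γ (y T) →
      dist (γ (y T (movedEnd β'))) (γ r') < d → F (y T) ≤ F (y 0) - κ := by
  have hk := hK.toIsKnot
  obtain ⟨c, hc, ρ₀, hρ₀, hpull⟩ := hK.exists_pull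
  obtain ⟨ρ₁, hρ₁, hopp⟩ := hK.exists_radius_opposite
  obtain ⟨ρ₂, hρ₂, hsame⟩ := hK.exists_radius_same
  obtain ⟨ρ, hρ, hρe0, hρe1, hρe2⟩ : ∃ ρ > 0, ρ ≤ ρ₀ ∧ 2 * ρ < ρ₁ ∧ 2 * ρ < ρ₂ :=
    ⟨min ρ₀ (min (ρ₁ / 3) (ρ₂ / 3)), by positivity, min_le_left _ _, by
      have : min ρ₀ (min (ρ₁ / 3) (ρ₂ / 3)) ≤ ρ₁ / 3 := (min_le_right _ _).trans (min_le_left _ _)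
      linarith, by
      have : min ρ₀ (min (ρ₁ / 3) (ρ₂ / 3)) ≤ ρ₂ / 3 := (min_le_right _ _).trans (min_le_right _ _)
      linarith⟩
  obtain ⟨d, hd, hlift⟩ := hk.exists_dist_lt hρ
  refine ⟨d, hd, c / 2, by positivity, c / 2 * ρ, by positivity, ?_⟩
  intro F hF hθ p r β y T r' β' hr hrd hy hy0 hT hr' hrd'
  have hFd : Differentiable ℝ F := hF.smooth.differentiable (by simp)
  have hij := movedEnd_ne_keptEnd β
  have hyi : y 0 (movedEnd β) = r := by rw [hy0, piece_movedEnd]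
  have hyj : y 0 (keptEnd β) = p (keptEnd β) := by rw [hy0, piece_keptEnd]
  generalize movedEnd β = i at *
  generalize keptEnd β = j at *
  obtain ⟨k, hkr⟩ := hlift _ _ hrd
  -- the cord at the first splitting is replaced by a translate, with its old end near the new one
  have hcr := (IsCrossing.of_mem_crossings hr hij).shift hk (-k) 0 0
  simp only [Int.cast_zero, zero_mul, add_zero] at hcr
  have hnear : |r - (p i + ((-k : ℤ) : ℝ) * L)| < ρ := by
    convert hkr using 2
    push_cast
    ring
  generalize p i + ((-k : ℤ) : ℝ) * L = s at hcr hnear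
  obtain ⟨p', hp'i, hp'j⟩ : ∃ p' : Plane, p' i = s ∧ p' j = p j := by
    refine ⟨p + (s - p i) • EuclideanSpace.single i 1, ?_, ?_⟩
    · simp
    · simp [hij.symm]
  obtain ⟨σ, hσ, hσ2, hz⟩ := hpull p' (y 0) i j hij (by rw [hyj, hp'j])
    (by rw [hp'i, hp'j, hyi]; exact hcr) (by rw [hyi, hp'i]; exact hnear.le.trans hρe0)
  rw [hyi, hp'i] at hσ2
  have hzF : ∀ z, ‖z - y 0‖ ≤ ρ → c / 2 ≤ σ * -gradient F z i := by
    intro z hz'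
    have i1 := hz z (hz'.trans hρe0)
    have i2 := (norm_coord_le (gradient F z - gradient (energy γ) z) i).trans (hθ z)
    have i3 : |σ * (gradient F z i - gradient (energy γ) z i)| ≤ c / 2 := by
      rw [abs_mul, hσ, one_mul]
      exact i2
    have := (abs_le.1 i3).2
    linarith
  rcases hy.drop_or_monotone hFd (by positivity : 0 < c / 2) hσ hzF hT with h | ⟨h1, h2⟩
  · exact h
  exfalso
  have hi := (norm_coord_le (y T - y 0) i).trans h1
  have hj := (norm_coord_le (y T - y 0) j).trans h1
  simp only [PiLp.sub_apply] at hi hj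
  rw [hyi] at hi h2
  rw [hyj] at hj
  have hnear' : |y T i - s| ≤ 2 * ρ := by
    have := abs_add_le (y T i - r) (r - s)
    rw [sub_add_sub_cancel] at this
    linarith
  have hcr' := IsCrossing.of_mem_crossings hr' hij
  obtain ⟨k', hk'⟩ := hlift _ _ hrd'
  have hcr'' := hcr'.shift hk 0 0 k'
  simp only [Int.cast_zero, zero_mul, add_zero] at hcr''
  rcases fin_two_eq_or hij (k := movedEnd β') with h3 | h3
  · rw [h3] at hk'
    have := hsame _ _ _ _ _ _ hcr hcr'' (by linarith) (by linarith) (by linarith) ?_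
    · linarith
    · have h4 : 0 ≤ (σ * (r - s)) * (σ * (y T i - r)) := mul_nonneg hσ2.le h2
      have h5 : σ * σ = 1 := by rw [← abs_mul_abs_self, hσ, one_mul]
      calc (0 : ℝ) ≤ (σ * (r - s)) * (σ * (y T i - r)) := h4
        _ = (σ * σ) * ((r - s) * (y T i - r)) := by ring
        _ = _ := by rw [h5, one_mul]
  · rw [h3] at hk'
    have := hopp _ _ _ _ _ _ hcr hcr'' (by linarith) (by linarith) (by linarith)
    linarith

/-- For small perturbations `F` of the energy, two consecutive splittings lower `F` by a definite
amount. -/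
theorem exists_two_step_drop (hK : IsGenericKnot L γ) : ∃ θ > 0, ∃ κ > 0, ∀ F,
    IsTorusFun L F → (∀ p, |F p - energy γ p| ≤ θ) →
      (∀ p, ‖gradient F p - gradient (energy γ) p‖ ≤ θ) → ∀ x T r β y T' r' β',
      IsFlowLine F x → 0 ≤ T → r ∈ crossings γ (x T) → IsFlowLine F y → y 0 = piece (x T) r β →
      0 ≤ T' → r' ∈ crossings γ (y T') → F (piece (y T') r' β') ≤ F (x 0) - κ := by
  obtain ⟨d, hd, θ, hθ, κ, hκ, h⟩ := hK.exists_drop_between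
  obtain ⟨m, hm, hm1, hm2⟩ : ∃ m > 0, m ≤ κ ∧ m ≤ 1 / 2 * d ^ 2 :=
    ⟨min κ (1 / 2 * d ^ 2), by positivity, min_le_left _ _, min_le_right _ _⟩
  refine ⟨min θ (m / 8), by positivity, m / 2, by positivity, ?_⟩
  intro F hF h0 h1 x T r β y T' r' β' hx hT hr hy hy0 hT' hr'
  have hFd : Differentiable ℝ F := hF.smooth.differentiable (by simp)
  have hx1 : F (x T) ≤ F (x 0) := hx.antitone_energy hFd hT
  have hy1 : F (y T') ≤ F (y 0) := hy.antitone_energy hFd hT'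
  have hb : ∀ p, |F p - energy γ p| ≤ m / 8 := fun p => (h0 p).trans (min_le_right _ _)
  have b1 := abs_le.1 (hb (x T))
  have b2 := abs_le.1 (hb (y 0))
  have b3 := abs_le.1 (hb (y T'))
  have b4 := abs_le.1 (hb (piece (y T') r' β'))
  have e1 := energy_piece_le hr β
  have e2 := energy_piece_le hr' β'
  rw [← hy0] at e1
  have n1 : 0 ≤ dist (γ (x T (movedEnd β))) (γ r) ^ 2 := by positivity
  have n2 : 0 ≤ dist (γ (y T' (movedEnd β'))) (γ r') ^ 2 := by positivity
  by_cases s1 : dist (γ (x T (movedEnd β))) (γ r) < d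
  · by_cases s2 : dist (γ (y T' (movedEnd β'))) (γ r') < d
    · have := h F hF (fun p => (h1 p).trans (min_le_left _ _)) (x T) r β y T' r' β' hr s1 hy hy0
        hT' hr' s2
      linarith
    · push Not at s2
      have : d ^ 2 ≤ dist (γ (y T' (movedEnd β'))) (γ r') ^ 2 := by gcongr
      linarith
  · push Not at s1
    have : d ^ 2 ≤ dist (γ (x T (movedEnd β))) (γ r) ^ 2 := by gcongr
    linarith

end IsGenericKnot

/-! ### Unstable manifolds of critical points of index one -/

theorem inner_fderiv_gradient {F : Plane → ℝ} (hF : ContDiff ℝ ∞ F) (k v w : Plane) :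
    inner ℝ (fderiv ℝ (gradient F) k v) w = hessian F k v w := by
  have h1 : HasFDerivAt (fderiv ℝ F) (fderiv ℝ (fderiv ℝ F) k) k :=
    ((hF.fderiv_right (m := ∞) (by simp)).differentiable (by simp) k).hasFDerivAt
  have h2 : HasFDerivAt (gradient F) (fderiv ℝ (gradient F) k) k :=
    ((contDiff_gradient hF).differentiable (by simp) k).hasFDerivAt
  have h3 : HasFDerivAt (fun p => inner ℝ (gradient F p) w)
      ((innerSL ℝ w).comp (fderiv ℝ (gradient F) k)) k := by
    have := (innerSL ℝ w).hasFDerivAt.comp k h2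
    refine this.congr_of_eventuallyEq (Eventually.of_forall fun p => ?_)
    simp
  have h4 : HasFDerivAt (fun p => fderiv ℝ F p w)
      ((ContinuousLinearMap.apply ℝ ℝ w).comp (fderiv ℝ (fderiv ℝ F) k)) k :=
    (ContinuousLinearMap.apply ℝ ℝ w).hasFDerivAt.comp k h1
  have h5 : (fun p => inner ℝ (gradient F p) w) = fun p => fderiv ℝ F p w := by
    ext p
    exact inner_gradient_left
  rw [h5] at h3
  have := congrArg (fun l => l v) (h3.unique h4)
  simpa [real_inner_comm, hessian] using this

theorem hessian_comm {F : Plane → ℝ} (hF : ContDiff ℝ ∞ F) (k v w : Plane) :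
    hessian F k v w = hessian F k w v :=
  (hF.contDiffAt.isSymmSndFDerivAt (by simpa using (ENat.LEInfty.out : (2 : WithTop ℕ∞) ≤ ∞))) v w

theorem hessian_add_left {F : Plane → ℝ} (k u v w : Plane) :
    hessian F k (u + v) w = hessian F k u w + hessian F k v w := by simp [hessian]

theorem hessian_smul_left {F : Plane → ℝ} (k v w : Plane) (a : ℝ) :
    hessian F k (a • v) w = a * hessian F k v w := by simp [hessian]

theorem hessian_add_right {F : Plane → ℝ} (k u v w : Plane) :
    hessian F k u (v + w) = hessian F k u v + hessian F k u w := by simp [hessian]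

theorem hessian_smul_right {F : Plane → ℝ} (k v w : Plane) (a : ℝ) :
    hessian F k v (a • w) = a * hessian F k v w := by simp [hessian]

/-- At a critical point of index one there is a linear form that does not vanish on the nonzero
vectors on which the Hessian is negative. -/
theorem exists_direction_of_index_one {F : Plane → ℝ} (hF : ContDiff ℝ ∞ F) {k : Plane}
    (h : HasMorseIndex F k 1) : ∃ v, ∀ z, hessian F k z z < 0 → hessian F k v z ≠ 0 := by
  obtain ⟨⟨V, hV, hneg⟩, hmax⟩ := h
  obtain ⟨v, hvV, hv0⟩ : ∃ v ∈ V, v ≠ 0 := by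
    apply V.exists_mem_ne_zero_of_ne_bot
    rintro rfl
    simp at hV
  have hv := hneg v hvV hv0
  refine ⟨v, fun z hz h0 => ?_⟩
  have hli : LinearIndependent ℝ ![v, z] := by
    rw [LinearIndependent.pair_iff]
    intro a b hab
    have h1 : hessian F k v (a • v + b • z) = 0 := by rw [hab]; simp [hessian]
    have h2 : hessian F k z (a • v + b • z) = 0 := by rw [hab]; simp [hessian]
    rw [hessian_add_right, hessian_smul_right, hessian_smul_right, h0] at h1
    rw [hessian_add_right, hessian_smul_right, hessian_smul_right, hessian_comm hF, h0] at h2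
    constructor
    · rcases mul_eq_zero.1 (by linarith : a * hessian F k v v = 0) with h | h
      · exact h
      · linarith
    · rcases mul_eq_zero.1 (by linarith : b * hessian F k z z = 0) with h | h
      · exact h
      · linarith
  have h2 : (2 : ℕ) ∈ {n : ℕ | ∃ V : Submodule ℝ Plane, Module.finrank ℝ V = n ∧
      ∀ v ∈ V, v ≠ 0 → hessian F k v v < 0} := by
    refine ⟨Submodule.span ℝ (range ![v, z]), by simpa using finrank_span_eq_card hli, ?_⟩
    intro w hw hw0
    rw [Matrix.range_cons, Matrix.range_cons, Matrix.range_empty, union_empty] at hw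
    obtain ⟨a, b, rfl⟩ := Submodule.mem_span_pair.1 hw
    have e : hessian F k (a • v + b • z) (a • v + b • z) =
        a ^ 2 * hessian F k v v + b ^ 2 * hessian F k z z := by
      simp only [hessian_add_right, hessian_add_left, hessian_smul_left, hessian_smul_right]
      rw [hessian_comm hF k z v, h0]
      ring
    rw [e]
    by_cases ha : a = 0
    · have hb : b ≠ 0 := by
        rintro rfl
        simp [ha] at hw0
      have : 0 < b ^ 2 := by positivity
      rw [ha]
      nlinarith
    · have : 0 < a ^ 2 := by positivity
      have : 0 ≤ b ^ 2 := by positivity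
      nlinarith
  have := hmax h2
  omega

/-- `x` is a solution of the gradient equation of `F` for nonpositive times, which stays in the ball
of radius `ε` about `k` and emanates from `k`. -/
structure IsLocalUnstable (F : Plane → ℝ) (k : Plane) (ε : ℝ) (x : ℝ → Plane) : Prop where
  hasDerivAt : ∀ t ≤ 0, HasDerivAt x (-gradient F (x t)) t
  mem_ball : ∀ t ≤ 0, x t ∈ Metric.ball k ε
  tendsto : Tendsto x atBot (𝓝 k)

theorem IsLocalUnstable.shift {F : Plane → ℝ} {k : Plane} {ε : ℝ} {x : ℝ → Plane}
    (h : IsLocalUnstable F k ε x) {s : ℝ} (hs : s ≤ 0) :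
    IsLocalUnstable F k ε fun t => x (t + s) :=
  ⟨fun t ht => by simpa using (h.hasDerivAt (t + s) (by linarith)).comp_add_const t s,
    fun t ht => h.mem_ball _ (by linarith),
    h.tendsto.comp (tendsto_atBot_add_const_right _ s tendsto_id)⟩

theorem exists_antilipschitz_of_nondegenerate {F : Plane → ℝ} (hF : ContDiff ℝ ∞ F) {k : Plane}
    (hk : HessianNondegenerate F k) : ∃ m > 0, ∀ z, m * ‖z‖ ≤ ‖fderiv ℝ (gradient F) k z‖ := by
  have hker : LinearMap.ker (fderiv ℝ (gradient F) k).toLinearMap = ⊥ :=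
    LinearMap.ker_eq_bot'.2 fun z hz => hk z fun w => by
      have hz' : fderiv ℝ (gradient F) k z = 0 := hz
      rw [← inner_fderiv_gradient hF, hz', inner_zero_left]
  obtain ⟨K, hK, hK'⟩ := LinearMap.exists_antilipschitzWith _ hker
  have hK0 : (0 : ℝ) < K := by exact_mod_cast hK
  refine ⟨1 / K, by positivity, fun z => ?_⟩
  have h1 := hK'.le_mul_dist z 0
  rw [map_zero, dist_zero_right, dist_zero_right] at h1
  rw [div_mul_eq_mul_div, one_mul, div_le_iff₀ hK0, mul_comm]
  exact h1

/-- Near a nondegenerate critical point the Hessian is negative on the difference of any two points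
of the local unstable manifold: it decreases strictly along the flow, starting from `0`. -/
theorem exists_radius_hessian_neg {F : Plane → ℝ} (hF : ContDiff ℝ ∞ F) {k : Plane}
    (hk : HessianNondegenerate F k) : ∃ ε > 0, ∀ x y, IsLocalUnstable F k ε x →
      IsLocalUnstable F k ε y → x 0 ≠ y 0 → hessian F k (x 0 - y 0) (x 0 - y 0) < 0 := by
  obtain ⟨m, hm, hlow⟩ := exists_antilipschitz_of_nondegenerate hF hk
  set H := fderiv ℝ (gradient F) k with hH
  have hstrict : HasStrictFDerivAt (gradient F) H k :=
    (contDiff_gradient hF).contDiffAt.hasStrictFDerivAt (by simp)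
  have hev := hstrict.isLittleO.def (show (0 : ℝ) < m / 2 by positivity)
  obtain ⟨ε, hε, hball⟩ := Metric.eventually_nhds_iff_ball.1 hev
  refine ⟨ε, hε, fun x y hx hy hne => ?_⟩
  have hest : ∀ t ≤ 0, ‖gradient F (x t) - gradient F (y t) - H (x t - y t)‖ ≤
      m / 2 * ‖x t - y t‖ := fun t ht => hball (x t, y t) (by
    rw [← ball_prod_same]
    exact ⟨hx.mem_ball t ht, hy.mem_ball t ht⟩)
  set q : ℝ → ℝ := fun t => inner ℝ (H (x t - y t)) (x t - y t) with hq
  have hsymm : ∀ v w, inner ℝ (H v) w = (inner ℝ (H w) v : ℝ) := fun v w => by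
    rw [hH, inner_fderiv_gradient hF, inner_fderiv_gradient hF, hessian_comm hF]
  have hder : ∀ t ≤ 0, HasDerivAt q
      (2 * inner ℝ (H (x t - y t)) (-gradient F (x t) - -gradient F (y t))) t := fun t ht => by
    have h1 : HasDerivAt (fun t => x t - y t) (-gradient F (x t) - -gradient F (y t)) t :=
      (hx.hasDerivAt t ht).sub (hy.hasDerivAt t ht)
    have h2 : HasDerivAt (fun t => H (x t - y t)) (H (-gradient F (x t) - -gradient F (y t))) t :=
      H.hasFDerivAt.comp_hasDerivAt t h1
    have h3 := h2.inner ℝ h1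
    rw [hsymm (-gradient F (x t) - -gradient F (y t))] at h3
    rw [two_mul]
    exact h3
  have hle : ∀ t ≤ 0, 2 * inner ℝ (H (x t - y t)) (-gradient F (x t) - -gradient F (y t)) ≤
      -(m ^ 2 * ‖x t - y t‖ ^ 2) := fun t ht => by
    have h1 := hest t ht
    have h2 := hlow (x t - y t)
    have e : -gradient F (x t) - -gradient F (y t) =
        -(H (x t - y t)) - (gradient F (x t) - gradient F (y t) - H (x t - y t)) := by abel
    have h3 := abs_real_inner_le_norm (H (x t - y t))
      (gradient F (x t) - gradient F (y t) - H (x t - y t))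
    rw [e, inner_sub_right, inner_neg_right, real_inner_self_eq_norm_sq]
    have h4 := neg_abs_le (inner ℝ (H (x t - y t))
      (gradient F (x t) - gradient F (y t) - H (x t - y t)))
    have h5 := norm_nonneg (x t - y t)
    have h6 := norm_nonneg (H (x t - y t))
    have h7 : ‖H (x t - y t)‖ * ‖gradient F (x t) - gradient F (y t) - H (x t - y t)‖ ≤
        ‖H (x t - y t)‖ * (m / 2 * ‖x t - y t‖) := by gcongr
    have h8 : ‖H (x t - y t)‖ * (m / 2 * ‖x t - y t‖) ≤ 1 / 2 * ‖H (x t - y t)‖ ^ 2 := by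
      nlinarith
    have h9 : (m * ‖x t - y t‖) ^ 2 ≤ ‖H (x t - y t)‖ ^ 2 := by gcongr
    rw [mul_pow] at h9
    linarith
  have hanti : AntitoneOn q (Iic 0) := by
    have hsub : ∀ t ∈ interior (Iic (0 : ℝ)), t ≤ 0 := fun t ht =>
      mem_Iic.1 (interior_subset ht)
    refine antitoneOn_of_hasDerivWithinAt_nonpos (convex_Iic 0)
      (fun t ht => (hder t ht).continuousAt.continuousWithinAt)
      (fun t ht => (hder t (hsub t ht)).hasDerivWithinAt)
      fun t ht => (hle t (hsub t ht)).trans ?_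
    have : 0 ≤ m ^ 2 * ‖x t - y t‖ ^ 2 := by positivity
    linarith
  have hlim : Tendsto q atBot (𝓝 0) := by
    have h1 : Tendsto (fun t => x t - y t) atBot (𝓝 0) := by
      simpa using hx.tendsto.sub hy.tendsto
    have h2 : Tendsto (fun t => H (x t - y t)) atBot (𝓝 0) := by
      have := (H.continuous.tendsto 0).comp h1
      rwa [map_zero] at this
    have h3 := h2.inner (𝕜 := ℝ) h1
    rwa [inner_zero_left] at h3
  have hnonpos : ∀ t ≤ 0, q t ≤ 0 := fun t ht => by
    refine ge_of_tendsto hlim ?_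
    filter_upwards [eventually_le_atBot t] with u hu
    exact hanti (hu.trans ht) ht hu
  rw [← inner_fderiv_gradient hF]
  by_contra! hge
  have hzero : ∀ t ∈ Iic (0 : ℝ), q t = 0 := fun t ht =>
    le_antisymm (hnonpos t ht) (le_trans hge (hanti ht (by simp) ht))
  have h1 : HasDerivWithinAt q 0 (Iic 0) 0 :=
    (hasDerivWithinAt_const (0 : ℝ) (Iic 0) (0 : ℝ)).congr hzero (hzero 0 (by simp))
  have h2 := (uniqueDiffWithinAt_Iic (0 : ℝ)).eq_deriv _ h1 (hder 0 le_rfl).hasDerivWithinAt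
  have h3 := hle 0 le_rfl
  rw [← h2] at h3
  have h4 : 0 < ‖x 0 - y 0‖ := norm_pos_iff.2 (sub_ne_zero.2 hne)
  have : 0 < m ^ 2 * ‖x 0 - y 0‖ ^ 2 := by positivity
  linarith

theorem isLocalUnstable_const {F : Plane → ℝ} {k : Plane} (hk : k ∈ Crit F) {ε : ℝ} (hε : 0 < ε) :
    IsLocalUnstable F k ε fun _ => k :=
  ⟨fun t _ => by
    have h0 : gradient F k = 0 := hk
    simpa [h0] using hasDerivAt_const t k, fun _ _ => Metric.mem_ball_self hε, tendsto_const_nhds⟩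

theorem exists_eq_of_tendsto_atBot {φ : ℝ → ℝ} (hc : ContinuousOn φ (Iic 0))
    (hlim : Tendsto φ atBot (𝓝 0)) {w : ℝ} (hw : 0 < w * φ 0) (hle : |w| ≤ |φ 0|) :
    ∃ t ≤ 0, φ t = w := by
  have key : ∀ {φ : ℝ → ℝ} {w : ℝ}, ContinuousOn φ (Iic 0) → Tendsto φ atBot (𝓝 0) → 0 < w →
      w ≤ φ 0 → ∃ t ≤ 0, φ t = w := by
    intro φ w hc hlim hw hle
    obtain ⟨a, ha, ha0⟩ := ((hlim.eventually_lt_const hw).and (eventually_le_atBot 0)).exists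
    obtain ⟨t, ht, hte⟩ := intermediate_value_Icc ha0 (hc.mono Icc_subset_Iic_self) ⟨ha.le, hle⟩
    exact ⟨t, ht.2, hte⟩
  rcases pos_and_pos_or_neg_and_neg_of_mul_pos hw with ⟨h1, h2⟩ | ⟨h1, h2⟩
  · exact key hc hlim h1 (by rwa [abs_of_pos h1, abs_of_pos h2] at hle)
  · obtain ⟨t, ht, hte⟩ := key (φ := fun t => -φ t) (w := -w) hc.neg (by simpa using hlim.neg)
      (by linarith) (by rwa [abs_of_neg h1, abs_of_neg h2] at hle)
    exact ⟨t, ht, by linarith⟩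

/-- Two local unstable solutions on the same side of a critical point of index one: every point of
the second one sufficiently far in the past lies on the first one. -/
theorem exists_radius_common_point {F : Plane → ℝ} (hF : ContDiff ℝ ∞ F) {k : Plane}
    (hcrit : k ∈ Crit F) (hk : HessianNondegenerate F k) (hi : HasMorseIndex F k 1) :
    ∃ ε > 0, ∃ ℓ : Plane → ℝ, (∀ x, IsLocalUnstable F k ε x → x 0 ≠ k → ℓ (x 0) ≠ 0) ∧
      ∀ x y, IsLocalUnstable F k ε x → IsLocalUnstable F k ε y → (∀ t ≤ 0, y t ≠ k) →
        0 < ℓ (y 0) * ℓ (x 0) → ∃ n : ℕ, ∃ t ≤ 0, x t = y (-n) := by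
  obtain ⟨v, hv⟩ := exists_direction_of_index_one hF hi
  obtain ⟨ε, hε, hneg⟩ := exists_radius_hessian_neg hF hk
  have hconst := isLocalUnstable_const hcrit hε
  obtain ⟨ℓ, hℓ⟩ : ∃ ℓ : Plane → ℝ, ∀ p, ℓ p = hessian F k v (p - k) := ⟨_, fun _ => rfl⟩
  have hk0 : ℓ k = 0 := by simp [hℓ, hessian]
  have hinj : ∀ x y, IsLocalUnstable F k ε x → IsLocalUnstable F k ε y → x 0 ≠ y 0 →
      ℓ (x 0) ≠ ℓ (y 0) := fun x y hx hy hne he => by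
    refine hv _ (hneg x y hx hy hne) ?_
    have : hessian F k v (x 0 - y 0) = ℓ (x 0) - ℓ (y 0) := by simp [hessian, hℓ]
    rw [this, he, sub_self]
  have hcont : Continuous ℓ := by
    have : ℓ = fun p => fderiv ℝ (fderiv ℝ F) k v (p - k) := funext hℓ
    rw [this]
    fun_prop
  have hlim : ∀ x, IsLocalUnstable F k ε x → Tendsto (fun t => ℓ (x t)) atBot (𝓝 0) :=
    fun x hx => by
      have := (hcont.tendsto k).comp hx.tendsto
      rwa [hk0] at this
  have hcont' : ∀ x, IsLocalUnstable F k ε x → ContinuousOn (fun t => ℓ (x t)) (Iic 0) :=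
    fun x hx t ht =>
      (hcont.continuousAt.comp (hx.hasDerivAt t ht).continuousAt).continuousWithinAt
  refine ⟨ε, hε, ℓ, fun x hx hne => hk0 ▸ hinj x _ hx hconst hne, fun x y hx hy hyk hpos => ?_⟩
  -- `ℓ` does not vanish on the second solution, so it keeps its sign there
  have hsign : ∀ t ≤ 0, 0 < ℓ (y t) * ℓ (x 0) := by
    intro t ht
    by_contra! hle
    have hcy : ContinuousOn (fun t => ℓ (y t) * ℓ (x 0)) (Icc t 0) :=
      ((hcont' y hy).mono Icc_subset_Iic_self).mul continuousOn_const
    obtain ⟨u, hu, hu0⟩ := intermediate_value_Icc ht hcy ⟨hle, hpos.le⟩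
    rcases mul_eq_zero.1 hu0 with h | h
    · have := hinj _ _ (hy.shift hu.2) hconst (by simpa using hyk u hu.2)
      rw [hk0, zero_add] at this
      exact this h
    · rw [h, mul_zero] at hpos
      exact lt_irrefl _ hpos
  have hn : Tendsto (fun n : ℕ => |ℓ (y (-n))|) atTop (𝓝 0) := by
    have := (hlim y hy).comp (tendsto_neg_atTop_atBot.comp tendsto_natCast_atTop_atTop)
    simpa using this.abs
  have hx0 : 0 < |ℓ (x 0)| := abs_pos.2 (right_ne_zero_of_mul hpos.ne')
  obtain ⟨n, hn⟩ := (hn.eventually_lt_const hx0).exists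
  have hn0 : -(n : ℝ) ≤ 0 := by simp
  obtain ⟨t, ht, hte⟩ := exists_eq_of_tendsto_atBot (hcont' x hx) (hlim x hx)
    (hsign _ hn0) hn.le
  refine ⟨n, t, ht, ?_⟩
  by_contra hne
  exact hinj _ _ (hx.shift ht) (hy.shift hn0) (by simpa using hne) (by simpa using hte)

/-- The unstable manifold of a critical point of index one is swept out by countably many flow
lines. These only depend on the function near the critical point. -/
theorem exists_countable_base {L : ℝ} (hL : 0 < L) {F : Plane → ℝ} (hF : ContDiff ℝ ∞ F) {k : Plane}
    (hcrit : k ∈ Crit F) (hk : HessianNondegenerate F k) (hi : HasMorseIndex F k 1) {ε₀ : ℝ}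
    (hε₀ : 0 < ε₀) : ∃ A : Set Plane, A.Countable ∧ A ⊆ Metric.ball k ε₀ ∧ ∀ G, IsTorusFun L G →
      EqOn G F (Metric.ball k ε₀) → ∀ c ∈ unstableManifold G k,
        ∃ b ∈ A, ∃ t ≥ 0, c = flow G t b := by
  obtain ⟨ε₁, hε₁, ℓ, hne, hcommon⟩ := exists_radius_common_point hF hcrit hk hi
  obtain ⟨ε, hε, hεε, hεε'⟩ : ∃ ε > 0, ε ≤ ε₀ ∧ ε ≤ ε₁ :=
    ⟨min ε₀ ε₁, by positivity, min_le_left _ _, min_le_right _ _⟩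
  have hmono : ∀ x, IsLocalUnstable F k ε x → IsLocalUnstable F k ε₁ x := fun x hx =>
    ⟨hx.hasDerivAt, fun t ht => Metric.ball_subset_ball hεε' (hx.mem_ball t ht), hx.tendsto⟩
  -- at most one solution is chosen on each side of the critical point
  obtain ⟨A, hA, hAk, hA1, hA2⟩ : ∃ A : Set Plane, A.Countable ∧ k ∈ A ∧ A ⊆ Metric.ball k ε₀ ∧
      ∀ x, IsLocalUnstable F k ε x → (∀ t ≤ 0, x t ≠ k) → ∃ b ∈ A, ∃ t ≤ 0, x t = b := by
    have side : ∀ σ : ℝ, ∃ A : Set Plane, A.Countable ∧ A ⊆ Metric.ball k ε₀ ∧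
        ∀ x, IsLocalUnstable F k ε x → (∀ t ≤ 0, x t ≠ k) → 0 < σ * ℓ (x 0) →
          ∃ b ∈ A, ∃ t ≤ 0, x t = b := by
      intro σ
      by_cases h : ∃ y, IsLocalUnstable F k ε y ∧ (∀ t ≤ 0, y t ≠ k) ∧ 0 < σ * ℓ (y 0)
      · obtain ⟨y, hy, hyk, hyσ⟩ := h
        refine ⟨range fun n : ℕ => y (-n), countable_range _, ?_, fun x hx _ hxσ => ?_⟩
        · rintro _ ⟨n, rfl⟩
          exact Metric.ball_subset_ball hεε (hy.mem_ball _ (by simp))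
        · have hpos : 0 < ℓ (y 0) * ℓ (x 0) := by
            have h1 := mul_pos hyσ hxσ
            have h2 : 0 < σ ^ 2 * (ℓ (y 0) * ℓ (x 0)) := by linarith
            exact pos_of_mul_pos_right h2 (sq_nonneg σ)
          obtain ⟨n, t, ht, he⟩ := hcommon x y (hmono x hx) (hmono y hy) hyk hpos
          exact ⟨_, ⟨n, rfl⟩, t, ht, he⟩
      · push Not at h
        exact ⟨∅, countable_empty, empty_subset _, fun x hx hxk hxσ =>
          absurd hxσ (not_lt.2 (h x hx hxk))⟩
    obtain ⟨A, hA, hA1, hA2⟩ := side 1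
    obtain ⟨B, hB, hB1, hB2⟩ := side (-1)
    refine ⟨insert k (A ∪ B), (hA.union hB).insert k, mem_insert _ _,
      insert_subset (Metric.mem_ball_self hε₀) (union_subset hA1 hB1), fun x hx hxk => ?_⟩
    rcases lt_or_gt_of_ne (hne x (hmono x hx) (hxk 0 le_rfl)) with h | h
    · obtain ⟨b, hb, h⟩ := hB2 x hx hxk (by linarith)
      exact ⟨b, mem_insert_of_mem _ (Or.inr hb), h⟩
    · obtain ⟨b, hb, h⟩ := hA2 x hx hxk (by linarith)
      exact ⟨b, mem_insert_of_mem _ (Or.inl hb), h⟩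
  refine ⟨A, hA, hA1, fun G hG hGF c hc => ?_⟩
  obtain ⟨x, hx, rfl, hxlim⟩ := hc
  by_cases hck : ∃ t, x t = k
  · obtain ⟨t, ht⟩ := hck
    have hGk : gradient G k = 0 := by
      have : G =ᶠ[𝓝 k] F := hGF.eventuallyEq_of_mem (Metric.ball_mem_nhds k hε₀)
      have h0 : gradient F k = 0 := hcrit
      rwa [gradient, this.fderiv_eq]
    have hconst : IsFlowLine G fun _ => k := fun s => by
      simpa [hGk] using hasDerivAt_const s k
    have := hG.eq_of_isFlowLine hL hx hconst (t₀ := t) ht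
    exact ⟨k, hAk, 0, le_rfl, by rw [hG.flow_zero hL, this]⟩
  push Not at hck
  obtain ⟨s, hs⟩ := eventually_atBot.1 (hxlim.eventually (Metric.ball_mem_nhds k hε))
  have hloc : IsLocalUnstable F k ε fun t => x (t + min s 0) := by
    have hb : ∀ t ≤ 0, x (t + min s 0) ∈ Metric.ball k ε := fun t ht =>
      hs _ (by linarith [min_le_left s 0])
    refine ⟨fun t ht => ?_, hb, hxlim.comp (tendsto_atBot_add_const_right _ _ tendsto_id)⟩
    have h1 := hx.shift (min s 0) t
    have h2 : G =ᶠ[𝓝 (x (t + min s 0))] F := hGF.eventuallyEq_of_mem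
      (Metric.isOpen_ball.mem_nhds (Metric.ball_subset_ball hεε (hb t ht)))
    have h3 : gradient G (x (t + min s 0)) = gradient F (x (t + min s 0)) := by
      rw [gradient, h2.fderiv_eq, gradient]
    rwa [← h3]
  obtain ⟨b, hb, t, ht, hxb⟩ := hA2 _ hloc fun t _ => hck _
  refine ⟨b, hb, -(t + min s 0), by linarith [min_le_right s 0], ?_⟩
  have := hG.eq_flow hL (hx.shift (t + min s 0)) (-(t + min s 0))
  simp only [zero_add, neg_add_cancel] at this
  rw [this, ← hxb]

/-! ### Steering a flow line off its course -/

open Classical in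
/-- A function supported in a small ball extends to a doubly periodic function. -/
theorem exists_periodic_extension {L : ℝ} (hL : 0 < L) {h₀ : Plane → ℝ} (hh : ContDiff ℝ ∞ h₀)
    {z : Plane} {r : ℝ} (hr : r < L / 4) (hsupp : ∀ p, h₀ p ≠ 0 → p ∈ Metric.closedBall z r) :
    ∃ h, IsTorusFun L h ∧ (∀ p ∈ Metric.ball z (L / 4), h p = h₀ p) ∧
      ∀ p, h p ≠ 0 → ∃ v ∈ lattice L, p + v ∈ Metric.closedBall z r := by
  set h : Plane → ℝ := fun p => if H : ∃ v ∈ lattice L, p + v ∈ Metric.ball z (L / 4) then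
    h₀ (p + H.choose) else 0 with hdef
  have h1 : ∀ p, ∀ v ∈ lattice L, p + v ∈ Metric.ball z (L / 4) → h p = h₀ (p + v) := by
    intro p v hv hp
    have H : ∃ v ∈ lattice L, p + v ∈ Metric.ball z (L / 4) := ⟨v, hv, hp⟩
    have e : H.choose = v := by
      rw [← sub_eq_zero]
      refine lattice_discrete hL (sub_mem H.choose_spec.1 hv) ?_
      have := dist_triangle_right (p + H.choose) (p + v) z
      rw [dist_add_left, dist_eq_norm] at this
      have i1 : dist (p + H.choose) z < L / 4 := H.choose_spec.2
      have i2 : dist (p + v) z < L / 4 := hp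
      linarith
    simp only [hdef, dif_pos H, e]
  have h2 : ∀ p, (∀ v ∈ lattice L, p + v ∉ Metric.closedBall z r) → h p = 0 := by
    intro p hp
    by_cases H : ∃ v ∈ lattice L, p + v ∈ Metric.ball z (L / 4)
    · obtain ⟨v, hv, hpv⟩ := H
      rw [h1 p v hv hpv]
      by_contra h0
      exact hp v hv (hsupp _ h0)
    · simp only [hdef, dif_neg H]
  refine ⟨h, ⟨?_, fun p j k => ?_⟩, fun p hp => ?_, fun p hp => ?_⟩
  · rw [contDiff_iff_contDiffAt]
    intro p
    by_cases H : ∃ v ∈ lattice L, p + v ∈ Metric.ball z (L / 4)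
    · obtain ⟨v, hv, hpv⟩ := H
      have hs : ContDiff ℝ ∞ fun q => h₀ (q + v) := hh.comp (contDiff_id.add contDiff_const)
      refine hs.contDiffAt.congr_of_eventuallyEq ?_
      have hc : Continuous fun q : Plane => q + v := continuous_id.add continuous_const
      filter_upwards [hc.continuousAt (Metric.isOpen_ball.mem_nhds hpv)] with q hq
      exact h1 q v hv hq
    · push Not at H
      refine contDiffAt_const (c := (0 : ℝ)) |>.congr_of_eventuallyEq ?_
      filter_upwards [Metric.ball_mem_nhds p (show 0 < L / 4 - r by linarith)] with q hq
      refine h2 q fun v hv hqv => H v hv ?_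
      have i1 : dist (q + v) z ≤ r := hqv
      have i2 : dist q p < L / 4 - r := hq
      have i3 := dist_triangle (p + v) (q + v) z
      rw [dist_add_right, dist_comm p q] at i3
      rw [Metric.mem_ball]
      linarith
  · have hv := vec_mem_lattice L j k
    generalize (!₂[j * L, k * L] : Plane) = v at hv
    by_cases H : ∃ w ∈ lattice L, p + w ∈ Metric.ball z (L / 4)
    · obtain ⟨w, hw, hpw⟩ := H
      have e : p + v + (w - v) = p + w := by abel
      rw [h1 p w hw hpw, h1 (p + v) (w - v) (sub_mem hw hv) (by rwa [e]), e]
    · push Not at H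
      have hball : ∀ w ∈ lattice L, p + w ∉ Metric.closedBall z r := fun w hw hpw =>
        H w hw (Metric.closedBall_subset_ball hr hpw)
      rw [h2 p hball, h2 (p + v) fun w hw hpw => hball (v + w) (add_mem hv hw) (by
        rwa [← add_assoc])]
  · have := h1 p 0 (zero_mem _) (by simpa using hp)
    simpa using this
  · by_contra! hne
    exact hp (h2 p hne)

theorem IsFlowLine.contDiff {F : Plane → ℝ} (hF : ContDiff ℝ ∞ F) {x : ℝ → Plane}
    (hx : IsFlowLine F x) : ContDiff ℝ ∞ x := by
  have hd : Differentiable ℝ x := fun t => (hx t).differentiableAt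
  have he : deriv x = fun t => -gradient F (x t) := funext fun t => (hx t).deriv
  rw [contDiff_infty]
  intro n
  induction n with
  | zero => exact contDiff_zero.2 hx.continuous
  | succ n ih =>
    have : ((n + 1 : ℕ) : WithTop ℕ∞) = (n : WithTop ℕ∞) + 1 := by push_cast; rfl
    rw [this, contDiff_succ_iff_deriv]
    refine ⟨hd, by simp, ?_⟩
    rw [he]
    exact (((contDiff_gradient hF).of_le (by exact_mod_cast le_top)).comp ih).neg

theorem eq_smul_of_inner_eq_zero {e d : Plane} (he : ‖e‖ = 1) (h : inner ℝ e d = (0 : ℝ)) :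
    d = (inner ℝ (!₂[-e 1, e 0] : Plane) d : ℝ) • (!₂[-e 1, e 0] : Plane) := by
  have h1 : e 0 ^ 2 + e 1 ^ 2 = 1 := by
    have := EuclideanSpace.norm_sq_eq e
    rw [he, Fin.sum_univ_two] at this
    simpa using this.symm
  simp only [PiLp.inner_apply, Fin.sum_univ_two] at h ⊢
  simp at h ⊢
  ext i
  fin_cases i
  · simp
    linear_combination (e 0) * h - d 0 * h1
  · simp
    linear_combination (e 1) * h - d 1 * h1

theorem exists_smooth_inverse {φ : ℝ → ℝ} (hφ : ContDiff ℝ ∞ φ) (h0 : φ 0 = 0)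
    (hd : deriv φ 0 ≠ 0) : ∃ ψ : ℝ → ℝ, ψ 0 = 0 ∧
      (∀ᶠ u in 𝓝 0, ContDiffAt ℝ ∞ ψ u ∧ φ (ψ u) = u) ∧ ∀ᶠ s in 𝓝 0, ψ (φ s) = s := by
  have hder : ∀ s, HasDerivAt φ (deriv φ s) s := fun s =>
    (hφ.differentiable (by simp) s).hasDerivAt
  have hf' := (hder 0).hasFDerivAt_equiv hd
  set Φ := hφ.contDiffAt.toOpenPartialHomeomorph φ hf' (by simp) with hΦ
  have hcoe : (Φ : ℝ → ℝ) = φ := ContDiffAt.toOpenPartialHomeomorph_coe _ _ _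
  have hsource : (0 : ℝ) ∈ Φ.source := ContDiffAt.mem_toOpenPartialHomeomorph_source _ _ _
  have htarget : (0 : ℝ) ∈ Φ.target := by
    have := Φ.map_source hsource
    rwa [hcoe, h0] at this
  have hψ0 : Φ.symm 0 = 0 := by
    have := Φ.left_inv hsource
    rwa [hcoe, h0] at this
  refine ⟨Φ.symm, hψ0, ?_, ?_⟩
  · have hc : ContinuousAt Φ.symm 0 := Φ.symm.continuousAt htarget
    have h1 : ∀ᶠ u in 𝓝 0, deriv φ (Φ.symm u) ≠ 0 := by
      have hcd : Continuous (deriv φ) := hφ.continuous_deriv (by simp)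
      have : ContinuousAt (fun u => deriv φ (Φ.symm u)) 0 := hcd.continuousAt.comp hc
      exact this.eventually_ne (by rwa [hψ0])
    filter_upwards [h1, Φ.open_target.mem_nhds htarget] with u h1 h2
    refine ⟨Φ.contDiffAt_symm_deriv h1 h2 (by rw [hcoe]; exact hder _)
      (by rw [hcoe]; exact hφ.contDiffAt), ?_⟩
    have := Φ.right_inv h2
    rwa [hcoe] at this
  · filter_upwards [Φ.open_source.mem_nhds hsource] with s hs
    have := Φ.left_inv hs
    rwa [hcoe] at this

theorem contDiffAt_gradient {y : Plane → ℝ} {p : Plane} (h : ContDiffAt ℝ ∞ y p) :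
    ContDiffAt ℝ ∞ (gradient y) p :=
  (InnerProductSpace.toDual ℝ Plane).symm.toContinuousLinearEquiv.contDiff.contDiffAt.comp p
    (h.fderiv_right (m := ∞) (by simp))

/-- Near a noncritical point, a flow line is contained in the zero set of a smooth function with
nonvanishing gradient, and the zero set is invariant under the flow: the rate of change of the
function along the flow is at most a multiple of its absolute value. -/
theorem IsFlowLine.exists_label {F : Plane → ℝ} (hF : ContDiff ℝ ∞ F) {x : ℝ → Plane}
    (hx : IsFlowLine F x) (h0 : gradient F (x 0) ≠ 0) :
    ∃ y : Plane → ℝ, ∃ r > 0, ∃ K ≥ 0, (∀ᶠ s in 𝓝 0, y (x s) = 0) ∧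
      ∀ p ∈ Metric.ball (x 0) r, ContDiffAt ℝ ∞ y p ∧
        |inner ℝ (gradient y p) (gradient F p)| ≤ K * |y p| ∧ gradient y p ≠ 0 ∧
          ‖gradient y p‖ ≤ K := by
  have hg0 : 0 < ‖gradient F (x 0)‖ := norm_pos_iff.2 h0
  obtain ⟨e, he, hee⟩ : ∃ e : Plane, ‖e‖ = 1 ∧ inner ℝ e (-gradient F (x 0)) ≠ (0 : ℝ) := by
    refine ⟨‖gradient F (x 0)‖⁻¹ • gradient F (x 0), ?_, ?_⟩
    · rw [norm_smul, norm_inv, norm_norm, inv_mul_cancel₀ hg0.ne']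
    · rw [inner_neg_right, real_inner_smul_left, real_inner_self_eq_norm_sq]
      simp [hg0.ne']
  obtain ⟨n, hn⟩ : ∃ n : Plane, n = !₂[-e 1, e 0] := ⟨_, rfl⟩
  have hsplit : ∀ d, inner ℝ e d = (0 : ℝ) → d = (inner ℝ n d : ℝ) • n := fun d hd => by
    rw [hn]
    exact eq_smul_of_inner_eq_zero he hd
  have hen : inner ℝ e n = (0 : ℝ) := by
    rw [hn, PiLp.inner_apply, Fin.sum_univ_two]
    simp
    ring
  have hn1 : ‖n‖ = 1 := by
    rw [EuclideanSpace.norm_eq, Fin.sum_univ_two] at he ⊢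
    rw [← he, hn]
    simp [add_comm]
  -- the component of the orbit along `e` is used as a parameter of the orbit
  have hxs := hx.contDiff hF
  obtain ⟨φ, hφ⟩ : ∃ φ : ℝ → ℝ, ∀ s, φ s = inner ℝ e (x s - x 0) := ⟨_, fun _ => rfl⟩
  have hφs : ContDiff ℝ ∞ φ := by
    rw [funext hφ]
    exact contDiff_const.inner ℝ (hxs.sub contDiff_const)
  have hφd : deriv φ 0 ≠ 0 := by
    have h1 : HasDerivAt (fun s => inner ℝ e (x s - x 0))
        ((inner ℝ e (-gradient F (x 0)) : ℝ) + inner ℝ (0 : Plane) (x 0 - x 0)) 0 :=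
      (hasDerivAt_const (0 : ℝ) e).inner ℝ ((hx 0).sub_const (x 0))
    rw [← funext hφ] at h1
    rw [h1.deriv, inner_zero_left, add_zero]
    exact hee
  obtain ⟨ψ, hψ0, hψ, hψφ⟩ := exists_smooth_inverse hφs (by simp [hφ]) hφd
  obtain ⟨π, hπ⟩ : ∃ π : Plane → Plane, ∀ p, π p = x (ψ (inner ℝ e (p - x 0))) := ⟨_, fun _ => rfl⟩
  have hlin : ContDiff ℝ ∞ fun p : Plane => (inner ℝ e (p - x 0) : ℝ) :=
    contDiff_const.inner ℝ (contDiff_id.sub contDiff_const)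
  have hlin0 : Tendsto (fun p : Plane => (inner ℝ e (p - x 0) : ℝ)) (𝓝 (x 0)) (𝓝 0) := by
    have := hlin.continuous.tendsto (x 0)
    simpa using this
  have hψ' := hlin0.eventually hψ
  have hπ0 : π (x 0) = x 0 := by simp [hπ, hψ0]
  have hπs : ∀ᶠ p in 𝓝 (x 0), ContDiffAt ℝ ∞ π p := by
    filter_upwards [hψ'] with p hp
    rw [funext hπ]
    exact hxs.contDiffAt.comp p (hp.1.comp p hlin.contDiffAt)
  have hπc : Tendsto π (𝓝 (x 0)) (𝓝 (x 0)) := by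
    have := hπs.self_of_nhds.continuousAt.tendsto
    rwa [hπ0] at this
  obtain ⟨y, hy⟩ : ∃ y : Plane → ℝ, ∀ p, y p = inner ℝ n (p - π p) := ⟨_, fun _ => rfl⟩
  have hys : ∀ᶠ p in 𝓝 (x 0), ContDiffAt ℝ ∞ y p := by
    filter_upwards [hπs] with p hp
    rw [funext hy]
    exact contDiffAt_const.inner ℝ (contDiffAt_id.sub hp)
  have hyx : ∀ᶠ s in 𝓝 0, y (x s) = 0 := by
    filter_upwards [hψφ] with s hs
    rw [hy, hπ, ← hφ, hs, sub_self, inner_zero_right]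
  -- the gradient of `y` has component `1` along `n`
  have hgrad : ∀ᶠ p in 𝓝 (x 0), gradient y p ≠ 0 := by
    filter_upwards [hys] with p hp h0
    have h1 : HasDerivAt (fun u : ℝ => p + u • n) n 0 := by
      simpa using ((hasDerivAt_id (0 : ℝ)).smul_const n).const_add p
    have h2 : HasFDerivAt y (fderiv ℝ y p) (p + (0 : ℝ) • n) := by
      simpa using (hp.differentiableAt (by simp)).hasFDerivAt
    have h3 : HasDerivAt (fun u : ℝ => y (p + u • n)) (fderiv ℝ y p n) 0 :=
      h2.comp_hasDerivAt 0 h1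
    have h4 : (fun u : ℝ => y (p + u • n)) = fun u => y p + u := by
      ext u
      have : π (p + u • n) = π p := by
        rw [hπ, hπ, add_sub_right_comm, inner_add_right, real_inner_smul_right, hen]
        simp
      rw [hy, hy, this, add_sub_right_comm, inner_add_right, real_inner_smul_right,
        real_inner_self_eq_norm_sq, hn1]
      simp
    have h5 : HasDerivAt (fun u : ℝ => y p + u) 1 0 := (hasDerivAt_id (0 : ℝ)).const_add _
    rw [h4] at h3
    have h6 := h3.unique h5
    have h7 : inner ℝ (gradient y p) n = fderiv ℝ y p n := inner_gradient_left
    rw [h0, inner_zero_left, h6] at h7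
    norm_num at h7
  obtain ⟨m, hm⟩ : ∃ m : Plane → ℝ, ∀ p, m p = inner ℝ (gradient y p) (gradient F p) :=
    ⟨_, fun _ => rfl⟩
  have hms : ContDiffAt ℝ 1 m (x 0) := by
    rw [funext hm]
    exact ((contDiffAt_gradient hys.self_of_nhds).inner ℝ
      (contDiff_gradient hF).contDiffAt).of_le (by simp)
  have hmx : ∀ᶠ s in 𝓝 0, m (x s) = 0 := by
    have h1 : ∀ᶠ s in 𝓝 0, ContDiffAt ℝ ∞ y (x s) := hx.continuous.continuousAt.eventually hys
    filter_upwards [hyx.eventually_nhds, h1] with s hs h1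
    have h2 := hasDerivAt_comp_flowLine (hx s) (h1.differentiableAt (by simp))
    have h3 : HasDerivAt (fun s => y (x s)) 0 s :=
      (hasDerivAt_const s (0 : ℝ)).congr_of_eventuallyEq hs
    have := h2.unique h3
    rw [hm]
    rw [inner_neg_right] at this
    linarith
  obtain ⟨K, t, ht, hK⟩ := hms.exists_lipschitzOnWith
  have hmy : ∀ᶠ p in 𝓝 (x 0), |m p| ≤ K * |y p| := by
    have h1 : ∀ᶠ p in 𝓝 (x 0), m (π p) = 0 := by
      have hc : Tendsto (fun p : Plane => ψ (inner ℝ e (p - x 0))) (𝓝 (x 0)) (𝓝 0) := by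
        have := hψ.self_of_nhds.1.continuousAt.tendsto
        rw [hψ0] at this
        exact this.comp hlin0
      filter_upwards [hc.eventually hmx] with p hp
      rw [hπ]
      exact hp
    filter_upwards [h1, ht, hπc ht, hψ'] with p h1 h2 h3 h4
    have h5 : inner ℝ e (p - π p) = (0 : ℝ) := by
      have : p - π p = (p - x 0) - (π p - x 0) := by abel
      rw [this, inner_sub_right, hπ, ← hφ, h4.2, sub_self]
    have h6 : ‖p - π p‖ = |y p| := by
      rw [hsplit _ h5, norm_smul, hn1, mul_one, Real.norm_eq_abs, hy]
    have := hK.dist_le_mul p h2 (π p) h3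
    rwa [h1, Real.dist_eq, sub_zero, dist_eq_norm, h6] at this
  have hbound : ∀ᶠ p in 𝓝 (x 0), ‖gradient y p‖ < ‖gradient y (x 0)‖ + 1 :=
    (contDiffAt_gradient hys.self_of_nhds).continuousAt.norm.eventually_lt_const (by simp)
  obtain ⟨r, hr, hball⟩ := Metric.eventually_nhds_iff_ball.1
    (hys.and (hmy.and (hgrad.and hbound)))
  refine ⟨y, r, hr, max K (‖gradient y (x 0)‖ + 1), le_max_of_le_left K.2, hyx, fun p hp => ?_⟩
  obtain ⟨h1, h2, h3, h4⟩ := hball p hp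
  rw [hm] at h2
  refine ⟨h1, h2.trans ?_, h3, h4.le.trans (le_max_right _ _)⟩
  gcongr
  exact le_max_left _ _

/-- A function with `u' ≤ K |u| - w` and `w ≥ 0` that starts at `0` is negative once `w` has been
positive. -/
theorem neg_of_deriv_le {u u' w : ℝ → ℝ} {K a b c : ℝ}
    (hu : ∀ t ∈ Icc a b, HasDerivAt u (u' t) t) (hle : ∀ t ∈ Icc a b, u' t ≤ K * |u t| - w t)
    (hw : ∀ t ∈ Icc a b, 0 ≤ w t) (ha : u a = 0) (hc : c ∈ Icc a b) (hwc : 0 < w c) :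
    ∀ t ∈ Ioc c b, u t < 0 := by
  have hcont : ContinuousOn u (Icc a b) := fun t ht => (hu t ht).continuousAt.continuousWithinAt
  have hbar : ∀ δ > 0, ∀ t ∈ Icc a b, u t ≤ δ * Real.exp ((K + 1) * (t - a)) := by
    intro δ hδ
    have hB : ∀ t, HasDerivAt (fun t => δ * Real.exp ((K + 1) * (t - a)))
        (δ * (Real.exp ((K + 1) * (t - a)) * (K + 1))) t := fun t => by
      have h1 : HasDerivAt (fun t => (K + 1) * (t - a)) (K + 1) t := by
        simpa using ((hasDerivAt_id t).sub_const a).const_mul (K + 1)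
      exact (h1.exp).const_mul δ
    refine image_le_of_deriv_right_lt_deriv_boundary hcont
      (fun t ht => (hu t (Ico_subset_Icc_self ht)).hasDerivWithinAt) (by simp [ha, hδ.le]) hB ?_
    intro t ht he
    have h1 := hle t (Ico_subset_Icc_self ht)
    have h2 := hw t (Ico_subset_Icc_self ht)
    have h3 : 0 < δ * Real.exp ((K + 1) * (t - a)) := by positivity
    rw [he, abs_of_pos h3] at h1
    linarith
  have hnonpos : ∀ t ∈ Icc a b, u t ≤ 0 := by
    intro t ht
    have hlim : Tendsto (fun δ : ℝ => δ * Real.exp ((K + 1) * (t - a))) (𝓝[>] 0) (𝓝 0) := by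
      have : Tendsto (fun δ : ℝ => δ * Real.exp ((K + 1) * (t - a))) (𝓝 0)
          (𝓝 (0 * Real.exp ((K + 1) * (t - a)))) := tendsto_id.mul_const _
      rw [zero_mul] at this
      exact this.mono_left nhdsWithin_le_nhds
    refine ge_of_tendsto hlim ?_
    filter_upwards [self_mem_nhdsWithin] with δ hδ
    exact hbar δ hδ t ht
  set z : ℝ → ℝ := fun t => Real.exp (K * t) * u t with hz
  have hzd : ∀ t ∈ Icc a b, HasDerivAt z
      (Real.exp (K * t) * K * u t + Real.exp (K * t) * u' t) t := fun t ht => by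
    have h1 : HasDerivAt (fun t => K * t) K t := by simpa using (hasDerivAt_id t).const_mul K
    exact h1.exp.mul (hu t ht)
  have hzle : ∀ t ∈ Icc a b, Real.exp (K * t) * K * u t + Real.exp (K * t) * u' t ≤
      -(Real.exp (K * t) * w t) := fun t ht => by
    have h1 := hle t ht
    rw [abs_of_nonpos (hnonpos t ht)] at h1
    have h2 := mul_le_mul_of_nonneg_left h1 (Real.exp_nonneg (K * t))
    linarith
  have hanti : AntitoneOn z (Icc a b) := by
    have hsub : ∀ t ∈ interior (Icc a b), t ∈ Icc a b := fun t ht => interior_subset ht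
    refine antitoneOn_of_hasDerivWithinAt_nonpos (convex_Icc a b)
      (fun t ht => (hzd t ht).continuousAt.continuousWithinAt)
      (fun t ht => (hzd t (hsub t ht)).hasDerivWithinAt)
      fun t ht => (hzle t (hsub t ht)).trans ?_
    have := hw t (hsub t ht)
    have := Real.exp_nonneg (K * t)
    simp only [Left.neg_nonpos_iff]
    positivity
  intro t ht
  by_contra! hge
  have htm : t ∈ Icc a b := ⟨hc.1.trans ht.1.le, ht.2⟩
  have hzt : 0 ≤ z t := mul_nonneg (Real.exp_nonneg _) hge
  have hz0 : ∀ s ∈ Icc c t, z s = 0 := fun s hs => by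
    have hsm : s ∈ Icc a b := ⟨hc.1.trans hs.1, hs.2.trans ht.2⟩
    exact le_antisymm (mul_nonpos_of_nonneg_of_nonpos (Real.exp_nonneg _) (hnonpos s hsm))
      (hzt.trans (hanti hsm htm hs.2))
  have h1 : HasDerivWithinAt z 0 (Icc c t) c :=
    (hasDerivWithinAt_const c (Icc c t) (0 : ℝ)).congr hz0 (hz0 c ⟨le_rfl, ht.1.le⟩)
  have h2 := (uniqueDiffOn_Icc ht.1 c ⟨le_rfl, ht.1.le⟩).eq_deriv _ h1 (hzd c hc).hasDerivWithinAt
  have h3 := hzle c hc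
  rw [← h2] at h3
  have := mul_pos (Real.exp_pos (K * c)) hwc
  linarith

/-- The rate of change of a label along the flow of a function perturbed in the direction of the
label. -/
theorem inner_perturbed_le {A G X : Plane} {K C a c y : ℝ} (ha0 : 0 ≤ a) (ha1 : a ≤ 1)
    (hAG : |inner ℝ A G| ≤ K * |y|) (hA : ‖A‖ ≤ K) (hX : ‖X‖ ≤ C) :
    inner ℝ A (-(G + a • (c • A + y • X))) ≤ (K + K * C) * |y| - a * c * ‖A‖ ^ 2 := by
  have e : inner ℝ A (-(G + a • (c • A + y • X))) =
      -inner ℝ A G - a * c * ‖A‖ ^ 2 - a * (y * inner ℝ A X) := by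
    rw [inner_neg_right, inner_add_right, real_inner_smul_right, inner_add_right,
      real_inner_smul_right, real_inner_smul_right, real_inner_self_eq_norm_sq]
    ring
  have h1 : |inner ℝ A X| ≤ K * C := (abs_real_inner_le_norm A X).trans (by
    gcongr
    exact (norm_nonneg _).trans hA)
  have h2 : |a * (y * inner ℝ A X)| ≤ K * C * |y| := by
    rw [abs_mul, abs_mul, abs_of_nonneg ha0]
    calc a * (|y| * |inner ℝ A X|) ≤ 1 * (|y| * (K * C)) := by gcongr
      _ = _ := by ring
  have h3 := neg_abs_le (inner ℝ A G : ℝ)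
  have h4 := neg_abs_le (a * (y * inner ℝ A X))
  rw [e]
  linarith

/-- Small multiples of `h` keep the flow line from a given point close, on a compact time
interval. -/
theorem eventually_dist_flow_lt {L : ℝ} (hL : 0 < L) {F h : Plane → ℝ} (hF : IsTorusFun L F)
    (hh : IsTorusFun L h) {x : ℝ → Plane} (hx : IsFlowLine F x) (T : ℝ) {κ : ℝ} (hκ : 0 < κ) :
    ∀ᶠ a in 𝓝[>] (0 : ℝ), ∀ t ∈ Icc 0 T, dist (x t) (flow (F + a • h) t (x 0)) < κ := by
  obtain ⟨K, hK⟩ := hF.exists_lipschitz hL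
  obtain ⟨B, hB0, hB⟩ := hh.exists_bound_gradient hL
  have h1 : Tendsto (fun a : ℝ => gronwallBound 0 K (a * B) T) (𝓝[>] 0) (𝓝 0) := by
    have h2 : Tendsto (fun a : ℝ => a * B) (𝓝[>] 0) (𝓝 0) := by
      have : Tendsto (fun a : ℝ => a * B) (𝓝 0) (𝓝 (0 * B)) := tendsto_id.mul_const B
      rw [zero_mul] at this
      exact this.mono_left nhdsWithin_le_nhds
    have h3 := ((gronwallBound_continuous_ε 0 K T).tendsto 0).comp h2
    rwa [gronwallBound_ε0_δ0] at h3
  filter_upwards [h1.eventually_lt_const hκ, self_mem_nhdsWithin] with a ha ha0 t ht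
  have ha0 : 0 < a := ha0
  have hFa := hF.add (hh.const_smul a)
  have h2 := hx.dist_le_gronwall hK (hFa.isFlowLine_flow hL (x 0)) (ε := a * B) (fun p => by
    rw [gradient_add (hF.smooth.differentiable (by simp) p)
      ((hh.const_smul a).smooth.differentiable (by simp) p), add_sub_cancel_left,
      gradient_const_smul a (hh.smooth.differentiable (by simp) p), norm_smul, Real.norm_eq_abs,
      abs_of_pos ha0]
    gcongr
    exact hB p) t
  simp only [hFa.flow_zero hL, dist_self, abs_of_nonneg ht.1] at h2
  refine h2.trans_lt (lt_of_le_of_lt ?_ ha)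
  exact gronwallBound_mono le_rfl (by positivity) K.2 ht.2

/-- A label function of a flow line, cut off near `x 0` and extended periodically. -/
theorem exists_cutoff_label {L : ℝ} (hL : 0 < L) {z : Plane} {y : Plane → ℝ} {r : ℝ}
    (hrL : r ≤ L / 4) (hy : ∀ p ∈ Metric.ball z r, ContDiffAt ℝ ∞ y p) {ρ : ℝ} (hρ : 0 < ρ)
    (hρr : ρ < r) : ∃ h χ : Plane → ℝ, IsTorusFun L h ∧ ContDiff ℝ ∞ χ ∧ (∀ p, 0 ≤ χ p) ∧
      (∀ p ∈ Metric.ball z (ρ / 2), χ p = 1) ∧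
      (∀ p, h p ≠ 0 → ∃ v ∈ lattice L, p + v ∈ Metric.closedBall z ρ) ∧
      ∀ p ∈ Metric.ball z r, gradient h p = χ p • gradient y p + y p • gradient χ p := by
  let χ : ContDiffBump z := ⟨ρ / 2, ρ, by positivity, by linarith⟩
  have hχs : ContDiff ℝ ∞ (χ : Plane → ℝ) := χ.contDiff
  have hh₀ : ContDiff ℝ ∞ fun p => χ p * y p := by
    rw [contDiff_iff_contDiffAt]
    intro p
    by_cases hp : p ∈ Metric.ball z r
    · exact hχs.contDiffAt.mul (hy p hp)
    · refine (contDiffAt_const (c := (0 : ℝ))).congr_of_eventuallyEq ?_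
      have : p ∈ (Metric.closedBall z ρ)ᶜ := fun h => hp (Metric.closedBall_subset_ball hρr h)
      filter_upwards [Metric.isClosed_closedBall.isOpen_compl.mem_nhds this] with q hq
      have h0 : χ q = 0 := by
        rw [← Function.notMem_support, χ.support_eq]
        exact fun h => hq (Metric.ball_subset_closedBall h)
      rw [h0, zero_mul]
  obtain ⟨h, hh, hin, hsupp⟩ := exists_periodic_extension hL hh₀ (z := z) (hρr.trans_le hrL)
    fun p hp => by
      have h0 : p ∈ Function.support χ := left_ne_zero_of_mul hp
      rw [χ.support_eq] at h0
      exact Metric.ball_subset_closedBall h0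
  refine ⟨h, χ, hh, hχs, fun p => χ.nonneg, fun p hp =>
    χ.one_of_mem_closedBall (Metric.ball_subset_closedBall hp), hsupp, fun p hp => ?_⟩
  have he : h =ᶠ[𝓝 p] fun p => χ p * y p := by
    filter_upwards [Metric.isOpen_ball.mem_nhds (Metric.ball_subset_ball hrL hp)] with q hq
    exact hin q hq
  have h1 : fderiv ℝ (fun p => χ p * y p) p = χ p • fderiv ℝ y p + y p • fderiv ℝ χ p :=
    fderiv_mul (hχs.differentiable (by simp) p) ((hy p hp).differentiableAt (by simp))
  rw [gradient, he.fderiv_eq, h1]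
  simp [gradient]

/-- The flow line through a point `x (-T)` can be steered, by arbitrarily small multiples of a bump
function supported near the noncritical point `x 0`, so that it misses `x T`. -/
theorem exists_steering_core {L : ℝ} (hL : 0 < L) {F : Plane → ℝ} (hF : IsTorusFun L F)
    {x : ℝ → Plane} (hx : IsFlowLine F x) {y : Plane → ℝ} {r K T : ℝ} (hT : 0 < T)
    (hrL : r ≤ L / 4) (hr : 0 < r) (h0 : gradient F (x 0) ≠ 0)
    (hy : ∀ p ∈ Metric.ball (x 0) r, ContDiffAt ℝ ∞ y p ∧
        |inner ℝ (gradient y p) (gradient F p)| ≤ K * |y p| ∧ gradient y p ≠ 0 ∧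
          ‖gradient y p‖ ≤ K)
    (hxT : ∀ s ∈ Icc (-T) (2 * T), x s ∈ Metric.ball (x 0) (r / 2) ∧ y (x s) = 0) {ρ : ℝ}
    (hρ : 0 < ρ) (hρr : ρ < r) :
    ∃ h, IsTorusFun L h ∧ (∀ p, h p ≠ 0 → ∃ v ∈ lattice L, p + v ∈ Metric.closedBall (x 0) ρ) ∧
      ∀ᶠ a in 𝓝[>] (0 : ℝ), ∀ σ, flow (F + a • h) σ (x (-T)) ≠ x T := by
  obtain ⟨h, χ, hh, hχs, hχ0, hχ1, hsupp, hgrad⟩ :=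
    exists_cutoff_label hL hrL (fun p hp => (hy p hp).1) hρ hρr
  refine ⟨h, hh, hsupp, ?_⟩
  obtain ⟨C, hC⟩ := (isCompact_closedBall (x 0) r).exists_bound_of_continuousOn
    (contDiff_gradient hχs).continuous.continuousOn
  obtain ⟨B, hB0, hB⟩ := hh.exists_bound hL
  have hanti := hx.strictAnti_energy hL hF h0
  have hF0 := hF.smooth.continuous
  obtain ⟨g, hg, hg1, hg2⟩ : ∃ g > 0, F (x T) + 2 * g < F (x (T / 2)) ∧
      F (x (2 * T)) + 2 * g < F (x T) := by
    have i1 : F (x T) < F (x (T / 2)) := hanti (by linarith)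
    have i2 : F (x (2 * T)) < F (x T) := hanti (by linarith)
    refine ⟨min (F (x (T / 2)) - F (x T)) (F (x T) - F (x (2 * T))) / 3, ?_, ?_, ?_⟩
    · have := lt_min (sub_pos.2 i1) (sub_pos.2 i2)
      positivity
    · have := min_le_left (F (x (T / 2)) - F (x T)) (F (x T) - F (x (2 * T)))
      linarith
    · have := min_le_right (F (x (T / 2)) - F (x T)) (F (x T) - F (x (2 * T)))
      linarith
  obtain ⟨κ₁, hκ₁, hκ₁'⟩ := Metric.eventually_nhds_iff_ball.1
    ((hF0.tendsto (x (T / 2))).eventually_const_lt hg1)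
  obtain ⟨κ₂, hκ₂, hκ₂'⟩ := Metric.eventually_nhds_iff_ball.1
    ((hF0.tendsto (x (2 * T))).eventually_lt_const (show F (x (2 * T)) < F (x T) - 2 * g by
      linarith))
  have hclose := eventually_dist_flow_lt hL hF hh (hx.shift (-T)) (3 * T)
    (show 0 < min (min (r / 2) (ρ / 2)) (min κ₁ κ₂) by positivity)
  have hsmall : ∀ᶠ a in 𝓝[>] (0 : ℝ), a * B < g := by
    have : Tendsto (fun a : ℝ => a * B) (𝓝 0) (𝓝 (0 * B)) := tendsto_id.mul_const B
    rw [zero_mul] at this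
    exact (this.mono_left nhdsWithin_le_nhds).eventually_lt_const hg
  have hone : ∀ᶠ a in 𝓝[>] (0 : ℝ), a < 1 :=
    nhdsWithin_le_nhds (Iio_mem_nhds one_pos)
  filter_upwards [hclose, hsmall, hone, self_mem_nhdsWithin] with a hclose ha ha1 ha0
  have ha0 : 0 < a := ha0
  have hFa := hF.add (hh.const_smul a)
  simp only [zero_add] at hclose
  -- the perturbed flow line, with the same time parameter as `x`
  obtain ⟨Y, hY⟩ : ∃ Y : ℝ → Plane, ∀ s, Y s = flow (F + a • h) (s + T) (x (-T)) :=
    ⟨_, fun _ => rfl⟩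
  have hYline : IsFlowLine (F + a • h) Y := by
    rw [funext hY]
    exact (hFa.isFlowLine_flow hL (x (-T))).shift T
  have hYdist : ∀ s ∈ Icc (-T) (2 * T), dist (x s) (Y s) < min (min (r / 2) (ρ / 2)) (min κ₁ κ₂) :=
    fun s hs => by
      have := hclose (s + T) ⟨by linarith [hs.1], by linarith [hs.2]⟩
      rw [hY]
      simpa using this
  have hYball : ∀ s ∈ Icc (-T) (2 * T), Y s ∈ Metric.ball (x 0) r := fun s hs => by
    have i1 := (hYdist s hs).trans_le ((min_le_left _ _).trans (min_le_left _ _))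
    have i2 : dist (x s) (x 0) < r / 2 := (hxT s hs).1
    have i3 := dist_triangle_left (Y s) (x 0) (x s)
    rw [Metric.mem_ball]
    linarith
  have hu : ∀ s ∈ Ioc 0 (2 * T), y (Y s) < 0 := by
    refine neg_of_deriv_le (u := fun s => y (Y s)) (K := K + K * C) (a := -T)
      (w := fun s => a * χ (Y s) * ‖gradient y (Y s)‖ ^ 2)
      (fun s hs => hasDerivAt_comp_flowLine (hYline s)
        ((hy _ (hYball s hs)).1.differentiableAt (by simp))) (fun s hs => ?_) (fun s hs => ?_) ?_
      ⟨by linarith, by linarith⟩ ?_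
    · obtain ⟨-, h1, -, h2⟩ := hy _ (hYball s hs)
      rw [gradient_add (hF.smooth.differentiable (by simp) _)
        ((hh.const_smul a).smooth.differentiable (by simp) _),
        gradient_const_smul a (hh.smooth.differentiable (by simp) _), hgrad _ (hYball s hs)]
      exact inner_perturbed_le ha0.le ha1.le h1 h2
        (hC _ (Metric.ball_subset_closedBall (hYball s hs)))
    · have := hχ0 (Y s)
      positivity
    · have : Y (-T) = x (-T) := by rw [hY, neg_add_cancel, hFa.flow_zero hL]
      simp only [this]
      exact (hxT (-T) ⟨le_rfl, by linarith⟩).2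
    · have hm : (0 : ℝ) ∈ Icc (-T) (2 * T) := ⟨by linarith, by linarith⟩
      have i1 : χ (Y 0) = 1 := hχ1 _ (by
        rw [Metric.mem_ball, dist_comm]
        exact (hYdist 0 hm).trans_le ((min_le_left _ _).trans (min_le_right _ _)))
      have i2 := norm_pos_iff.2 (hy _ (hYball 0 hm)).2.2.1
      simp only [i1]
      positivity
  intro σ hσ
  have hYσ : Y (σ - T) = x T := by rw [hY, sub_add_cancel, hσ]
  have hE : Antitone fun s => (F + a • h) (Y s) :=
    hYline.antitone_energy (hFa.smooth.differentiable (by simp))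
  have hah : ∀ p, |a * h p| < g := fun p => by
    rw [abs_mul, abs_of_pos ha0]
    exact lt_of_le_of_lt (mul_le_mul_of_nonneg_left (hB p) ha0.le) ha
  have hval : ∀ p, (F + a • h) p = F p + a * h p := fun p => by simp
  have b0 := abs_lt.1 (hah (x T))
  -- by comparison of energies, `x T` could only be reached between the times `T / 2` and `2 * T`
  have hlow : T / 2 < σ - T := by
    by_contra! hle
    have i1 := hE hle
    simp only [hYσ, hval] at i1
    have i2 : F (x T) + 2 * g < F (Y (T / 2)) := hκ₁' _ (by
      rw [Metric.mem_ball, dist_comm]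
      exact (hYdist _ ⟨by linarith, by linarith⟩).trans_le
        ((min_le_right _ _).trans (min_le_left _ _)))
    have b1 := abs_lt.1 (hah (Y (T / 2)))
    linarith
  have hhigh : σ - T < 2 * T := by
    by_contra! hle
    have i1 := hE hle
    simp only [hYσ, hval] at i1
    have i2 : F (Y (2 * T)) < F (x T) - 2 * g := hκ₂' _ (by
      rw [Metric.mem_ball, dist_comm]
      exact (hYdist _ ⟨by linarith, by linarith⟩).trans_le
        ((min_le_right _ _).trans (min_le_right _ _)))
    have b1 := abs_lt.1 (hah (Y (2 * T)))
    linarith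
  have := hu (σ - T) ⟨by linarith, hhigh.le⟩
  rw [hYσ, (hxT T ⟨by linarith, by linarith⟩).2] at this
  exact lt_irrefl _ this

/-- A flow line can be steered, by arbitrarily small multiples of a bump function supported near one
of its noncritical points `x 0`, in such a way that the part that has passed this point since a
definite time cannot be reached any more from the part that is still to arrive. -/
theorem exists_steering {L : ℝ} (hL : 0 < L) {F : Plane → ℝ} (hF : IsTorusFun L F)
    {x : ℝ → Plane} (hx : IsFlowLine F x) (h0 : gradient F (x 0) ≠ 0) {O : Set Plane}
    (hO : O ∈ 𝓝 (x 0)) {τ : ℝ} (hτ : 0 < τ) :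
    ∃ h, IsTorusFun L h ∧ (∀ p, h p ≠ 0 → ∃ v ∈ lattice L, p + v ∈ O) ∧
      ∀ᶠ a in 𝓝[>] (0 : ℝ), ∀ s ≤ -τ, ∀ s' ≥ τ, ∀ t, flow (F + a • h) t (x s) ≠ x s' := by
  obtain ⟨y, r₁, hr₁, K, -, hyx, hy⟩ := hx.exists_label hF.smooth h0
  obtain ⟨r, hr, hrr, hrL⟩ : ∃ r > 0, r ≤ r₁ ∧ r ≤ L / 4 :=
    ⟨min r₁ (L / 4), by positivity, min_le_left _ _, min_le_right _ _⟩
  have hxr : ∀ᶠ s in 𝓝 0, x s ∈ Metric.ball (x 0) (r / 2) :=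
    hx.continuous.continuousAt.eventually (Metric.ball_mem_nhds _ (by positivity))
  obtain ⟨δ, hδ, hball⟩ := Metric.eventually_nhds_iff_ball.1 (hxr.and hyx)
  obtain ⟨T, hT, hTτ, hTδ⟩ : ∃ T > 0, T ≤ τ ∧ 2 * T < δ :=
    ⟨min τ (δ / 3), by positivity, min_le_left _ _, by linarith [min_le_right τ (δ / 3)]⟩
  have hanti := hx.strictAnti_energy hL hF h0
  -- the support of the bump is kept in a range of energies passed between the times `-T` and `T`
  obtain ⟨w, hw, hw1, hw2⟩ : ∃ w > 0, w ≤ F (x (-T)) - F (x 0) ∧ w ≤ F (x 0) - F (x T) := by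
    have i1 : F (x 0) < F (x (-T)) := hanti (by linarith)
    have i2 : F (x T) < F (x 0) := hanti hT
    exact ⟨_, lt_min (sub_pos.2 i1) (sub_pos.2 i2), min_le_left _ _, min_le_right _ _⟩
  have hFw : ∀ᶠ p in 𝓝 (x 0), |F p - F (x 0)| < w / 2 := by
    have : Continuous fun p => |F p - F (x 0)| := (hF.smooth.continuous.sub continuous_const).abs
    exact this.continuousAt.eventually_lt_const (by simpa using hw)
  obtain ⟨ρ₁, hρ₁, hρball⟩ := Metric.nhds_basis_closedBall.mem_iff.1 (inter_mem hFw hO)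
  obtain ⟨ρ, hρ, hρρ, hρr⟩ : ∃ ρ > 0, ρ ≤ ρ₁ ∧ ρ < r :=
    ⟨min ρ₁ (r / 2), by positivity, min_le_left _ _, by linarith [min_le_right ρ₁ (r / 2)]⟩
  obtain ⟨h, hh, hsupp, hev⟩ := exists_steering_core hL hF hx hT hrL hr h0
    (fun p hp => hy p (Metric.ball_subset_ball hrr hp))
    (fun s hs => hball s (by
      rw [mem_ball_zero_iff, Real.norm_eq_abs, abs_lt]
      exact ⟨by linarith [hs.1], by linarith [hs.2]⟩)) hρ hρr
  have hsupp' : ∀ p, h p ≠ 0 → ∃ v ∈ lattice L, |F (p + v) - F (x 0)| < w / 2 ∧ p + v ∈ O :=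
    fun p hp => by
      obtain ⟨v, hv, hpv⟩ := hsupp p hp
      exact ⟨v, hv, hρball (Metric.closedBall_subset_closedBall hρρ hpv)⟩
  refine ⟨h, hh, fun p hp => (hsupp' p hp).imp fun v hv => ⟨hv.1, hv.2.2⟩, ?_⟩
  have hgrad : ∀ p, w ≤ |F p - F (x 0)| → gradient h p = 0 := by
    intro p hp
    have hc : Continuous fun p => |F p - F (x 0)| := (hF.smooth.continuous.sub continuous_const).abs
    have : h =ᶠ[𝓝 p] fun _ => 0 := by
      filter_upwards [hc.continuousAt.eventually_const_lt
        (show w / 2 < |F p - F (x 0)| by linarith)] with q hq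
      by_contra hne
      obtain ⟨v, hv, hlt, -⟩ := hsupp' q hne
      rw [hF.periodic.add_lattice hv] at hlt
      linarith
    rw [gradient, this.fderiv_eq]
    simp
  filter_upwards [hev] with a ha s hs s' hs' t ht
  have hFa := hF.add (hh.const_smul a)
  have hder : ∀ u, w ≤ |F (x u) - F (x 0)| → HasDerivAt x (-gradient (F + a • h) (x u)) u := by
    intro u hu
    rw [gradient_add (hF.smooth.differentiable (by simp) _)
      ((hh.const_smul a).smooth.differentiable (by simp) _),
      gradient_const_smul a (hh.smooth.differentiable (by simp) _), hgrad _ hu, smul_zero, add_zero]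
    exact hx u
  have hflow : ∀ u v, u ≤ v → (∀ q ∈ Icc u v, w ≤ |F (x q) - F (x 0)|) →
      flow (F + a • h) (v - u) (x u) = x v := by
    intro u v huv hq
    have h1 := hFa.eqOn_Icc hL (fun q hq' => hder q (hq q hq'))
      (fun q _ => (hFa.isFlowLine_flow hL (x u)).shift (-u) q) (by
        simp [hFa.flow_zero hL]) (right_mem_Icc.2 huv)
    rw [h1, sub_eq_add_neg]
  have h1 : flow (F + a • h) (-T - s) (x s) = x (-T) := hflow s (-T) (by linarith) fun q hq => by
    have : F (x (-T)) ≤ F (x q) := hanti.antitone hq.2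
    refine le_trans ?_ (le_abs_self _)
    linarith
  have h2 : flow (F + a • h) (s' - T) (x T) = x s' := hflow T s' (by linarith) fun q hq => by
    have : F (x q) ≤ F (x T) := hanti.antitone hq.1
    refine le_trans ?_ (neg_le_abs _)
    linarith
  refine ha (-(s' - T) + (t + -(-T - s))) ?_
  rw [← hFa.flow_flow hL, ← hFa.flow_flow hL, ← h1, hFa.flow_flow hL (-(-T - s)), neg_add_cancel,
    hFa.flow_zero hL, ht, ← h2, hFa.flow_flow hL, neg_add_cancel, hFa.flow_zero hL]

/-! ### Cords whose splitting process runs into a given set -/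

theorem isClosed_exists_mem {Y Z : Type*} [TopologicalSpace Y] [TopologicalSpace Z] {K : Set Z}
    (hK : IsCompact K) {D : Set (Y × Z)} (hD : IsClosed D) :
    IsClosed {y | ∃ z ∈ K, (y, z) ∈ D} := by
  have := isCompact_iff_compactSpace.1 hK
  have h1 : IsClosed ((fun q : Y × K => (q.1, (q.2 : Z))) ⁻¹' D) := hD.preimage (by fun_prop)
  have h2 := isClosedMap_fst_of_compactSpace _ h1
  convert h2 using 1
  ext y
  constructor
  · rintro ⟨z, hz, h⟩
    exact ⟨(y, ⟨z, hz⟩), h, rfl⟩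
  · rintro ⟨⟨y', z⟩, h, rfl⟩
    exact ⟨z, z.2, h⟩

theorem continuous_piece (β : Bool) : Continuous fun q : Plane × ℝ => piece q.1 q.2 β := by
  cases β
  · exact continuous_mk.comp (((continuous_coord 0).comp continuous_fst).prodMk continuous_snd)
  · exact continuous_mk.comp (continuous_snd.prodMk ((continuous_coord 1).comp continuous_fst))

theorem exists_piece_shift {L : ℝ} {v : Plane} (hv : v ∈ lattice L) (k : ℤ) (β : Bool) :
    ∃ w ∈ lattice L, ∀ p r, piece (p + v) (r + k * L) β = piece p r β + w := by
  obtain ⟨⟨i, hi⟩, ⟨j, hj⟩⟩ := mem_lattice_iff.1 hv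
  cases β
  · refine ⟨_, vec_mem_lattice L i k, fun p r => ?_⟩
    ext l
    fin_cases l <;> simp [piece, hi]
  · refine ⟨_, vec_mem_lattice L k j, fun p r => ?_⟩
    ext l
    fin_cases l <;> simp [piece, hj]

section Bad

variable {L : ℝ} {N : Set Plane}

/-- The cords that flow into `C` up to time `T`. -/
def flowInto (F₀ : Plane → ℝ) (T : ℝ) (C : Set (Perturbation L N × Plane)) :
    Set (Perturbation L N × Plane) :=
  {q | ∃ t ∈ Icc 0 T, (q.1, flow (F₀ + q.1.1) t q.2) ∈ C}

/-- The cords that can be split, at a crossing at distance at least `d` from their ends, in such a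
way that one of the pieces lies in `C`. -/
def splitInto (γ : ℝ → Space) (d : ℝ) (C : Set (Perturbation L N × Plane)) :
    Set (Perturbation L N × Plane) :=
  {q | ∃ r ∈ Icc 0 L, ∃ β, (q.2, r) ∈ markedFar γ d ∧ (q.1, piece q.2 r β) ∈ C}

/-- The cords that, after `m` splittings, flow into `C`; each flow takes at most the time `T`, and
the crossings have distance at least `d` from the ends of the cord that is split. -/
def bad (γ : ℝ → Space) (F₀ : Plane → ℝ) (T d : ℝ) (C : Set (Perturbation L N × Plane)) :
    ℕ → Set (Perturbation L N × Plane)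
  | 0 => flowInto F₀ T C
  | m + 1 => flowInto F₀ T (splitInto γ d (bad γ F₀ T d C m))

variable {γ : ℝ → Space} {F₀ : Plane → ℝ} {T d : ℝ} {C : Set (Perturbation L N × Plane)}

theorem isClosed_flowInto (hL : 0 < L) (hF : IsTorusFun L F₀) (hC : IsClosed C) :
    IsClosed (flowInto F₀ T C) := by
  have h1 : Continuous fun z : (Perturbation L N × Plane) × ℝ =>
      (z.1.1, flow (F₀ + z.1.1.1) z.2 z.1.2) :=
    (continuous_fst.comp continuous_fst).prodMk ((Perturbation.continuous_flow hL hF).comp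
      ((continuous_fst.comp continuous_fst).prodMk
        (continuous_snd.prodMk (continuous_snd.comp continuous_fst))))
  exact isClosed_exists_mem isCompact_Icc (hC.preimage h1)

theorem isClosed_splitInto (hγ : Continuous γ) (hC : IsClosed C) :
    IsClosed (splitInto γ d C) := by
  have h2 : ∀ β, IsClosed {q : Perturbation L N × Plane |
      ∃ r ∈ Icc 0 L, (q.2, r) ∈ markedFar γ d ∧ (q.1, piece q.2 r β) ∈ C} := fun β => by
    have h1 : Continuous fun z : (Perturbation L N × Plane) × ℝ => (z.1.2, z.2) := by fun_prop
    have h3 : Continuous fun z : (Perturbation L N × Plane) × ℝ =>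
        (z.1.1, piece z.1.2 z.2 β) :=
      (continuous_fst.comp continuous_fst).prodMk ((continuous_piece β).comp h1)
    exact isClosed_exists_mem isCompact_Icc
      (((isClosed_markedFar hγ d).preimage h1).inter (hC.preimage h3))
  convert (h2 true).union (h2 false) using 1
  ext q
  simp only [splitInto, mem_ofPred_eq, mem_union, Bool.exists_bool]
  grind

theorem isClosed_bad (hL : 0 < L) (hF : IsTorusFun L F₀) (hγ : Continuous γ) (hC : IsClosed C)
    (m : ℕ) : IsClosed (bad γ F₀ T d C m) := by
  induction m with
  | zero => exact isClosed_flowInto hL hF hC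
  | succ m ih => exact isClosed_flowInto hL hF (isClosed_splitInto hγ ih)

theorem flowInto_mono {T' : ℝ} {C' : Set (Perturbation L N × Plane)} (hT : T ≤ T') (hC : C ⊆ C') :
    flowInto F₀ T C ⊆ flowInto F₀ T' C' := by
  rintro q ⟨t, ht, h⟩
  exact ⟨t, ⟨ht.1, ht.2.trans hT⟩, hC h⟩

theorem splitInto_mono {d' : ℝ} {C' : Set (Perturbation L N × Plane)} (hd : d' ≤ d) (hC : C ⊆ C') :
    splitInto γ d C ⊆ splitInto γ d' C' := by
  rintro q ⟨r, hr, β, h1, h2⟩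
  exact ⟨r, hr, β, markedFar_anti hd h1, hC h2⟩

theorem bad_mono {T' d' : ℝ} (hT : T ≤ T') (hd : d' ≤ d) (m : ℕ) :
    bad γ F₀ T d C m ⊆ bad γ F₀ T' d' C m := by
  induction m with
  | zero => exact flowInto_mono hT subset_rfl
  | succ m ih => exact flowInto_mono hT (splitInto_mono hd ih)

theorem flowInto_flow (hL : 0 < L) (hF : IsTorusFun L F₀) {g : Perturbation L N} {p : Plane} {t : ℝ}
    (ht : 0 ≤ t) (h : (g, flow (F₀ + g.1) t p) ∈ flowInto F₀ T C) :
    (g, p) ∈ flowInto F₀ (T + t) C := by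
  obtain ⟨s, hs, h⟩ := h
  refine ⟨s + t, ⟨by linarith [hs.1], by linarith [hs.2]⟩, ?_⟩
  simp only at h ⊢
  rwa [(g.isTorusFun_add hF).flow_flow hL] at h

theorem bad_flow (hL : 0 < L) (hF : IsTorusFun L F₀) {g : Perturbation L N} {p : Plane} {t : ℝ}
    (ht : 0 ≤ t) {m : ℕ} (h : (g, flow (F₀ + g.1) t p) ∈ bad γ F₀ T d C m) :
    (g, p) ∈ bad γ F₀ (T + t) d C m := by
  cases m with
  | zero => exact flowInto_flow hL hF ht h
  | succ m =>
    exact flowInto_mono le_rfl (splitInto_mono le_rfl (bad_mono (by linarith) le_rfl m))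
      (flowInto_flow hL hF ht h)

end Bad

/-! ### Cords reached after a number of splittings -/

/-- The cord `q` is a piece of a cord to which `p` flows up to time `T`, split at a crossing at
distance at least `d` from its ends. -/
def Step (L : ℝ) (γ : ℝ → Space) (F : Plane → ℝ) (T d : ℝ) (p q : Plane) : Prop :=
  ∃ t ∈ Icc 0 T, ∃ r ∈ Icc 0 L, ∃ β, (flow F t p, r) ∈ markedFar γ d ∧ q = piece (flow F t p) r β

/-- The cords reached from `p` after exactly `m` splittings. -/
def reach (L : ℝ) (γ : ℝ → Space) (F : Plane → ℝ) (T d : ℝ) (p : Plane) : ℕ → Set Plane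
  | 0 => {p}
  | m + 1 => {q | ∃ c ∈ reach L γ F T d p m, Step L γ F T d c q}

theorem mem_reach_succ {L : ℝ} {γ : ℝ → Space} {F : Plane → ℝ} {T d : ℝ} {p q : Plane} {m : ℕ} :
    q ∈ reach L γ F T d p (m + 1) ↔ ∃ c, Step L γ F T d p c ∧ q ∈ reach L γ F T d c m := by
  induction m generalizing q with
  | zero =>
    constructor
    · rintro ⟨c, hc, h⟩
      obtain rfl : c = p := hc
      exact ⟨q, h, rfl⟩
    · rintro ⟨c, h, hc⟩
      obtain rfl : q = c := hc
      exact ⟨p, rfl, h⟩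
  | succ m ih =>
    constructor
    · rintro ⟨c, hc, h⟩
      obtain ⟨c', h', hc'⟩ := ih.1 hc
      exact ⟨c', h', c, hc', h⟩
    · rintro ⟨c', h', c, hc', h⟩
      exact ⟨c, ih.2 ⟨c', h', hc'⟩, h⟩

theorem mem_bad_iff {L : ℝ} {N : Set Plane} {γ : ℝ → Space} {F₀ : Plane → ℝ} {T d : ℝ}
    {C : Set (Perturbation L N × Plane)} {g : Perturbation L N} {p : Plane} {m : ℕ} :
    (g, p) ∈ bad γ F₀ T d C m ↔
      ∃ c ∈ reach L γ (F₀ + g.1) T d p m, (g, c) ∈ flowInto F₀ T C := by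
  induction m generalizing p with
  | zero =>
    constructor
    · exact fun h => ⟨p, rfl, h⟩
    · rintro ⟨c, hc, h⟩
      obtain rfl : c = p := hc
      exact h
  | succ m ih =>
    constructor
    · rintro ⟨t, ht, r, hr, β, h1, h2⟩
      obtain ⟨c, hc, h⟩ := ih.1 h2
      exact ⟨c, mem_reach_succ.2 ⟨_, ⟨t, ht, r, hr, β, h1, rfl⟩, hc⟩, h⟩
    · rintro ⟨c, hc, h⟩
      obtain ⟨_, ⟨t, ht, r, hr, β, h1, rfl⟩, hc'⟩ := mem_reach_succ.1 hc
      exact ⟨t, ht, r, hr, β, h1, ih.2 ⟨c, hc', h⟩⟩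

/-- If the gradients of two functions agree along the flow lines that start at the cords reached
after fewer than `m` splittings, then the cords reached after `m` splittings agree. -/
theorem reach_congr {L : ℝ} (hL : 0 < L) {γ : ℝ → Space} {F F' : Plane → ℝ} (hF : IsTorusFun L F)
    (hF' : IsTorusFun L F') {T d : ℝ} {p : Plane} {m : ℕ}
    (h : ∀ i < m, ∀ c ∈ reach L γ F T d p i, ∀ t ∈ Icc 0 T,
      gradient F' (flow F t c) = gradient F (flow F t c)) :
    reach L γ F' T d p m = reach L γ F T d p m := by
  induction m with
  | zero => rfl
  | succ m ih =>
    have hm := ih fun i hi => h i (by omega)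
    have hflow : ∀ c ∈ reach L γ F T d p m, ∀ t ∈ Icc 0 T, flow F' t c = flow F t c := by
      intro c hc t ht
      have h1 := hF.isFlowLine_flow hL c
      have h2 := hF'.isFlowLine_flow hL c
      exact hF'.eqOn_Icc hL (a := 0) (b := T) (fun s _ => h2 s) (fun s hs => by
        rw [h m (by omega) c hc s hs]
        exact h1 s) (by rw [hF.flow_zero hL, hF'.flow_zero hL]) ht
    ext q
    simp only [reach, hm, Step, mem_ofPred_eq]
    constructor
    · rintro ⟨c, hc, t, ht, hs⟩
      exact ⟨c, hc, t, ht, by rwa [hflow c hc t ht] at hs⟩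
    · rintro ⟨c, hc, t, ht, hs⟩
      exact ⟨c, hc, t, ht, by rwa [hflow c hc t ht]⟩

/-! ### Cords to be avoided -/

/-- The standing assumptions on the unperturbed function `F₀`, the set `N` on which the
perturbations vanish, and the open set `G` of perturbations that are considered. -/
structure Admissible (L : ℝ) (γ : ℝ → Space) (F₀ : Plane → ℝ) (N : Set Plane)
    (G : Set (Perturbation L N)) : Prop where
  knot : IsGenericKnot L γ
  torus : IsTorusFun L F₀
  invariant : IsInvariant L N
  disjoint : Disjoint (closure N) (closure (cordsMeetingKnot γ))
  isOpen : IsOpen G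
  speed : ∃ V, ∀ g ∈ G, ∀ p, ‖gradient (F₀ + g.1) p‖ ≤ V
  regular : ∀ g ∈ G, ∀ p ∈ closure (cordsMeetingKnot γ), gradient (F₀ + g.1) p ≠ 0

/-- A set `C` of cords to be avoided, depending on the perturbation: it depends only on the
gradient of the perturbation along a set `A` which flow lines leave instantly, and for a dense set
of "nice" perturbations it is locally finite. -/
structure IsTarget {L : ℝ} {N : Set Plane} (γ : ℝ → Space) (F₀ : Plane → ℝ)
    (G : Set (Perturbation L N)) (C : Set (Perturbation L N × Plane)) (A : Set Plane)
    (Nice : Perturbation L N → Prop) : Prop where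
  isClosed : IsClosed C
  add_lattice : ∀ g p, ∀ v ∈ lattice L, (g, p) ∈ C → (g, p + v) ∈ C
  subset : ∀ g p, (g, p) ∈ C → p ∈ closure (cordsMeetingKnot γ)
  isClosed_support : IsClosed A
  invariant_support : IsInvariant L A
  congr : ∀ g g' : Perturbation L N, (∀ p ∈ A, gradient g'.1 p = gradient g.1 p) →
    (∀ p, (g', p) ∈ C ↔ (g, p) ∈ C) ∧ (Nice g → Nice g')
  dense : ∀ g ∈ G, ∀ U ∈ 𝓝 g, ∃ g' ∈ U, Nice g'
  finite : ∀ g ∈ G, Nice g → ∀ R, {p | (g, p) ∈ C ∧ ‖p‖ ≤ R}.Finite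
  escape : ∀ g ∈ G, Nice g → ∀ x, IsFlowLine (F₀ + g.1) x → gradient (F₀ + g.1) (x 0) ≠ 0 →
    ∀ a b, a < b → ∃ s ∈ Ioo a b, x s ∉ A

theorem finite_lattice_inter {L : ℝ} (hL : 0 < L) (R : ℝ) :
    {v | v ∈ lattice L ∧ ‖v‖ ≤ R}.Finite := by
  obtain ⟨n, hn⟩ := exists_nat_ge (R / L)
  refine ((finite_Icc (-(n : ℤ)) n).image2 (fun j k : ℤ => (!₂[j * L, k * L] : Plane))
    (finite_Icc (-(n : ℤ)) n)).subset ?_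
  rintro v ⟨⟨j, k, rfl⟩, hv⟩
  have key : ∀ j : ℤ, |j * L| ≤ R → j ∈ Icc (-(n : ℤ)) n := by
    intro j hj
    rw [abs_mul, abs_of_pos hL, ← le_div_iff₀ hL] at hj
    have := hj.trans hn
    rw [mem_Icc, ← abs_le]
    exact_mod_cast this
  exact ⟨j, key j (by simpa using (norm_coord_le _ 0).trans hv), k,
    key k (by simpa using (norm_coord_le _ 1).trans hv), rfl⟩

theorem finite_translates {L : ℝ} (hL : 0 < L) {B : Set Plane} (hB : B.Finite) (R : ℝ) :
    {p | (∃ q ∈ B, q - p ∈ lattice L) ∧ ‖p‖ ≤ R}.Finite := by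
  refine (hB.biUnion fun q _ => (finite_lattice_inter hL (‖q‖ + R)).image fun v => q - v).subset ?_
  rintro p ⟨⟨q, hq, hv⟩, hp⟩
  refine mem_biUnion hq ⟨q - p, ⟨hv, (norm_sub_le _ _).trans (by gcongr)⟩, by simp⟩

section Targets

variable {L : ℝ} {N : Set Plane} {γ : ℝ → Space} {F₀ : Plane → ℝ} {G : Set (Perturbation L N)}

theorem isTarget_point (hA : Admissible L γ F₀ N G) {q : Plane}
    (hq : q ∈ closure (cordsMeetingKnot γ)) :
    IsTarget γ F₀ G {z : Perturbation L N × Plane | q - z.2 ∈ lattice L} ∅ fun _ => True where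
  isClosed := (isClosed_lattice hA.knot.pos).preimage (continuous_const.sub continuous_snd)
  add_lattice g p v hv h := by
    have e : q - (p + v) = (q - p) - v := by abel
    show q - (p + v) ∈ lattice L
    rw [e]
    exact sub_mem h hv
  subset g p h := by
    have := (isInvariant_cordsMeetingKnot hA.knot.toIsKnot).closure q hq _ (neg_mem h)
    simpa using this
  isClosed_support := isClosed_empty
  invariant_support := fun p hp => absurd hp (notMem_empty p)
  congr g g' _ := ⟨fun p => Iff.rfl, id⟩
  dense g _ U hU := ⟨g, mem_of_mem_nhds hU, trivial⟩
  finite g _ _ R := by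
    refine (finite_translates hA.knot.pos (finite_singleton q) R).subset ?_
    rintro p ⟨h1, h2⟩
    exact ⟨⟨q, rfl, h1⟩, h2⟩
  escape g _ _ x _ _ a b hab := by
    obtain ⟨s, hs⟩ := nonempty_Ioo.2 hab
    exact ⟨s, hs, notMem_empty _⟩

theorem finite_splitInto (hK : IsGenericKnot L γ) {d : ℝ} (hd : 0 < d)
    {C : Set (Perturbation L N × Plane)} {g : Perturbation L N}
    (hfin : ∀ R, {p | (g, p) ∈ C ∧ ‖p‖ ≤ R}.Finite) (R : ℝ) :
    {p | (g, p) ∈ splitInto γ d C ∧ ‖p‖ ≤ R}.Finite := by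
  -- the piece is one of finitely many cords, and it lies on the line of the cord that is split
  have key : ∀ β : Bool, {p : Plane | ∃ r ∈ Icc 0 L, ‖p‖ ≤ R ∧ (p, r) ∈ markedFar γ d ∧
      (g, piece p r β) ∈ C}.Finite := by
    intro β
    have hB := (hfin (R + L)).inter_of_left {q | γ (q 0) ≠ γ (q 1)}
    refine (hB.biUnion (t := fun q => (fun s => if β then !₂[s, q 1] else !₂[q 0, s]) ''
      {s ∈ Icc (-R) R | Collinear ℝ {γ (q 0), γ (q 1), γ s}})
      fun q hq => (hK.finite_collinear hq.2).image _).subset ?_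
    rintro p ⟨r, hr, hp, hfar, hC⟩
    obtain ⟨h1, h2, h3⟩ := hfar
    have hcr := markedFar_subset hd ⟨h1, h2, h3⟩
    have hcol := IsCrossing.collinear (mem_crossings.1 hcr)
    simp only at h1 h2 h3 hcol
    have hc0 := abs_le.1 ((norm_coord_le p 0).trans hp)
    have hc1 := abs_le.1 ((norm_coord_le p 1).trans hp)
    have hnorm : ‖piece p r β‖ ≤ R + L := by
      have e : ∀ q : Plane, ‖q‖ ^ 2 = q 0 ^ 2 + q 1 ^ 2 := fun q => by
        rw [EuclideanSpace.norm_sq_eq, Fin.sum_univ_two]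
        simp
      have hR : 0 ≤ R := (norm_nonneg p).trans hp
      have i1 := e p
      have i2 := e (piece p r β)
      have i3 : ‖p‖ ^ 2 ≤ R ^ 2 := by gcongr
      have i4 : r ^ 2 ≤ L ^ 2 := by
        have := hr.1
        have := hr.2
        gcongr
      have hL := hK.pos
      refine abs_le_of_sq_le_sq' ?_ (by positivity) |>.2
      cases β
      · simp only [piece, Bool.false_eq_true, if_false] at i2 ⊢
        rw [i2]
        simp
        nlinarith [sq_nonneg (p 1)]
      · simp only [piece, if_true] at i2 ⊢
        rw [i2]
        simp
        nlinarith [sq_nonneg (p 0)]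
    refine mem_biUnion (x := piece p r β) ⟨⟨hC, hnorm⟩, ?_⟩ ?_
    · cases β
      · have : γ (p 0) ≠ γ r := dist_pos.1 (hd.trans_le h2)
        simpa [piece] using this
      · have : γ r ≠ γ (p 1) := dist_pos.1 (hd.trans_le h3)
        simpa [piece] using this
    · cases β
      · refine ⟨p 1, ⟨hc1, by simpa [piece] using hcol⟩, ?_⟩
        ext i
        fin_cases i <;> simp [piece]
      · refine ⟨p 0, ⟨hc0, ?_⟩, ?_⟩
        · have : ({γ r, γ (p 1), γ (p 0)} : Set Space) = {γ (p 0), γ r, γ (p 1)} := by grind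
          simpa [piece, this] using hcol
        · ext i
          fin_cases i <;> simp [piece]
  refine ((key true).union (key false)).subset ?_
  rintro p ⟨⟨r, hr, β, h1, h2⟩, hp⟩
  cases β
  · exact Or.inr ⟨r, hr, hp, h1, h2⟩
  · exact Or.inl ⟨r, hr, hp, h1, h2⟩

/-- To keep the pieces of a cord out of a target means to keep the cord out of another target, with
the same support. -/
theorem IsTarget.splitInto (hA : Admissible L γ F₀ N G) {C : Set (Perturbation L N × Plane)}
    {A : Set Plane} {Nice : Perturbation L N → Prop} (h : IsTarget γ F₀ G C A Nice) {d : ℝ}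
    (hd : 0 < d) : IsTarget γ F₀ G (splitInto γ d C) A Nice where
  isClosed := isClosed_splitInto hA.knot.toIsKnot.continuous h.isClosed
  add_lattice := by
    rintro g p v hv ⟨r, hr, β, h1, h2⟩
    obtain ⟨w, hw, hw2⟩ := exists_piece_shift hv 0 β
    refine ⟨r, hr, β, ?_, ?_⟩
    · have := (hA.knot.toIsKnot.markedFar_shift hv 0).2 h1
      simpa using this
    · have := h.add_lattice g _ w hw h2
      rw [← hw2] at this
      simpa using this
  subset := by
    rintro g p ⟨r, hr, β, h1, h2⟩
    exact subset_closure (mem_cordsMeetingKnot_of_mem_markedCords (markedFar_subset hd h1))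
  isClosed_support := h.isClosed_support
  invariant_support := h.invariant_support
  congr g g' hgg := by
    obtain ⟨h1, h2⟩ := h.congr g g' hgg
    refine ⟨fun p => ?_, h2⟩
    simp only [CordSplitting.splitInto, mem_ofPred_eq, h1]
  dense := h.dense
  finite g hg hn R := finite_splitInto hA.knot hd (h.finite g hg hn) R
  escape := h.escape

end Targets

/-! ### Tangencies of flow lines with arcs of cords that meet the knot -/

/-- The determinant of two vectors of the plane. -/
def cross (v w : Plane) : ℝ := v 0 * w 1 - v 1 * w 0

theorem cross_add_smul (v e w : Plane) (a : ℝ) :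
    cross (v + a • e) w = cross v w + a * cross e w := by
  simp [cross]
  ring

theorem continuous_cross : Continuous fun q : Plane × Plane => cross q.1 q.2 := by
  unfold cross
  fun_prop

theorem eq_zero_of_cross_ne_zero {v w : Plane} (h : cross v w ≠ 0) {a b : ℝ}
    (hab : a • v - b • w = 0) : a = 0 ∧ b = 0 := by
  have h0 : a * v 0 - b * w 0 = 0 := by simpa using congrArg (fun p : Plane => p 0) hab
  have h1 : a * v 1 - b * w 1 = 0 := by simpa using congrArg (fun p : Plane => p 1) hab
  constructor
  · refine (mul_eq_zero.1 (?_ : a * cross v w = 0)).resolve_right h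
    unfold cross
    linear_combination w 1 * h0 - w 0 * h1
  · refine (mul_eq_zero.1 (?_ : b * cross v w = 0)).resolve_right h
    unfold cross
    linear_combination v 1 * h0 - v 0 * h1

/-- Two transverse curves meet in an isolated pair of parameters. -/
theorem eventually_eq_of_cross_ne_zero {x σ : ℝ → Plane} {t u : ℝ} {x' σ' : Plane}
    (hx : HasDerivAt x x' t) (hσ : HasDerivAt σ σ' u) (h : cross x' σ' ≠ 0) :
    ∀ᶠ z : ℝ × ℝ in 𝓝 (t, u), x z.1 = σ z.2 → z = (t, u) := by
  have hd : HasFDerivAt (fun z : ℝ × ℝ => x z.1 - σ z.2)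
      ((ContinuousLinearMap.toSpanSingleton ℝ x').comp (ContinuousLinearMap.fst ℝ ℝ ℝ) -
        (ContinuousLinearMap.toSpanSingleton ℝ σ').comp (ContinuousLinearMap.snd ℝ ℝ ℝ)) (t, u) :=
    (hx.hasFDerivAt.comp (t, u) hasFDerivAt_fst).sub (hσ.hasFDerivAt.comp (t, u) hasFDerivAt_snd)
  have hker : LinearMap.ker ((ContinuousLinearMap.toSpanSingleton ℝ x').comp
      (ContinuousLinearMap.fst ℝ ℝ ℝ) - (ContinuousLinearMap.toSpanSingleton ℝ σ').comp
        (ContinuousLinearMap.snd ℝ ℝ ℝ)).toLinearMap = ⊥ :=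
    LinearMap.ker_eq_bot'.2 fun z hz => by
      have hz' : z.1 • x' - z.2 • σ' = 0 := by simpa using hz
      obtain ⟨h1, h2⟩ := eq_zero_of_cross_ne_zero h hz'
      exact Prod.ext h1 h2
  obtain ⟨K, -, hK'⟩ := LinearMap.exists_antilipschitzWith _ hker
  have hev := hd.eventually_ne (c := 0) ⟨K, hK'⟩
  rw [eventually_nhdsWithin_iff] at hev
  filter_upwards [hev] with z hz heq
  by_contra hne
  exact hz hne (sub_eq_zero.2 heq)

/-- A function of one variable has arbitrarily small values that it takes only finitely often. -/
theorem exists_finite_level {φ φ' : ℝ → ℝ} {α β : ℝ} (h : ∀ u ∈ Icc α β, HasDerivAt φ (φ' u) u)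
    {δ : ℝ} (hδ : 0 < δ) : ∃ a ∈ Ioo 0 δ, {u ∈ Icc α β | φ u = a}.Finite := by
  set s : Set ℝ := {u ∈ Icc α β | φ' u = 0} with hs
  have hnull : MeasureTheory.volume (φ '' s) = 0 := by
    refine MeasureTheory.addHaar_image_eq_zero_of_det_fderivWithin_eq_zero _ (f' := fun _ => 0)
      (fun u hu => ?_) fun u _ => ?_
    · have := (h u hu.1).hasFDerivAt
      rw [hu.2, ContinuousLinearMap.toSpanSingleton_zero] at this
      exact this.hasFDerivWithinAt
    · simp [ContinuousLinearMap.det]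
  obtain ⟨a, ha, has⟩ : ∃ a ∈ Ioo 0 δ, a ∉ φ '' s := by
    by_contra! hall
    have h1 := MeasureTheory.measure_mono_null (fun a ha => hall a ha) hnull
    rw [Real.volume_Ioo] at h1
    simp at h1
    linarith
  refine ⟨a, ha, ?_⟩
  by_contra hinf
  obtain ⟨u, hu, hacc⟩ := Set.Infinite.exists_accPt_of_subset_isCompact
    (show Set.Infinite _ from hinf) isCompact_Icc (fun u hu => hu.1)
  have hφu : φ u = a := by
    have hcl : IsClosed {u ∈ Icc α β | φ u = a} := by
      have hc : ContinuousOn φ (Icc α β) := fun u hu => (h u hu).continuousAt.continuousWithinAt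
      exact hc.preimage_isClosed_of_isClosed isClosed_Icc isClosed_singleton
    have := hcl.closure_subset (mem_closure_iff_clusterPt.2 hacc.clusterPt)
    exact this.2
  have hne : φ' u ≠ 0 := fun h0 => has ⟨u, ⟨hu, h0⟩, hφu⟩
  have hev := (h u hu).eventually_ne (c := a) hne
  rw [accPt_iff_frequently_nhdsNE] at hacc
  obtain ⟨z, hz1, hz2⟩ := (hacc.and_eventually hev).exists
  exact hz2 hz1.2

/-- A linear function, cut off and extended periodically. -/
theorem exists_cutoff_linear {L : ℝ} (hL : 0 < L) (z e : Plane) {r : ℝ} (hr : 0 < r)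
    (hrL : r < L / 4) : ∃ h, IsTorusFun L h ∧ (∀ p ∈ Metric.ball z (r / 2), gradient h p = e) ∧
      ∀ p, h p ≠ 0 → ∃ v ∈ lattice L, p + v ∈ Metric.closedBall z r := by
  let χ : ContDiffBump z := ⟨r / 2, r, by positivity, by linarith⟩
  have hl : ContDiff ℝ ∞ fun p : Plane => (inner ℝ e p : ℝ) := contDiff_const.inner ℝ contDiff_id
  obtain ⟨h, hh, hin, hsupp⟩ := exists_periodic_extension hL (h₀ := fun p => χ p * inner ℝ e p)
    (χ.contDiff.mul hl) hrL (z := z) fun p hp => by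
      have h0 : p ∈ Function.support χ := left_ne_zero_of_mul hp
      rw [χ.support_eq] at h0
      exact Metric.ball_subset_closedBall h0
  refine ⟨h, hh, fun p hp => ?_, hsupp⟩
  have he : h =ᶠ[𝓝 p] fun p => innerSL ℝ e p := by
    filter_upwards [Metric.isOpen_ball.mem_nhds hp] with q hq
    have hq' : dist q z < r / 2 := hq
    rw [hin q (by rw [Metric.mem_ball]; linarith),
      χ.one_of_mem_closedBall (Metric.ball_subset_closedBall hq), one_mul]
    simp
  rw [gradient, he.fderiv_eq, ContinuousLinearMap.fderiv]
  exact (InnerProductSpace.toDual ℝ Plane).symm_apply_apply e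

section Tangencies

variable {L : ℝ} {N : Set Plane} {γ : ℝ → Space} {F₀ : Plane → ℝ} {G : Set (Perturbation L N)}

/-- The points of an arc, and their translates. -/
def arcPoints (L : ℝ) (σ : ℝ → Plane) (w : ℝ) : Set Plane :=
  {p | ∃ u ∈ Icc (-w) w, σ u - p ∈ lattice L}

/-- The points of an arc at which it is tangent to a flow line, and their translates. -/
def tangencies (L : ℝ) (N : Set Plane) (F₀ : Plane → ℝ) (σ : ℝ → Plane) (w : ℝ) :
    Set (Perturbation L N × Plane) :=
  {q | ∃ u ∈ Icc (-w) w, σ u - q.2 ∈ lattice L ∧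
    cross (gradient (F₀ + q.1.1) (σ u)) (deriv σ u) = 0}

/-- An arc is in good position with respect to the flow if it is tangent to it only finitely
often. -/
def FinitelyTangent (F : Plane → ℝ) (σ : ℝ → Plane) (w : ℝ) : Prop :=
  {u ∈ Icc (-w) w | cross (gradient F (σ u)) (deriv σ u) = 0}.Finite

theorem isClosed_tangencies (hL : 0 < L) (hF : IsTorusFun L F₀) {σ : ℝ → Plane} {w : ℝ}
    (hσ : ContDiff ℝ ∞ σ) : IsClosed (tangencies L N F₀ σ w) := by
  have hσc := hσ.continuous
  have hσd : Continuous (deriv σ) := hσ.continuous_deriv (by simp)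
  have h1 : Continuous fun z : (Perturbation L N × Plane) × ℝ => σ z.2 - z.1.2 := by fun_prop
  have h2 : Continuous fun z : (Perturbation L N × Plane) × ℝ =>
      cross (gradient (F₀ + z.1.1.1) (σ z.2)) (deriv σ z.2) :=
    continuous_cross.comp (((Perturbation.continuous_gradient hF).comp
      ((continuous_fst.comp continuous_fst).prodMk (hσc.comp continuous_snd))).prodMk
        (hσd.comp continuous_snd))
  exact isClosed_exists_mem isCompact_Icc
    (((isClosed_lattice hL).preimage h1).inter (isClosed_eq h2 continuous_const))

/-- A small multiple of a cut-off linear function makes the number of tangencies finite: the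
multiples to be avoided are the critical values of a function of one variable. -/
theorem exists_finitelyTangent (hA : Admissible L γ F₀ N G) {σ : ℝ → Plane} {w : ℝ}
    (hσ : ContDiff ℝ ∞ σ) {z : Plane} {r : ℝ} (hr : 0 < r) (hrL : r < L / 4)
    (hrN : ∀ p ∈ Metric.closedBall z r, p ∉ N)
    (hσz : ∀ u ∈ Icc (-w) w, σ u ∈ Metric.ball z (r / 2)) {e : Plane}
    (he : ∀ u ∈ Icc (-w) w, cross e (deriv σ u) ≠ 0) (g : Perturbation L N)
    {U : Set (Perturbation L N)} (hU : U ∈ 𝓝 g) : ∃ g' ∈ U, FinitelyTangent (F₀ + g'.1) σ w := by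
  have hL := hA.knot.pos
  obtain ⟨h, hh, hgrad, hsupp⟩ := exists_cutoff_linear hL z e hr hrL
  have hN : ∀ p ∈ N, h p = 0 := fun p hp => by
    by_contra hne
    obtain ⟨v, hv, hpv⟩ := hsupp p hne
    exact hrN _ hpv (hA.invariant p hp v hv)
  set H : Perturbation L N := ⟨h, hh.smooth, hh.periodic, hN⟩
  have hlim := Perturbation.tendsto_move_right hL g H
  obtain ⟨δ, hδ, hδU⟩ := mem_nhdsGT_iff_exists_Ioo_subset.1 (hlim hU)
  have hg := Perturbation.isTorusFun_add hA.torus g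
  obtain ⟨c, hc⟩ : ∃ c : ℝ → ℝ, ∀ u, c u = cross (gradient (F₀ + g.1) (σ u)) (deriv σ u) :=
    ⟨_, fun _ => rfl⟩
  have hσd : Differentiable ℝ (deriv σ) :=
    (contDiff_infty_iff_deriv.1 hσ).2.differentiable (by simp)
  have hcd : Differentiable ℝ c := by
    have i1 : Differentiable ℝ fun u => gradient (F₀ + g.1) (σ u) :=
      ((contDiff_gradient hg.smooth).comp hσ).differentiable (by simp)
    rw [funext hc]
    unfold cross
    fun_prop
  have hed : Differentiable ℝ fun u => cross e (deriv σ u) := by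
    unfold cross
    fun_prop
  obtain ⟨a, ha, hfin⟩ := exists_finite_level (φ := fun u => -c u / cross e (deriv σ u))
    (α := -w) (β := w) (fun u hu =>
      ((hcd u).neg.div (hed u) (he u hu)).hasDerivAt) hδ
  refine ⟨_, hδU ha, hfin.subset ?_⟩
  rintro u ⟨hu, h0⟩
  refine ⟨hu, ?_⟩
  have e1 : gradient (F₀ + (Perturbation.move g H a).1) (σ u) =
      gradient (F₀ + g.1) (σ u) + a • e := by
    rw [Perturbation.gradient_add_eq hA.torus, Perturbation.gradient_add_eq hA.torus, add_assoc]
    congr 1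
    rw [← hgrad _ (hσz u hu)]
    simp only [Perturbation.move]
    rw [gradient_add (g.2.1.differentiable (by simp) _)
      ((hh.const_smul a).smooth.differentiable (by simp) _),
      gradient_const_smul a (hh.smooth.differentiable (by simp) _)]
  rw [e1, cross_add_smul, ← hc] at h0
  rw [div_eq_iff (he u hu)]
  linarith

/-- A flow line that is nowhere constant cannot follow an arc that is tangent to the flow only
finitely often. -/
theorem escape_of_finitelyTangent (hL : 0 < L) {F : Plane → ℝ} (hF : IsTorusFun L F)
    {σ : ℝ → Plane} {w : ℝ} (hσ : ContDiff ℝ ∞ σ) (hfin : FinitelyTangent F σ w) {x : ℝ → Plane}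
    (hx : IsFlowLine F x) (h0 : gradient F (x 0) ≠ 0) {a b : ℝ} (hab : a < b) :
    ∃ s ∈ Ioo a b, x s ∉ arcPoints L σ w := by
  by_contra! hall
  -- every point of the flow line would be a tangency
  have htan : ∀ s ∈ Ioo a b, ∃ u ∈ {u ∈ Icc (-w) w | cross (gradient F (σ u)) (deriv σ u) = 0},
      σ u - x s ∈ lattice L := by
    intro s hs
    have hlim : Tendsto (fun n : ℕ => s + (b - s) * (1 / ((n : ℝ) + 1 + 1))) atTop (𝓝 s) := by
      have h1 : Tendsto (fun n : ℕ => 1 / (((n + 1 : ℕ) : ℝ) + 1)) atTop (𝓝 0) :=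
        tendsto_one_div_add_atTop_nhds_zero_nat.comp (tendsto_add_atTop_nat 1)
      have h2 : Tendsto (fun n : ℕ => s + (b - s) * (1 / (((n + 1 : ℕ) : ℝ) + 1))) atTop
          (𝓝 (s + (b - s) * 0)) := (h1.const_mul (b - s)).const_add s
      simpa using h2
    have hmem : ∀ n : ℕ, s + (b - s) * (1 / ((n : ℝ) + 1 + 1)) ∈ Ioo a b := fun n => by
      have h1 : 0 < b - s := by linarith [hs.2]
      have h2 : 0 < 1 / ((n : ℝ) + 1 + 1) := by positivity
      have h3 : 1 / ((n : ℝ) + 1 + 1) < 1 := by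
        rw [div_lt_one (by positivity)]
        have : (0 : ℝ) ≤ n := Nat.cast_nonneg n
        linarith
      have h4 := mul_pos h1 h2
      exact ⟨by linarith [hs.1], by nlinarith⟩
    have hne : ∀ n : ℕ, s + (b - s) * (1 / ((n : ℝ) + 1 + 1)) ≠ s := fun n => by
      have h1 : 0 < b - s := by linarith [hs.2]
      have h2 : 0 < 1 / ((n : ℝ) + 1 + 1) := by positivity
      have := mul_pos h1 h2
      linarith
    obtain ⟨t, ht⟩ : ∃ t : ℕ → ℝ, ∀ n, t n = s + (b - s) * (1 / ((n : ℝ) + 1 + 1)) :=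
      ⟨_, fun _ => rfl⟩
    simp only [← ht] at hlim hmem hne
    choose u hu hv using fun n => hall (t n) (hmem n)
    obtain ⟨u₀, hu₀, φ, hφ, hlu⟩ := isCompact_Icc.tendsto_subseq hu
    have hlt := hlim.comp hφ.tendsto_atTop
    have hlv : Tendsto (fun n => σ (u (φ n)) - x (t (φ n))) atTop (𝓝 (σ u₀ - x s)) :=
      ((hσ.continuous.tendsto u₀).comp hlu).sub ((hx.continuous.tendsto s).comp hlt)
    have hv₀ : σ u₀ - x s ∈ lattice L :=
      (isClosed_lattice hL).mem_of_tendsto hlv (Eventually.of_forall fun n => hv (φ n))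
    refine ⟨u₀, ⟨hu₀, ?_⟩, hv₀⟩
    by_contra hcr
    have hev : ∀ᶠ n in atTop, σ (u (φ n)) - x (t (φ n)) = σ u₀ - x s := by
      filter_upwards [hlv.eventually (Metric.ball_mem_nhds _ hL)] with n hn
      refine sub_eq_zero.1 (lattice_discrete hL (sub_mem (hv (φ n)) hv₀) ?_)
      rw [← dist_eq_norm]
      exact hn
    obtain ⟨v, hvdef⟩ : ∃ v, v = σ u₀ - x s := ⟨_, rfl⟩
    have hxv : x s + v = σ u₀ := by rw [hvdef]; abel
    have hgr : gradient F (σ u₀) = gradient F (x s) := by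
      rw [← hxv, hF.gradient_add_lattice (hvdef ▸ hv₀)]
    have hiso := eventually_eq_of_cross_ne_zero (x := fun t => x t + v) ((hx s).add_const v)
      ((hσ.differentiable (by simp) u₀).hasDerivAt) (by
        intro h
        apply hcr
        rw [hgr]
        simp only [cross, PiLp.neg_apply] at h ⊢
        linarith)
    obtain ⟨n, h1, h2⟩ := (hev.and ((hlt.prodMk_nhds hlu).eventually hiso)).exists
    have h3 := h2 (by
      simp only [Function.comp_apply]
      rw [hvdef, ← h1]
      abel)
    exact hne (φ n) (congrArg Prod.fst h3)
  obtain ⟨B, -, hB⟩ := hF.exists_bound_gradient hL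
  have hsub : x '' Ioo a b ⊆ {p | (∃ q ∈ σ '' {u ∈ Icc (-w) w |
      cross (gradient F (σ u)) (deriv σ u) = 0}, q - p ∈ lattice L) ∧
        ‖p‖ ≤ ‖x a‖ + B * (b - a)} := by
    rintro _ ⟨s, hs, rfl⟩
    obtain ⟨u, hu, hv⟩ := htan s hs
    refine ⟨⟨_, ⟨u, hu, rfl⟩, hv⟩, ?_⟩
    have h1 := hx.dist_le hB a s
    have h2 := norm_le_norm_add_norm_sub' (x s) (x a)
    have hB0 : 0 ≤ B := (norm_nonneg _).trans (hB 0)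
    have h3 : B * |s - a| ≤ B * (b - a) := by
      rw [abs_of_pos (by linarith [hs.1])]
      gcongr
      exact hs.2.le
    linarith
  have hinj := hx.injective hL hF h0
  exact (Ioo_infinite hab).image hinj.injOn ((finite_translates hL (hfin.image σ) _).subset hsub)

/-- The tangencies of flow lines with an arc of cords that meet the knot can be avoided. -/
theorem isTarget_tangencies (hA : Admissible L γ F₀ N G) {σ : ℝ → Plane} {w : ℝ}
    (hσ : ContDiff ℝ ∞ σ) {z : Plane} {r : ℝ} (hr : 0 < r) (hrL : r < L / 4)
    (hrN : ∀ p ∈ Metric.closedBall z r, p ∉ N)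
    (hσz : ∀ u ∈ Icc (-w) w, σ u ∈ Metric.ball z (r / 2)) {e : Plane}
    (he : ∀ u ∈ Icc (-w) w, cross e (deriv σ u) ≠ 0)
    (hσS : ∀ u, σ u ∈ cordsMeetingKnot γ) :
    IsTarget γ F₀ G (tangencies L N F₀ σ w) (arcPoints L σ w)
      fun g => FinitelyTangent (F₀ + g.1) σ w where
  isClosed := isClosed_tangencies hA.knot.pos hA.torus hσ
  add_lattice := by
    rintro g p v hv ⟨u, hu, h1, h2⟩
    refine ⟨u, hu, ?_, h2⟩
    have e : σ u - (p + v) = (σ u - p) - v := by abel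
    simp only at h1 ⊢
    rw [e]
    exact sub_mem h1 hv
  subset := by
    rintro g p ⟨u, hu, h1, h2⟩
    refine subset_closure ?_
    have := isInvariant_cordsMeetingKnot hA.knot.toIsKnot _ (hσS u) _ (neg_mem h1)
    simpa using this
  isClosed_support := by
    have h1 : Continuous fun z : Plane × ℝ => σ z.2 - z.1 := by
      have := hσ.continuous
      fun_prop
    exact isClosed_exists_mem isCompact_Icc ((isClosed_lattice hA.knot.pos).preimage h1)
  invariant_support := by
    rintro p ⟨u, hu, h1⟩ v hv
    refine ⟨u, hu, ?_⟩
    have e : σ u - (p + v) = (σ u - p) - v := by abel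
    rw [e]
    exact sub_mem h1 hv
  congr g g' h := by
    have h' : ∀ u ∈ Icc (-w) w, gradient (F₀ + g'.1) (σ u) = gradient (F₀ + g.1) (σ u) := by
      intro u hu
      rw [Perturbation.gradient_add_eq hA.torus, Perturbation.gradient_add_eq hA.torus,
        h _ ⟨u, hu, by simp⟩]
    constructor
    · intro p
      constructor
      · rintro ⟨u, hu, h1, h2⟩
        exact ⟨u, hu, h1, by rwa [← h' u hu]⟩
      · rintro ⟨u, hu, h1, h2⟩
        exact ⟨u, hu, h1, by rwa [h' u hu]⟩
    · intro hn
      refine hn.subset ?_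
      rintro u ⟨hu, h0⟩
      exact ⟨hu, by rwa [← h' u hu]⟩
  dense g _ U hU := exists_finitelyTangent hA hσ hr hrL hrN hσz he g hU
  finite g _ hn R := by
    refine (finite_translates hA.knot.pos (hn.image σ) R).subset ?_
    rintro p ⟨⟨u, hu, h1, h2⟩, hp⟩
    exact ⟨⟨_, ⟨u, ⟨hu, h2⟩, rfl⟩, h1⟩, hp⟩
  escape g _ hn x hx h0 a b hab :=
    escape_of_finitelyTangent hA.knot.pos (Perturbation.isTorusFun_add hA.torus g) hσ hn hx h0 hab

end Tangencies

theorem IsKnot.markedCords_shift {L : ℝ} {γ : ℝ → Space} (hK : IsKnot L γ) {p : Plane} {r : ℝ}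
    {v : Plane} (hv : v ∈ lattice L) (k : ℤ) :
    (p + v, r + k * L) ∈ markedCords γ ↔ (p, r) ∈ markedCords γ := by
  obtain ⟨⟨i, hi⟩, ⟨j, hj⟩⟩ := mem_lattice_iff.1 hv
  simp [markedCords, crossings, hi, hj, hK.periodic_int]

theorem cross_rotate_ne_zero {w : Plane} (hw : w ≠ 0) : cross !₂[w 1, -w 0] w ≠ 0 := by
  intro h
  apply hw
  have h' : w 1 * w 1 + w 0 * w 0 = 0 := by simpa [cross] using h
  ext i
  fin_cases i
  · show w 0 = 0
    nlinarith [mul_self_nonneg (w 0), mul_self_nonneg (w 1)]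
  · show w 1 = 0
    nlinarith [mul_self_nonneg (w 0), mul_self_nonneg (w 1)]

/-! ### Finiteness of the splittings in bounded time -/

section Isolating

variable {L : ℝ} {N : Set Plane} {γ : ℝ → Space} {F₀ : Plane → ℝ} {G : Set (Perturbation L N)}

/-- Near a given marked cord, the crossings along a flow line are isolated as long as the flow line
avoids the tangencies with an arc of marked cords. -/
theorem exists_isTarget_isolating (hA : Admissible L γ F₀ N G) {q : Plane × ℝ}
    (hq : q ∈ markedCords γ) : ∃ C A Nice, IsTarget γ F₀ G C A Nice ∧ ∃ V ∈ 𝓝 q,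
      ∀ g : Perturbation L N, ∀ x, IsFlowLine (F₀ + g.1) x → ∀ t r, (x t, r) ∈ V →
        (x t, r) ∈ markedCords γ → (g, x t) ∉ C →
          ∀ᶠ z : ℝ × ℝ in 𝓝 (t, r), (x z.1, z.2) ∈ markedCords γ → z = (t, r) := by
  have hL := hA.knot.pos
  obtain ⟨σ, ρ, hσ, hσ', hσ0, hρ0, hemb, V, hV, hrange⟩ := hA.knot.arc q hq
  have hmem : ∀ u, (σ u, ρ u) ∈ markedCords γ ∩ V := fun u => hrange ▸ mem_range_self u
  have hσS : ∀ u, σ u ∈ cordsMeetingKnot γ := fun u =>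
    mem_cordsMeetingKnot_of_mem_markedCords (hmem u).1
  have hN : q.1 ∈ (closure N)ᶜ := fun h =>
    disjoint_left.1 hA.disjoint h (subset_closure (mem_cordsMeetingKnot_of_mem_markedCords hq))
  obtain ⟨r₀, hr₀, hr₀N⟩ := Metric.isOpen_iff.1 isClosed_closure.isOpen_compl _ hN
  obtain ⟨r, hr, hrlt⟩ := exists_between (lt_min hr₀ (by linarith : 0 < L / 4))
  obtain ⟨e, he⟩ : ∃ e, cross e (deriv σ 0) ≠ 0 := ⟨_, cross_rotate_ne_zero (hσ' 0)⟩
  have hev : ∀ᶠ u in 𝓝 (0 : ℝ), σ u ∈ Metric.ball q.1 (r / 2) ∧ cross e (deriv σ u) ≠ 0 := by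
    refine (hσ.continuous.continuousAt.eventually_mem ?_).and ?_
    · rw [hσ0]
      exact Metric.ball_mem_nhds _ (by positivity)
    · have h1 : Continuous fun u => cross e (deriv σ u) :=
        continuous_cross.comp (continuous_const.prodMk (hσ.continuous_deriv (by simp)))
      exact h1.continuousAt.eventually_ne he
  obtain ⟨w₀, hw₀, hball⟩ := Metric.eventually_nhds_iff.1 hev
  obtain ⟨w, hw, hww⟩ := exists_between hw₀
  have hIcc : ∀ u ∈ Icc (-w) w, σ u ∈ Metric.ball q.1 (r / 2) ∧ cross e (deriv σ u) ≠ 0 := by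
    intro u hu
    refine hball ?_
    rw [Real.dist_eq, sub_zero]
    exact (abs_le.2 hu).trans_lt hww
  refine ⟨_, _, _, isTarget_tangencies hA hσ hr (hrlt.trans_le (min_le_right _ _))
    (fun p hp hpN => hr₀N (Metric.closedBall_subset_ball (hrlt.trans_le (min_le_left _ _)) hp)
      (subset_closure hpN)) (fun u hu => (hIcc u hu).1) (fun u hu => (hIcc u hu).2) hσS, ?_⟩
  obtain ⟨V₁, hV₁, hpre⟩ := hemb.isInducing.isOpen_iff.1 (isOpen_Ioo (a := -w) (b := w))
  have hV' : ∀ z ∈ V ∩ V₁, z ∈ markedCords γ → ∃ u ∈ Ioo (-w) w, (σ u, ρ u) = z := by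
    intro z hz hzm
    obtain ⟨u, rfl⟩ : z ∈ range fun u => (σ u, ρ u) := hrange ▸ ⟨hzm, hz.1⟩
    exact ⟨u, hpre ▸ hz.2, rfl⟩
  have hq0 : (σ 0, ρ 0) = q := Prod.ext hσ0 hρ0
  refine ⟨V ∩ V₁, (hV.inter hV₁).mem_nhds ⟨hq0 ▸ (hmem 0).2, ?_⟩, ?_⟩
  · rw [← hq0]
    have : (0 : ℝ) ∈ Ioo (-w) w := ⟨by linarith, hw⟩
    rw [← hpre] at this
    exact this
  intro g x hx t r hzV hzm hC
  obtain ⟨u, hu, hue⟩ := hV' _ hzV hzm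
  have hσu : x t = σ u := (congrArg Prod.fst hue).symm
  have hρu : ρ u = r := congrArg Prod.snd hue
  have hcr : cross (-gradient (F₀ + g.1) (x t)) (deriv σ u) ≠ 0 := fun h => by
    refine hC ⟨u, Ioo_subset_Icc_self hu, by simp [hσu], ?_⟩
    rw [← hσu]
    simp only [cross, PiLp.neg_apply] at h ⊢
    linarith
  have hiso := eventually_eq_of_cross_ne_zero (hx t)
    ((hσ.differentiable (by simp) u).hasDerivAt) hcr
  rw [nhds_prod_eq] at hiso
  obtain ⟨pA, hpA, pB, hpB, hAB⟩ := eventually_prod_iff.1 hiso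
  rw [hemb.isInducing.nhds_eq_comap, eventually_comap] at hpB
  simp only [hue] at hpB
  have hcont : Continuous fun z : ℝ × ℝ => (x z.1, z.2) :=
    (hx.continuous.comp continuous_fst).prodMk continuous_snd
  have hlim := hcont.tendsto (t, r)
  filter_upwards [continuous_fst.continuousAt.eventually hpA, hlim.eventually hpB,
    hlim.eventually ((hV.inter hV₁).mem_nhds hzV)] with z h1 h2 h3 hz
  obtain ⟨u', hu', hue'⟩ := hV' _ h3 hz
  have h4 := hAB h1 (h2 u' hue') (congrArg Prod.fst hue').symm
  have h7 : z.1 = t := congrArg Prod.fst h4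
  refine Prod.ext h7 ?_
  show z.2 = r
  have h5 : u' = u := congrArg Prod.snd h4
  have h6 : ρ u' = z.2 := congrArg Prod.snd hue'
  rw [← h6, h5, hρu]

/-- Finitely many sets to be avoided control all crossings at distance at least `d` from the ends
of the cord. -/
theorem exists_finite_isolating (hA : Admissible L γ F₀ N G) {d : ℝ} (hd : 0 < d) :
    ∃ 𝒞 : Set (Set (Perturbation L N × Plane)), 𝒞.Finite ∧
      (∀ C ∈ 𝒞, ∃ A Nice, IsTarget γ F₀ G C A Nice) ∧
      ∀ g : Perturbation L N, ∀ x, IsFlowLine (F₀ + g.1) x → ∀ t r, (x t, r) ∈ markedFar γ d →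
        (∀ C ∈ 𝒞, (g, x t) ∉ C) →
          ∀ᶠ z : ℝ × ℝ in 𝓝 (t, r), (x z.1, z.2) ∈ markedCords γ → z = (t, r) := by
  have hL := hA.knot.pos
  have hK := hA.knot.toIsKnot
  have hcomp : IsCompact ((square L ×ˢ Icc 0 L) ∩ markedFar γ d) :=
    ((isCompact_square L).prod isCompact_Icc).inter_right (isClosed_markedFar hK.continuous d)
  have hloc := fun q : Plane × ℝ => fun hq : q ∈ (square L ×ˢ Icc 0 L) ∩ markedFar γ d =>
    exists_isTarget_isolating hA (markedFar_subset hd hq.2)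
  choose! C A Nice hT V hV hiso using hloc
  obtain ⟨s, hcov⟩ := hcomp.elim_nhds_subcover' (fun q _ => V q) fun q hq => hV q hq
  have hfin : {D | ∃ q ∈ s, C q.1 = D}.Finite :=
    s.finite_toSet.image fun q => C (Subtype.val q)
  refine ⟨_, hfin, ?_, ?_⟩
  · rintro _ ⟨⟨q, hq⟩, -, rfl⟩
    exact ⟨_, _, hT q hq⟩
  intro g x hx t r hfar hav
  obtain ⟨v, hv, hxv⟩ := exists_lattice_add_mem_fundamentalDomain hL (x t)
  obtain ⟨k, hk⟩ := exists_shift_mem_Ico hL r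
  have hmem : (x t + v, r + k * L) ∈ (square L ×ˢ Icc 0 L) ∩ markedFar γ d :=
    ⟨⟨fundamentalDomain_subset_square L hxv, Ico_subset_Icc_self hk⟩,
      (hK.markedFar_shift hv k).2 hfar⟩
  have hU := hcov hmem
  obtain ⟨⟨q, hq⟩, hqs, hqV⟩ := mem_iUnion₂.1 hU
  have hF := g.isTorusFun_add hA.torus
  have hCv : (g, x t + v) ∉ C q := fun h => by
    refine hav (C q) ⟨⟨q, hq⟩, hqs, rfl⟩ ?_
    have := (hT q hq).add_lattice g _ _ (neg_mem hv) h
    simpa using this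
  have h1 := hiso q hq g (fun s => x s + v) (hx.add_lattice hF hv) t (r + k * L) hqV
    (markedFar_subset hd hmem.2) hCv
  have hlim : Tendsto (fun z : ℝ × ℝ => (z.1, z.2 + k * L)) (𝓝 (t, r)) (𝓝 (t, r + k * L)) := by
    have : Continuous fun z : ℝ × ℝ => (z.1, z.2 + k * L) := by fun_prop
    exact this.tendsto (t, r)
  filter_upwards [hlim.eventually h1] with z hz hzm
  have := hz ((hK.markedCords_shift hv k).2 hzm)
  simp only [Prod.mk.injEq, add_left_inj] at this
  exact Prod.ext this.1 this.2

end Isolating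

section Finite

variable {L : ℝ} {N : Set Plane} {γ : ℝ → Space} {F : Plane → ℝ}

theorem finite_step (hL : 0 < L) (hγ : Continuous γ) (hF : IsTorusFun L F) {T d : ℝ} (hd : 0 < d)
    {c : Plane} (hiso : ∀ t ∈ Icc 0 T, ∀ r, (flow F t c, r) ∈ markedFar γ d →
      ∀ᶠ z : ℝ × ℝ in 𝓝 (t, r), (flow F z.1 c, z.2) ∈ markedCords γ → z = (t, r)) :
    {q | Step L γ F T d c q}.Finite := by
  have hfin : {z : ℝ × ℝ | z ∈ Icc 0 T ×ˢ Icc 0 L ∧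
      (flow F z.1 c, z.2) ∈ markedFar γ d}.Finite := by
    by_contra hinf
    obtain ⟨z, hz, hacc⟩ := Set.Infinite.exists_accPt_of_subset_isCompact
      (show Set.Infinite _ from hinf) (isCompact_Icc.prod isCompact_Icc) fun z hz => hz.1
    have hcont : Continuous fun z : ℝ × ℝ => (flow F z.1 c, z.2) :=
      ((hF.isFlowLine_flow hL c).continuous.comp continuous_fst).prodMk continuous_snd
    have hcl := ((isClosed_markedFar hγ d).preimage hcont).closure_subset_iff.2
      (fun z hz => hz.2 : {z : ℝ × ℝ | z ∈ Icc 0 T ×ˢ Icc 0 L ∧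
        (flow F z.1 c, z.2) ∈ markedFar γ d} ⊆ _)
      (mem_closure_iff_clusterPt.2 hacc.clusterPt)
    rw [accPt_iff_frequently_nhdsNE] at hacc
    obtain ⟨y, hy1, hy3⟩ := (hacc.and_eventually
      ((eventually_nhdsWithin_of_eventually_nhds (hiso z.1 hz.1 z.2 hcl)).and
        self_mem_nhdsWithin)).exists
    exact hy3.2 (hy3.1 (markedFar_subset hd hy1.2))
  refine ((hfin.prod (finite_univ (α := Bool))).image
    fun y => piece (flow F y.1.1 c) y.1.2 y.2).subset ?_
  rintro _ ⟨t, ht, r, hr, β, h, rfl⟩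
  exact ⟨((t, r), β), ⟨⟨⟨ht, hr⟩, h⟩, mem_univ _⟩, rfl⟩

theorem finite_reach (hL : 0 < L) (hγ : Continuous γ) (hF : IsTorusFun L F) {T d : ℝ} (hd : 0 < d)
    {b : Plane} {m : ℕ} (hiso : ∀ i < m, ∀ c ∈ reach L γ F T d b i, ∀ t ∈ Icc 0 T, ∀ r,
      (flow F t c, r) ∈ markedFar γ d →
        ∀ᶠ z : ℝ × ℝ in 𝓝 (t, r), (flow F z.1 c, z.2) ∈ markedCords γ → z = (t, r)) :
    (reach L γ F T d b m).Finite := by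
  induction m with
  | zero => exact finite_singleton b
  | succ m ih =>
    have h1 := ih fun i hi => hiso i (by omega)
    refine (h1.biUnion fun c hc => finite_step hL hγ hF hd (hiso m (by omega) c hc)).subset ?_
    rintro q ⟨c, hc, h⟩
    exact mem_biUnion hc h

end Finite

/-! ### Steering the flow lines away from the cords to be avoided -/

theorem subset_closure_iInter {X ι : Type*} [TopologicalSpace X] {G : Set X} {s : Set ι}
    (hs : s.Finite) {O : ι → Set X} (hO : ∀ i ∈ s, IsOpen (O i)) (hG : IsOpen G)
    (hd : ∀ i ∈ s, G ⊆ closure (O i)) : G ⊆ closure (⋂ i ∈ s, O i) := by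
  induction s, hs using Set.Finite.induction_on with
  | empty => simp
  | @insert a s has hs ih =>
    have h1 := ih (fun i hi => hO i (mem_insert_of_mem a hi)) fun i hi =>
      hd i (mem_insert_of_mem a hi)
    have h2 : G ∩ O a ⊆ closure (⋂ i ∈ insert a s, O i) := by
      rw [biInter_insert]
      exact fun x hx => (hO a (mem_insert a s)).inter_closure ⟨hx.2, h1 hx.1⟩
    refine fun x hx => closure_minimal h2 isClosed_closure ?_
    exact hG.inter_closure ⟨hx, hd a (mem_insert a s) hx⟩

theorem isClosed_saturation {L : ℝ} (hL : 0 < L) {B : Set Plane} (hB : IsCompact B) :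
    IsClosed {p : Plane | ∃ q ∈ B, q - p ∈ lattice L} :=
  isClosed_exists_mem (D := {z : Plane × Plane | z.2 - z.1 ∈ lattice L}) hB
    ((isClosed_lattice hL).preimage (continuous_snd.sub continuous_fst))

theorem isInvariant_saturation {L : ℝ} (B : Set Plane) :
    IsInvariant L {p : Plane | ∃ q ∈ B, q - p ∈ lattice L} := by
  rintro p ⟨q, hq, h⟩ v hv
  refine ⟨q, hq, ?_⟩
  have e : q - (p + v) = (q - p) - v := by abel
  rw [e]
  exact sub_mem h hv

/-- A function supported in the translates of a ball is stationary away from the translates of a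
larger ball. -/
theorem gradient_eq_zero_of_support {L : ℝ} {h : Plane → ℝ} {c : Plane} {ρ : ℝ} (hρ : 0 < ρ)
    (hsupp : ∀ p, h p ≠ 0 → ∃ v ∈ lattice L, p + v ∈ Metric.ball c (ρ / 2)) {D : Set Plane}
    (hD : IsInvariant L D) (hdisj : Disjoint (Metric.ball c ρ) D) {p : Plane} (hp : p ∈ D) :
    gradient h p = 0 := by
  have he : h =ᶠ[𝓝 p] fun _ => (0 : ℝ) := by
    filter_upwards [Metric.ball_mem_nhds p (show 0 < ρ / 2 by positivity)] with q hq
    by_contra hne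
    obtain ⟨v, hv, hqv⟩ := hsupp q hne
    refine disjoint_left.1 hdisj (?_ : p + v ∈ _) (hD p hp v hv)
    rw [Metric.mem_ball] at hq hqv ⊢
    have h1 := dist_triangle (p + v) (q + v) c
    rw [dist_add_right, dist_comm p q] at h1
    linarith
  rw [he.gradient_eq]
  simp [gradient]

section Density

variable {L : ℝ} {N : Set Plane} {γ : ℝ → Space} {F₀ : Plane → ℝ} {G : Set (Perturbation L N)}

theorem Perturbation.gradient_move (g H : Perturbation L N) (a : ℝ) (p : Plane) :
    gradient (g.move H a).1 p = gradient g.1 p + a • gradient H.1 p := by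
  simp only [Perturbation.move]
  rw [gradient_add (g.2.1.differentiable (by simp) _)
    ((H.isTorusFun.const_smul a).smooth.differentiable (by simp) _),
    gradient_const_smul a (H.2.1.differentiable (by simp) _)]

/-- The cords in `C` that are met, up to time `T`, by the cords reached from `b` after `m`
splittings. -/
def hits (γ : ℝ → Space) (F₀ : Plane → ℝ) (T d : ℝ) (C : Set (Perturbation L N × Plane))
    (b : Plane) (m : ℕ) (g : Perturbation L N) : Set Plane :=
  {z | (g, z) ∈ C ∧ ∃ c ∈ reach L γ (F₀ + g.1) T d b m, ∃ t ∈ Icc 0 T, flow (F₀ + g.1) t c = z}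

theorem notMem_bad_of_hits_eq_empty {T d : ℝ} {C : Set (Perturbation L N × Plane)} {b : Plane}
    {m : ℕ} {g : Perturbation L N} (h : hits γ F₀ T d C b m g = ∅) :
    (g, b) ∉ bad γ F₀ T d C m := by
  intro hbad
  obtain ⟨c, hc, t, ht, hC⟩ := mem_bad_iff.1 hbad
  have hmem : flow (F₀ + g.1) t c ∈ hits γ F₀ T d C b m g := ⟨hC, c, hc, t, ht, rfl⟩
  rw [h] at hmem
  exact hmem

/-- One of the cords that are met can be removed by a small perturbation, provided that it is not
met before the last splitting. -/
theorem IsTarget.exists_remove_hit (hA : Admissible L γ F₀ N G)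
    {C : Set (Perturbation L N × Plane)} {A : Set Plane} {Nice : Perturbation L N → Prop}
    (hC : IsTarget γ F₀ G C A Nice) {T d : ℝ} {b : Plane} {m : ℕ} {g : Perturbation L N}
    (hg : g ∈ G) (hn : Nice g) (hfin : ∀ i ≤ m, (reach L γ (F₀ + g.1) T d b i).Finite)
    (havoid : ∀ i < m, ∀ c ∈ reach L γ (F₀ + g.1) T d b i, ∀ t ∈ Icc 0 T,
      (g, flow (F₀ + g.1) t c) ∉ C)
    (hreach : ∀ c ∈ reach L γ (F₀ + g.1) T d b m, (g, c) ∉ C) {z : Plane} (hz : (g, z) ∈ C)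
    {U : Set (Perturbation L N)} (hU : U ∈ 𝓝 g) :
    ∃ g' ∈ U, Nice g' ∧ hits γ F₀ T d C b m g' ⊆ hits γ F₀ T d C b m g \ {z} := by
  have hL := hA.knot.pos
  have hF := g.isTorusFun_add hA.torus
  obtain ⟨x, hxdef⟩ : ∃ x : ℝ → Plane, ∀ t, x t = flow (F₀ + g.1) t z := ⟨_, fun _ => rfl⟩
  have hx : IsFlowLine (F₀ + g.1) x := by
    rw [show x = fun t => flow (F₀ + g.1) t z from funext hxdef]
    exact hF.isFlowLine_flow hL z
  have hx0 : x 0 = z := by rw [hxdef, hF.flow_zero hL]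
  -- the cords that must not be moved
  obtain ⟨B, hBdef⟩ : ∃ B : Set Plane, B = reach L γ (F₀ + g.1) T d b m ∪ ⋃ i ∈ Iio m,
    ⋃ c ∈ reach L γ (F₀ + g.1) T d b i, (fun t => flow (F₀ + g.1) t c) '' Icc 0 T := ⟨_, rfl⟩
  have hBc : IsCompact B := by
    rw [hBdef]
    exact (hfin m le_rfl).isCompact.union ((finite_Iio m).isCompact_biUnion fun i hi =>
      (hfin i (le_of_lt hi)).isCompact_biUnion fun c _ =>
        isCompact_Icc.image (hF.isFlowLine_flow hL c).continuous)
  have hBC : ∀ p ∈ B, (g, p) ∉ C := by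
    intro p hp
    rw [hBdef] at hp
    rcases hp with hp | hp
    · exact hreach p hp
    · simp only [mem_iUnion] at hp
      obtain ⟨i, hi, c, hc, t, ht, rfl⟩ := hp
      exact havoid i hi c hc t ht
  obtain ⟨D, hDdef⟩ : ∃ D : Set Plane, D = {p | ∃ q ∈ B, q - p ∈ lattice L} := ⟨_, rfl⟩
  have hDc : IsClosed D := hDdef ▸ isClosed_saturation hL hBc
  have hDi : IsInvariant L D := hDdef ▸ isInvariant_saturation B
  have hBD : B ⊆ D := fun p hp => hDdef ▸ ⟨p, hp, by simp⟩
  have hzD : z ∉ D := by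
    rw [hDdef]
    rintro ⟨q, hq, h⟩
    have := hC.add_lattice g z _ h hz
    rw [add_sub_cancel] at this
    exact hBC q hq this
  have hzS := hC.subset g z hz
  have hzN : z ∉ closure N := fun h => disjoint_left.1 hA.disjoint h hzS
  have hz0 : gradient (F₀ + g.1) z ≠ 0 := hA.regular g hg z hzS
  -- the flow line through `z` leaves the support of the target in the recent past
  have hev : ∀ᶠ s in 𝓝 (0 : ℝ), x s ∈ (closure N)ᶜ ∩ Dᶜ ∧ gradient (F₀ + g.1) (x s) ≠ 0 := by
    refine (hx.continuous.continuousAt.eventually_mem ?_).and ?_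
    · rw [hx0]
      exact (isClosed_closure.isOpen_compl.inter hDc.isOpen_compl).mem_nhds ⟨hzN, hzD⟩
    · have h1 : Continuous fun s => gradient (F₀ + g.1) (x s) :=
        (contDiff_gradient hF.smooth).continuous.comp hx.continuous
      refine h1.continuousAt.eventually_ne ?_
      rw [hx0]
      exact hz0
  obtain ⟨τ₁, hτ₁, hball⟩ := Metric.eventually_nhds_iff.1 hev
  obtain ⟨τ₀, hτ₀, hτ⟩ : ∃ τ₀ > 0, 2 * τ₀ < τ₁ := ⟨τ₁ / 3, by positivity, by linarith⟩
  have hpast : ∀ s, |s| ≤ 2 * τ₀ →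
      x s ∈ (closure N)ᶜ ∩ Dᶜ ∧ gradient (F₀ + g.1) (x s) ≠ 0 := fun s hs => by
    refine hball ?_
    rw [Real.dist_eq, sub_zero]
    linarith
  obtain ⟨s₁, hs₁, hsA⟩ := hC.escape g hg hn x hx (hx0 ▸ hz0) (-τ₀) 0 (by linarith)
  obtain ⟨⟨hsN, hsD⟩, hs0⟩ := hpast s₁ (abs_le.2 ⟨by linarith [hs₁.1], by linarith [hs₁.2]⟩)
  obtain ⟨ρ, hρ, hρball⟩ := Metric.isOpen_iff.1 ((isClosed_closure.isOpen_compl.inter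
    hDc.isOpen_compl).inter hC.isClosed_support.isOpen_compl) (x s₁) ⟨⟨hsN, hsD⟩, hsA⟩
  obtain ⟨h, hh, hsupp, hsteer⟩ := exists_steering hL hF (hx.shift s₁)
    (O := Metric.ball (x s₁) (ρ / 2)) (by simpa using hs0)
    (by simpa using Metric.ball_mem_nhds (x s₁) (half_pos hρ))
    (show 0 < -s₁ by linarith [hs₁.2])
  have hhN : ∀ p ∈ N, h p = 0 := fun p hp => by
    by_contra hne
    obtain ⟨v, hv, hpv⟩ := hsupp p hne
    exact (hρball (Metric.ball_subset_ball (by linarith) hpv)).1.1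
      (subset_closure (hA.invariant p hp v hv))
  obtain ⟨H, hH⟩ : ∃ H : Perturbation L N, H.1 = h := ⟨⟨h, hh.smooth, hh.periodic, hhN⟩, rfl⟩
  have hgradD : ∀ p ∈ D, gradient h p = 0 := fun p hp =>
    gradient_eq_zero_of_support hρ hsupp hDi
      (disjoint_left.2 fun q hq hqD => (hρball hq).1.2 hqD) hp
  have hgradA : ∀ p ∈ A, gradient h p = 0 := fun p hp =>
    gradient_eq_zero_of_support hρ hsupp hC.invariant_support
      (disjoint_left.2 fun q hq hqA => (hρball hq).2 hqA) hp
  -- candidates for cords that are met after the perturbation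
  obtain ⟨V, hV⟩ := hA.speed
  obtain ⟨R, hR⟩ : ∃ R, ∀ c ∈ reach L γ (F₀ + g.1) T d b m, ‖c‖ ≤ R :=
    (hfin m le_rfl).isBounded.exists_norm_le
  have hpairs := (hfin m le_rfl).prod (hC.finite g hg hn (R + V * T))
  have hno : ∀ᶠ g' in 𝓝 g, ∀ q ∈ reach L γ (F₀ + g.1) T d b m ×ˢ
      {p | (g, p) ∈ C ∧ ‖p‖ ≤ R + V * T}, (∀ t ∈ Icc 0 T, flow (F₀ + g.1) t q.1 ≠ q.2) →
        ∀ t ∈ Icc 0 T, flow (F₀ + g'.1) t q.1 ≠ q.2 := by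
    refine (eventually_all_finite hpairs).2 fun q _ => ?_
    by_cases hq : ∀ t ∈ Icc 0 T, flow (F₀ + g.1) t q.1 ≠ q.2
    · have hcl : IsClosed {g' : Perturbation L N | (g', q.1) ∈
          flowInto F₀ T {y : Perturbation L N × Plane | y.2 = q.2}} :=
        (isClosed_flowInto hL hA.torus (isClosed_eq continuous_snd continuous_const)).preimage
          (by fun_prop)
      filter_upwards [hcl.isOpen_compl.mem_nhds (fun ⟨t, ht, h⟩ => hq t ht h)] with g' hg' _ t ht h
      exact hg' ⟨t, ht, h⟩
    · exact Eventually.of_forall fun g' h => absurd h hq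
  have hlim := Perturbation.tendsto_move_right hL g H
  obtain ⟨a, ⟨ha1, ha2⟩, ha3, ha4⟩ := ((hsteer.and (hlim.eventually_mem hU)).and
    ((hlim.eventually hno).and (hlim.eventually_mem (hA.isOpen.mem_nhds hg)))).exists
  have hgr : ∀ p, gradient h p = 0 → gradient (g.move H a).1 p = gradient g.1 p := fun p hp => by
    rw [Perturbation.gradient_move, hH, hp, smul_zero, add_zero]
  obtain ⟨g', hg'def⟩ : ∃ g', g' = g.move H a := ⟨_, rfl⟩
  have hF' : F₀ + g'.1 = F₀ + g.1 + a • h := by rw [hg'def, ← hH, add_assoc]; rfl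
  rw [← hg'def] at ha2 ha3 ha4 hgr
  rw [← hF'] at ha1
  have hT' := g'.isTorusFun_add hA.torus
  obtain ⟨hcongr, hnice⟩ := hC.congr g g' fun p hp => hgr p (hgradA p hp)
  refine ⟨g', ha2, hnice hn, ?_⟩
  have hre : reach L γ (F₀ + g'.1) T d b m = reach L γ (F₀ + g.1) T d b m := by
    refine reach_congr hL hF hT' fun i hi c hc t ht => ?_
    rw [Perturbation.gradient_add_eq hA.torus, Perturbation.gradient_add_eq hA.torus,
      hgr _ (hgradD _ (hBD ?_))]
    rw [hBdef]
    exact Or.inr (mem_iUnion₂.2 ⟨i, hi, mem_iUnion₂.2 ⟨c, hc, t, ht, rfl⟩⟩)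
  rintro y ⟨hyC, c, hc, t, ht, hty⟩
  rw [hre] at hc
  have hyC' := (hcongr y).1 hyC
  have hyR : ‖y‖ ≤ R + V * T := by
    have h1 := (hT'.isFlowLine_flow hL c).dist_le (hV g' ha4) 0 t
    rw [hT'.flow_zero hL, hty, sub_zero, abs_of_nonneg ht.1] at h1
    have h2 := norm_le_norm_add_norm_sub' y c
    have hV0 : 0 ≤ V := (norm_nonneg _).trans (hV g' ha4 0)
    have h3 : V * t ≤ V * T := by
      gcongr
      exact ht.2
    linarith [hR c hc]
  obtain ⟨t', ht', hty'⟩ : ∃ t' ∈ Icc 0 T, flow (F₀ + g.1) t' c = y := by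
    by_contra! hnot
    exact ha3 (c, y) ⟨hc, hyC', hyR⟩ hnot t ht hty
  refine ⟨⟨hyC', c, hc, t', ht', hty'⟩, ?_⟩
  rintro rfl
  -- `c` lies on the flow line through `y`, at a time before `-2 * τ₀`
  have hcx : c = x (-t') := by
    rw [hxdef, ← hty', hF.flow_flow hL, neg_add_cancel, hF.flow_zero hL]
  have hlt : 2 * τ₀ < t' := by
    by_contra! hle
    refine (hpast (-t') (by rwa [abs_neg, abs_of_nonneg ht'.1])).1.2 ?_
    rw [← hcx]
    exact hBD (hBdef ▸ Or.inl hc)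
  refine ha1 (-t' - s₁) (by linarith [hs₁.1]) (-s₁) le_rfl t ?_
  rw [sub_add_cancel, neg_add_cancel, ← hcx, hx0, hty]

/-- Among the perturbations in `G`, those for which the cords reached from `b` after `m` splittings
avoid a target are dense. -/
theorem IsTarget.subset_closure_notMem_bad (hA : Admissible L γ F₀ N G) {T d : ℝ} (hd : 0 < d)
    {b : Plane} (hb : b ∈ N) (m : ℕ) {C : Set (Perturbation L N × Plane)} {A : Set Plane}
    {Nice : Perturbation L N → Prop} (hC : IsTarget γ F₀ G C A Nice) :
    G ⊆ closure {g | (g, b) ∉ bad γ F₀ T d C m} := by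
  induction m using Nat.strong_induction_on generalizing C A Nice with
  | _ m ih =>
  have hL := hA.knot.pos
  have hγ := hA.knot.toIsKnot.continuous
  obtain ⟨𝒞, h𝒞, h𝒞T, hiso⟩ := exists_finite_isolating hA hd
  -- before the last splitting, the tangencies and the target are avoided
  obtain ⟨𝒟, h𝒟⟩ : ∃ 𝒟, 𝒟 = insert C (insert (CordSplitting.splitInto γ d C) 𝒞) := ⟨_, rfl⟩
  have h𝒟fin : 𝒟.Finite := h𝒟 ▸ (h𝒞.insert _).insert _
  have h𝒟T : ∀ D ∈ 𝒟, ∃ A Nice, IsTarget γ F₀ G D A Nice := by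
    rw [h𝒟]
    rintro D (rfl | rfl | hD)
    · exact ⟨_, _, hC⟩
    · exact ⟨_, _, hC.splitInto hA hd⟩
    · exact h𝒞T D hD
  obtain ⟨O, hO⟩ : ∃ O : Set (Perturbation L N), O = ⋂ i ∈ Iio m ×ˢ 𝒟,
    {g | (g, b) ∉ bad γ F₀ T d i.2 i.1} := ⟨_, rfl⟩
  have hpiece : ∀ i ∈ Iio m ×ˢ 𝒟,
      IsOpen {g : Perturbation L N | (g, b) ∉ bad γ F₀ T d i.2 i.1} := by
    rintro i hi
    obtain ⟨A, Nice, hT⟩ := h𝒟T i.2 hi.2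
    exact ((isClosed_bad hL hA.torus hγ hT.isClosed i.1).preimage (by fun_prop)).isOpen_compl
  have hOopen : IsOpen O := hO ▸ ((finite_Iio m).prod h𝒟fin).isOpen_biInter hpiece
  have hOdense : G ⊆ closure O := by
    rw [hO]
    refine subset_closure_iInter ((finite_Iio m).prod h𝒟fin) hpiece hA.isOpen fun i hi => ?_
    obtain ⟨A, Nice, hT⟩ := h𝒟T i.2 hi.2
    exact ih i.1 hi.1 hT
  have hOmem : ∀ g ∈ O, ∀ i < m, ∀ D ∈ 𝒟, ∀ c ∈ reach L γ (F₀ + g.1) T d b i, ∀ t ∈ Icc 0 T,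
      (g, flow (F₀ + g.1) t c) ∉ D := by
    intro g hg i hi D hD c hc t ht hmem
    rw [hO] at hg
    exact mem_iInter₂.1 hg (i, D) ⟨hi, hD⟩ (mem_bad_iff.2 ⟨c, hc, t, ht, hmem⟩)
  have hfin : ∀ g ∈ O, ∀ i ≤ m, (reach L γ (F₀ + g.1) T d b i).Finite := by
    intro g hg i hi
    have hF := g.isTorusFun_add hA.torus
    refine finite_reach hL hγ hF hd fun j hj c hc t ht r hr => ?_
    refine hiso g _ (hF.isFlowLine_flow hL c) t r hr fun D hD => ?_
    exact hOmem g hg j (by omega) D (h𝒟 ▸ Or.inr (Or.inr hD)) c hc t ht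
  have hreach : ∀ g ∈ O, ∀ c ∈ reach L γ (F₀ + g.1) T d b m, (g, c) ∉ C := by
    intro g hg c hc hcC
    cases m with
    | zero =>
      obtain rfl : c = b := hc
      exact disjoint_left.1 hA.disjoint (subset_closure hb) (hC.subset g c hcC)
    | succ m =>
      obtain ⟨c', hc', t, ht, r, hr, β, hfar, rfl⟩ := hc
      exact hOmem g hg m (by omega) (CordSplitting.splitInto γ d C)
        (h𝒟 ▸ Or.inr (Or.inl rfl)) c' hc' t ht
        ⟨r, hr, β, hfar, hcC⟩
  -- the cords that are met at the end are removed one by one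
  have hremove : ∀ k : ℕ, ∀ g ∈ G ∩ O, Nice g → (hits γ F₀ T d C b m g).ncard ≤ k → ∀ U ∈ 𝓝 g,
      ∃ g' ∈ U, (g', b) ∉ bad γ F₀ T d C m := by
    intro k
    have hhfin : ∀ g ∈ G ∩ O, Nice g → (hits γ F₀ T d C b m g).Finite := by
      intro g hg hn
      obtain ⟨V, hV⟩ := hA.speed
      obtain ⟨R, hR⟩ : ∃ R, ∀ c ∈ reach L γ (F₀ + g.1) T d b m, ‖c‖ ≤ R :=
        (hfin g hg.2 m le_rfl).isBounded.exists_norm_le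
      refine (hC.finite g hg.1 hn (R + V * T)).subset ?_
      rintro z ⟨hz, c, hc, t, ht, rfl⟩
      refine ⟨hz, ?_⟩
      have hF := g.isTorusFun_add hA.torus
      have h1 := (hF.isFlowLine_flow hL c).dist_le (hV g hg.1) 0 t
      rw [hF.flow_zero hL, sub_zero, abs_of_nonneg ht.1] at h1
      have h2 := norm_le_norm_add_norm_sub' (flow (F₀ + g.1) t c) c
      have hV0 : 0 ≤ V := (norm_nonneg _).trans (hV g hg.1 0)
      have h3 : V * t ≤ V * T := by
        gcongr
        exact ht.2
      linarith [hR c hc]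
    induction k with
    | zero =>
      intro g hg hn hcard U hU
      have h0 := (ncard_eq_zero (hhfin g hg hn)).1 (Nat.le_zero.1 hcard)
      exact ⟨g, mem_of_mem_nhds hU, notMem_bad_of_hits_eq_empty h0⟩
    | succ k ihk =>
      intro g hg hn hcard U hU
      rcases (hits γ F₀ T d C b m g).eq_empty_or_nonempty with h0 | ⟨z, hz⟩
      · exact ⟨g, mem_of_mem_nhds hU, notMem_bad_of_hits_eq_empty h0⟩
      obtain ⟨g', hg'U, hn', hsub⟩ := hC.exists_remove_hit hA hg.1 hn (hfin g hg.2)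
        (fun i hi => hOmem g hg.2 i hi C (h𝒟 ▸ Or.inl rfl)) (hreach g hg.2) hz.1
        (inter_mem (interior_mem_nhds.2 hU) ((hA.isOpen.inter hOopen).mem_nhds hg))
      refine ihk g' hg'U.2 hn' ?_ U (mem_interior_iff_mem_nhds.1 hg'U.1)
      have h1 := ncard_le_ncard hsub ((hhfin g hg hn).sdiff)
      have h2 := ncard_sdiff_singleton_lt_of_mem hz (hhfin g hg hn)
      omega
  intro g₀ hg₀
  rw [mem_closure_iff_nhds]
  intro U hU
  obtain ⟨g₁, ⟨hg₁U, hg₁G⟩, hg₁O⟩ := mem_closure_iff_nhds.1 (hOdense hg₀) _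
    (inter_mem (interior_mem_nhds.2 hU) (hA.isOpen.mem_nhds hg₀))
  obtain ⟨g₂, ⟨hg₂U, hg₂⟩, hn₂⟩ := hC.dense g₁ hg₁G (interior U ∩ (G ∩ O))
    ((isOpen_interior.inter (hA.isOpen.inter hOopen)).mem_nhds ⟨hg₁U, hg₁G, hg₁O⟩)
  exact hremove _ g₂ hg₂ hn₂ le_rfl U (mem_interior_iff_mem_nhds.1 hg₂U)

end Density

/-! ### Residual perturbations -/

theorem eventually_residual_of_subset_closure {X : Type*} [TopologicalSpace X] {G O : Set X}
    (hO : IsOpen O) (h : G ⊆ closure O) : ∀ᶠ g in residual X, g ∈ G → g ∈ O := by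
  have hopen : IsOpen (O ∪ (closure G)ᶜ) := hO.union isClosed_closure.isOpen_compl
  have hdense : Dense (O ∪ (closure G)ᶜ) := by
    intro x
    rw [closure_union]
    by_cases hx : x ∈ closure G
    · exact Or.inl (closure_minimal h isClosed_closure hx)
    · exact Or.inr (subset_closure hx)
  filter_upwards [residual_of_dense_open hopen hdense] with g hg hgG
  exact hg.resolve_right fun h => h (subset_closure hgG)

theorem IsKnot.markedBoundary_shift {L : ℝ} {γ : ℝ → Space} (hK : IsKnot L γ) {p : Plane} {r : ℝ}
    {v : Plane} (hv : v ∈ lattice L) (h : (p, r) ∈ markedBoundary γ) :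
    (p + v, r) ∈ markedBoundary γ := by
  have key : ∀ q : Plane × ℝ, ∀ w ∈ lattice L, q ∈ markedCords γ → (q.1 + w, q.2) ∈ markedCords γ :=
    fun q w hw hq => by simpa using (hK.markedCords_shift (r := q.2) hw 0).2 hq
  refine ⟨?_, fun hmem => h.2 ?_⟩
  · exact map_mem_closure (f := fun q : Plane × ℝ => (q.1 + v, q.2)) (by fun_prop) h.1
      fun q hq => key q v hv hq
  · simpa using key _ (-v) (neg_mem hv) hmem

section Generic

variable {L : ℝ} {N : Set Plane} {γ : ℝ → Space} {F₀ : Plane → ℝ} {G : Set (Perturbation L N)}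

/-- Countably many sets to be avoided prevent the crossings along a flow line from accumulating:
the tangencies with countably many arcs that cover the marked cords, and the boundary points. -/
theorem exists_countable_isolating (hA : Admissible L γ F₀ N G) :
    ∃ 𝒞 : Set (Set (Perturbation L N × Plane)), 𝒞.Countable ∧
      (∀ C ∈ 𝒞, ∃ A Nice, IsTarget γ F₀ G C A Nice) ∧
      ∀ g : Perturbation L N, ∀ x, IsFlowLine (F₀ + g.1) x → ∀ t r,
        (x t, r) ∈ closure (markedCords γ) → (∀ C ∈ 𝒞, (g, x t) ∉ C) →
          ∀ᶠ z : ℝ × ℝ in 𝓝 (t, r), (x z.1, z.2) ∈ markedCords γ → z = (t, r) := by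
  have hL := hA.knot.pos
  choose 𝒞 h𝒞 h𝒞T hiso using fun j : ℕ =>
    exists_finite_isolating hA (Nat.one_div_pos_of_nat (n := j))
  obtain ⟨P, hP⟩ : ∃ P : Set Plane,
      P = {p ∈ fundamentalDomain L | ∃ r, (p, r) ∈ markedBoundary γ} := ⟨_, rfl⟩
  have hPfin : P.Finite := hP ▸ hA.knot.boundaryFinite
  refine ⟨(⋃ j, 𝒞 j) ∪ (fun q => {z : Perturbation L N × Plane | q - z.2 ∈ lattice L}) '' P,
    (countable_iUnion fun j => (h𝒞 j).countable).union (hPfin.image _).countable, ?_, ?_⟩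
  · rintro C (hC | ⟨q, hq, rfl⟩)
    · obtain ⟨j, hj⟩ := mem_iUnion.1 hC
      exact h𝒞T j C hj
    · rw [hP] at hq
      obtain ⟨r, hr⟩ := hq.2
      exact ⟨_, _, isTarget_point hA (map_mem_closure (f := Prod.fst) continuous_fst hr.1
        fun y hy => mem_cordsMeetingKnot_of_mem_markedCords hy)⟩
  intro g x hx t r hcl hav
  by_cases hm : (x t, r) ∈ markedCords γ
  · obtain ⟨d, hd, hfar⟩ := exists_mem_markedFar hm
    obtain ⟨j, hj⟩ := exists_nat_one_div_lt hd
    exact hiso j g x hx t r (markedFar_anti hj.le hfar) fun C hC =>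
      hav C (Or.inl (mem_iUnion.2 ⟨j, hC⟩))
  · obtain ⟨v, hv, hxv⟩ := exists_lattice_add_mem_fundamentalDomain hL (x t)
    refine absurd ?_ (hav _ (Or.inr ⟨x t + v, ?_, rfl⟩))
    · simpa using hv
    · rw [hP]
      exact ⟨hxv, r, hA.knot.toIsKnot.markedBoundary_shift hv ⟨hcl, hm⟩⟩

/-- The splitting process of `c` never runs into one of the sets in `𝒞`. -/
def Avoids (γ : ℝ → Space) (F₀ : Plane → ℝ) (𝒞 : Set (Set (Perturbation L N × Plane)))
    (g : Perturbation L N) (c : Plane) : Prop :=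
  ∀ C ∈ 𝒞, ∀ m, ∀ T, ∀ d > 0, (g, c) ∉ bad γ F₀ T d C m

variable {𝒞 : Set (Set (Perturbation L N × Plane))} {g : Perturbation L N} {c : Plane}

theorem Avoids.flow (hL : 0 < L) (hF : IsTorusFun L F₀) (h : Avoids γ F₀ 𝒞 g c) {t : ℝ}
    (ht : 0 ≤ t) : Avoids γ F₀ 𝒞 g (flow (F₀ + g.1) t c) :=
  fun C hC m T d hd hbad => h C hC m (T + t) d hd (bad_flow hL hF ht hbad)

theorem Avoids.piece (h : Avoids γ F₀ 𝒞 g c) {t r : ℝ} (ht : 0 ≤ t)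
    (hr : r ∈ crossings γ (CordSplitting.flow (F₀ + g.1) t c) ∩ Ico 0 L) (β : Bool) :
    Avoids γ F₀ 𝒞 g (piece (CordSplitting.flow (F₀ + g.1) t c) r β) := by
  intro C hC m T d hd hbad
  obtain ⟨d', hd', hfar⟩ := exists_mem_markedFar (q := (CordSplitting.flow (F₀ + g.1) t c, r)) hr.1
  refine h C hC (m + 1) (max T t) (min d d') (lt_min hd hd') ⟨t, ⟨ht, le_max_right _ _⟩, r,
    Ico_subset_Icc_self hr.2, β, markedFar_anti (min_le_right _ _) hfar, ?_⟩
  exact bad_mono (le_max_left _ _) (min_le_left _ _) m hbad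

theorem Avoids.notMem (h : Avoids γ F₀ 𝒞 g c) {C : Set (Perturbation L N × Plane)}
    (hC : C ∈ 𝒞) {t : ℝ} (ht : 0 ≤ t) : (g, CordSplitting.flow (F₀ + g.1) t c) ∉ C := fun hmem =>
  h C hC 0 t 1 one_pos ⟨t, ⟨ht, le_rfl⟩, hmem⟩

/-- For generic perturbations, the splitting processes of countably many cords avoid countably many
targets. -/
theorem eventually_residual_avoids (hA : Admissible L γ F₀ N G) (h𝒞 : 𝒞.Countable)
    (hT : ∀ C ∈ 𝒞, ∃ A Nice, IsTarget γ F₀ G C A Nice) {B : Set Plane} (hB : B.Countable)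
    (hBN : B ⊆ N) :
    ∀ᶠ g in residual (Perturbation L N), g ∈ G → ∀ b ∈ B, Avoids γ F₀ 𝒞 g b := by
  have h1 : ∀ᶠ g in residual (Perturbation L N), ∀ C ∈ 𝒞, ∀ b ∈ B, ∀ m j : ℕ,
      g ∈ G → (g, b) ∉ bad γ F₀ j (1 / ((j : ℝ) + 1)) C m := by
    refine (eventually_countable_ball h𝒞).2 fun C hC => (eventually_countable_ball hB).2
      fun b hb => eventually_countable_forall.2 fun m => eventually_countable_forall.2 fun j => ?_
    obtain ⟨A, Nice, hCT⟩ := hT C hC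
    exact eventually_residual_of_subset_closure
      ((isClosed_bad hA.knot.pos hA.torus hA.knot.toIsKnot.continuous hCT.isClosed m).preimage
        (by fun_prop : Continuous fun g : Perturbation L N => (g, b))).isOpen_compl
      (hCT.subset_closure_notMem_bad hA Nat.one_div_pos_of_nat (hBN hb) m)
  filter_upwards [h1] with g hg hgG b hb C hC m T d hd hbad
  obtain ⟨j₁, hj₁⟩ := exists_nat_ge T
  obtain ⟨j₂, hj₂⟩ := exists_nat_one_div_lt hd
  refine hg C hC b hb m (max j₁ j₂) hgG (bad_mono ?_ ?_ m hbad)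
  · exact hj₁.trans (by exact_mod_cast le_max_left _ _)
  · refine le_trans ?_ hj₂.le
    have : (j₂ : ℝ) ≤ (max j₁ j₂ : ℕ) := by exact_mod_cast le_max_right _ _
    gcongr

end Generic

/-! ### Critical points -/

theorem HessianNondegenerate.isolated {F : Plane → ℝ} (hF : ContDiff ℝ ∞ F) {k : Plane}
    (hk : HessianNondegenerate F k) : ∀ᶠ p in 𝓝[≠] k, gradient F p ≠ 0 := by
  have hd : HasFDerivAt (fderiv ℝ F) (fderiv ℝ (fderiv ℝ F) k) k :=
    ((hF.fderiv_right (m := ∞) (by simp)).differentiable (by simp) k).hasFDerivAt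
  have hker : LinearMap.ker (fderiv ℝ (fderiv ℝ F) k).toLinearMap = ⊥ :=
    LinearMap.ker_eq_bot'.2 fun v hv => hk v fun w => by
      have hv' : fderiv ℝ (fderiv ℝ F) k v = 0 := hv
      simp [hessian, hv']
  obtain ⟨K, -, hK⟩ := LinearMap.exists_antilipschitzWith _ hker
  filter_upwards [hd.eventually_ne (c := 0) ⟨K, hK⟩] with p hp h0
  refine hp ?_
  rwa [← norm_eq_zero, ← norm_gradient, norm_eq_zero]

theorem IsMorse.countable_crit {F : Plane → ℝ} (hF : ContDiff ℝ ∞ F) (h : IsMorse F) :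
    (Crit F).Countable := by
  obtain ⟨t, ht, htc, hcov⟩ := TopologicalSpace.countable_cover_nhdsWithin (f := fun k => {k})
    (s := Crit F) fun k hk => by
      rw [mem_nhdsWithin_iff_eventually]
      have := eventually_nhdsWithin_iff.1 ((h k hk).isolated hF)
      filter_upwards [this] with p hp hpc
      by_contra hne
      exact hp hne hpc
  refine htc.mono fun k hk => ?_
  obtain ⟨k', hk', rfl⟩ := mem_iUnion₂.1 (hcov hk)
  exact hk'

theorem hessian_congr {F F' : Plane → ℝ} {k : Plane} (h : F =ᶠ[𝓝 k] F') :
    hessian F k = hessian F' k := by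
  funext v w
  simp only [hessian]
  rw [(h.fderiv).fderiv_eq]

theorem isClosed_crit {F : Plane → ℝ} (hF : ContDiff ℝ ∞ F) : IsClosed (Crit F) :=
  isClosed_eq (contDiff_gradient hF).continuous continuous_const

/-- A small perturbation that vanishes near the critical points has no new critical points. -/
theorem exists_crit_subset {L : ℝ} (hL : 0 < L) {F₀ : Plane → ℝ} (hF : IsTorusFun L F₀)
    {N : Set Plane} (hNo : IsOpen N) (hNi : IsInvariant L N) (hcN : Crit F₀ ⊆ N) :
    ∃ ε > 0, ∀ g ∈ Perturbation.small L N ε, Crit (F₀ + g.1) ⊆ Crit F₀ := by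
  have hcont : Continuous fun p => ‖gradient F₀ p‖ := (contDiff_gradient hF.smooth).continuous.norm
  obtain ⟨c, hc, hbd⟩ : ∃ c, 0 < c ∧ ∀ p ∈ square L ∩ Nᶜ, c ≤ ‖gradient F₀ p‖ :=
    ((isCompact_square L).inter_right hNo.isClosed_compl).exists_forall_le' hcont.continuousOn
      fun p hp => norm_pos_iff.2 fun h0 => hp.2 (hcN h0)
  refine ⟨c, hc, fun g hg p hp => ?_⟩
  have hp0 : gradient F₀ p + gradient g.1 p = 0 := by
    rw [← Perturbation.gradient_add_eq hF]
    exact hp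
  by_cases hpN : p ∈ N
  · have he : g.1 =ᶠ[𝓝 p] fun _ => (0 : ℝ) := by
      filter_upwards [hNo.mem_nhds hpN] with q hq using g.2.2.2 q hq
    rw [he.gradient_eq] at hp0
    simpa [gradient, Crit] using hp0
  · exfalso
    obtain ⟨v, hv, hpv⟩ := exists_lattice_add_mem_fundamentalDomain hL p
    have h1 := hbd (p + v) ⟨fundamentalDomain_subset_square L hpv, fun h =>
      hpN ((hNi.add_mem_iff hv).1 h)⟩
    rw [hF.gradient_add_lattice hv, eq_neg_of_add_eq_zero_left hp0, norm_neg] at h1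
    exact h1.not_gt (Perturbation.norm_gradient_lt_of_mem_small hg p)

/-- The unstable manifolds of the index 1 critical points of all small perturbations are swept out
by the flow lines that start at the points of one countable set. -/
theorem exists_countable_base_unstableUnion {L : ℝ} (hL : 0 < L) {F₀ : Plane → ℝ}
    (hF : IsTorusFun L F₀) (hM : IsMorse F₀) {Z : Set Plane} (hZ : IsInvariant L Z)
    (hcZ : Crit F₀ ⊆ Z) {η : ℝ} (hη : 0 < η) :
    ∃ B : Set Plane, B.Countable ∧ B ⊆ Metric.thickening η Z ∧ ∃ ε > 0,
      ∀ g ∈ Perturbation.small L (Metric.thickening η Z) ε, ∀ c ∈ unstableUnion (F₀ + g.1),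
        ∃ b ∈ B, ∃ t ≥ 0, c = flow (F₀ + g.1) t b := by
  have hcrit := hM.countable_crit hF.smooth
  have hbase := fun k : Plane => fun hk : k ∈ CritIndex F₀ 1 =>
    exists_countable_base hL hF.smooth hk.1 (hM k hk.1) hk.2 hη
  choose! A hAc hAb hA using hbase
  obtain ⟨ε, hε, hsub⟩ := exists_crit_subset hL hF Metric.isOpen_thickening (hZ.thickening η)
    (hcZ.trans (Metric.self_subset_thickening hη Z))
  have hball : ∀ k ∈ Crit F₀, Metric.ball k η ⊆ Metric.thickening η Z := fun k hk =>
    Metric.ball_subset_thickening (hcZ hk) η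
  refine ⟨⋃ k ∈ CritIndex F₀ 1, A k, (hcrit.mono fun k hk => hk.1).biUnion hAc,
    iUnion₂_subset fun k hk => (hAb k hk).trans (hball k hk.1), ε, hε, fun g hg c hc => ?_⟩
  obtain ⟨k, hk, hck⟩ := mem_iUnion₂.1 hc
  have hk₀ : k ∈ Crit F₀ := hsub g hg hk.1
  have heq : EqOn (F₀ + g.1) F₀ (Metric.ball k η) := fun p hp => by
    simp [g.2.2.2 p (hball k hk₀ hp)]
  have hk₁ : k ∈ CritIndex F₀ 1 := by
    refine ⟨hk₀, ?_⟩
    have h1 := hk.2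
    rw [HasMorseIndex, hessian_congr (heq.eventuallyEq_of_mem (Metric.ball_mem_nhds k hη))] at h1
    exact h1
  obtain ⟨b, hb, t, ht, hbt⟩ := hA k hk₁ _ (g.isTorusFun_add hF) heq c hck
  exact ⟨b, mem_biUnion hk₁ hb, t, ht, hbt⟩

/-! ### Finiteness of the splitting process -/

section Histories

variable {L : ℝ} {γ : ℝ → Space} {F : Plane → ℝ}

/-- The splittings that occur while the cord `c` flows on, before one of the pieces is split
again. -/
def firstSteps (L : ℝ) (γ : ℝ → Space) (F : Plane → ℝ) (c : Plane) : Set SplitStep :=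
  {a | 0 ≤ a.time ∧ a.crossing ∈ crossings γ (flow F a.time c) ∩ Ico 0 L}

theorem isHistory_cons_iff (hL : 0 < L) (hF : IsTorusFun L F) {c : Plane} {a : SplitStep}
    {l : List SplitStep} : IsHistory L γ F c (a :: l) ↔ a ∈ firstSteps L γ F c ∧
      IsHistory L γ F (piece (flow F a.time c) a.crossing a.second) l := by
  constructor
  · rintro ⟨h0, x, hx, rfl, h1, h2⟩
    rw [hF.eq_flow hL hx] at h1 h2
    exact ⟨⟨h0, h1⟩, h2⟩
  · rintro ⟨⟨h0, h1⟩, h2⟩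
    exact ⟨h0, _, hF.isFlowLine_flow hL c, hF.flow_zero hL c, h1, h2⟩

theorem finite_histories_of_firstSteps (hL : 0 < L) (hF : IsTorusFun L F) {c : Plane}
    (hfin : (firstSteps L γ F c).Finite) (h : ∀ a ∈ firstSteps L γ F c,
      {l | IsHistory L γ F (piece (flow F a.time c) a.crossing a.second) l}.Finite) :
    {l | IsHistory L γ F c l}.Finite := by
  refine ((finite_singleton []).union
    (hfin.biUnion fun a ha => (h a ha).image (List.cons a))).subset ?_
  rintro (_ | ⟨a, l⟩) hl
  · exact Or.inl rfl
  · obtain ⟨h1, h2⟩ := (isHistory_cons_iff hL hF).1 hl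
    exact Or.inr (mem_biUnion h1 ⟨l, h2, rfl⟩)

/-- Cords that meet the knot lose a definite amount of energy in the next unit of time. -/
theorem exists_energy_drop (hK : IsKnot L γ) (hF : IsTorusFun L F)
    (hreg : ∀ p ∈ closure (cordsMeetingKnot γ), gradient F p ≠ 0) :
    ∃ κ > 0, ∀ p ∈ cordsMeetingKnot γ, F (flow F 1 p) + κ ≤ F p := by
  have hL := hK.pos
  have hflow : Continuous fun p => flow F 1 p := by
    have h1 := Perturbation.continuous_flow (N := ∅) hL hF
    obtain ⟨g, hg⟩ : ∃ g : Perturbation L ∅, g.1 = 0 :=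
      ⟨⟨0, contDiff_const, fun _ _ _ => rfl, fun _ _ => rfl⟩, rfl⟩
    have h2 : Continuous fun p : Plane => flow (F + g.1) 1 p :=
      h1.comp (by fun_prop : Continuous fun p : Plane => (g, (1 : ℝ), p))
    simpa [hg] using h2
  have hcont : Continuous fun p => F p - F (flow F 1 p) :=
    hF.smooth.continuous.sub (hF.smooth.continuous.comp hflow)
  obtain ⟨κ, hκ, hbd⟩ : ∃ κ, 0 < κ ∧ ∀ p ∈ square L ∩ closure (cordsMeetingKnot γ),
      κ ≤ F p - F (flow F 1 p) :=
    ((isCompact_square L).inter_right isClosed_closure).exists_forall_le' hcont.continuousOn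
      fun p hp => by
        have h1 := (hF.isFlowLine_flow hL p).strictAnti_energy hL hF (t₀ := 0)
          (by rw [hF.flow_zero hL]; exact hreg p hp.2) one_pos
        simp only [hF.flow_zero hL] at h1
        linarith
  refine ⟨κ, hκ, fun p hp => ?_⟩
  obtain ⟨v, hv, hpv⟩ := exists_lattice_add_mem_fundamentalDomain hL p
  have h1 := hbd (p + v) ⟨fundamentalDomain_subset_square L hpv,
    subset_closure (isInvariant_cordsMeetingKnot hK p hp v hv)⟩
  rw [hF.flow_add_lattice hL 1 p hv, hF.periodic.add_lattice hv, hF.periodic.add_lattice hv] at h1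
  linarith

/-- A cord meets the knot only in bounded time. -/
theorem exists_time_bound (hK : IsKnot L γ) (hF : IsTorusFun L F)
    (hreg : ∀ p ∈ closure (cordsMeetingKnot γ), gradient F p ≠ 0) {x : ℝ → Plane}
    (hx : IsFlowLine F x) : ∃ T, ∀ t, x t ∈ cordsMeetingKnot γ → t ≤ T := by
  have hL := hK.pos
  obtain ⟨κ, hκ, hdrop⟩ := exists_energy_drop hK hF hreg
  obtain ⟨B, -, hB⟩ := hF.exists_bound hL
  have hlim := tendsto_atTop_ciInf (hx.antitone_energy (hF.smooth.differentiable (by simp)))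
    ⟨-B, by rintro _ ⟨t, rfl⟩; exact (abs_le.1 (hB (x t))).1⟩
  have hlim' : Tendsto (fun t => F (x t) - F (x (t + 1))) atTop (𝓝 0) := by
    have := hlim.sub (hlim.comp (tendsto_atTop_add_const_right atTop (1 : ℝ) tendsto_id))
    rw [sub_self] at this
    exact this
  obtain ⟨T, hT⟩ := eventually_atTop.1 (hlim'.eventually_lt_const hκ)
  refine ⟨T, fun t ht => ?_⟩
  by_contra! hlt
  have h1 := hT t hlt.le
  have h2 := hdrop _ ht
  have h3 : flow F 1 (x t) = x (t + 1) := by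
    rw [hF.eq_flow hL hx t, hF.flow_flow hL, add_comm, ← hF.eq_flow hL hx]
  rw [h3] at h2
  linarith

/-- If infinitely many splittings occurred along a flow line, then their times and crossings would
accumulate in a marked cord or in a boundary point. -/
theorem finite_firstSteps (hK : IsKnot L γ) (hF : IsTorusFun L F)
    (hreg : ∀ p ∈ closure (cordsMeetingKnot γ), gradient F p ≠ 0) {c : Plane}
    (hiso : ∀ t ≥ 0, ∀ r, (flow F t c, r) ∈ closure (markedCords γ) →
      ∀ᶠ z : ℝ × ℝ in 𝓝 (t, r), (flow F z.1 c, z.2) ∈ markedCords γ → z = (t, r)) :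
    (firstSteps L γ F c).Finite := by
  have hL := hK.pos
  have hx := hF.isFlowLine_flow hL c
  obtain ⟨T, hT⟩ := exists_time_bound hK hF hreg hx
  have hfin : {z : ℝ × ℝ | z ∈ Icc 0 T ×ˢ Icc 0 L ∧
      (flow F z.1 c, z.2) ∈ markedCords γ}.Finite := by
    by_contra hinf
    obtain ⟨z, hz, hacc⟩ := Set.Infinite.exists_accPt_of_subset_isCompact
      (show Set.Infinite _ from hinf) (isCompact_Icc.prod isCompact_Icc) fun z hz => hz.1
    have hcont : Continuous fun z : ℝ × ℝ => (flow F z.1 c, z.2) :=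
      (hx.continuous.comp continuous_fst).prodMk continuous_snd
    have hcl : (flow F z.1 c, z.2) ∈ closure (markedCords γ) :=
      map_mem_closure (f := fun z : ℝ × ℝ => (flow F z.1 c, z.2)) hcont
        (mem_closure_iff_clusterPt.2 hacc.clusterPt) fun y hy => hy.2
    rw [accPt_iff_frequently_nhdsNE] at hacc
    obtain ⟨y, hy1, hy2, hy3⟩ := (hacc.and_eventually
      ((eventually_nhdsWithin_of_eventually_nhds (hiso z.1 hz.1.1 z.2 hcl)).and
        self_mem_nhdsWithin)).exists
    exact hy3 (hy2 hy1.2)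
  refine ((hfin.prod (finite_univ (α := Bool))).image
    fun y => (⟨y.1.1, y.1.2, y.2⟩ : SplitStep)).subset ?_
  rintro ⟨t, r, β⟩ ⟨ht, hr, hr'⟩
  exact ⟨((t, r), β), ⟨⟨⟨⟨ht, hT t ⟨r, hr⟩⟩, Ico_subset_Icc_self hr'⟩, hr⟩, mem_univ _⟩, rfl⟩

/-- If no cord of the process has infinitely many splittings of its own, and two consecutive
splittings cost a definite amount of energy, then the whole process is finite. -/
theorem finite_histories (hL : 0 < L) (hF : IsTorusFun L F) {κ : ℝ} (hκ : 0 < κ)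
    (hdrop : ∀ x T r β y T' r' β', IsFlowLine F x → 0 ≤ T → r ∈ crossings γ (x T) →
      IsFlowLine F y → y 0 = piece (x T) r β → 0 ≤ T' → r' ∈ crossings γ (y T') →
        F (piece (y T') r' β') ≤ F (x 0) - κ) {P : Plane → Prop}
    (hfin : ∀ c, P c → (firstSteps L γ F c).Finite)
    (hpiece : ∀ c, P c → ∀ a ∈ firstSteps L γ F c,
      P (piece (flow F a.time c) a.crossing a.second)) {c : Plane} (hc : P c) :
    {l | IsHistory L γ F c l}.Finite := by
  obtain ⟨B, -, hB⟩ := hF.exists_bound hL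
  have key : ∀ n : ℕ, ∀ c, P c → F c < -B + n * κ → {l | IsHistory L γ F c l}.Finite := by
    intro n
    induction n with
    | zero =>
      intro c _ hlt
      have := (abs_le.1 (hB c)).1
      simp only [CharP.cast_eq_zero, zero_mul, add_zero] at hlt
      linarith
    | succ n ih =>
      intro c hc hlt
      refine finite_histories_of_firstSteps hL hF (hfin c hc) fun a ha => ?_
      have hc₁ := hpiece c hc a ha
      refine finite_histories_of_firstSteps hL hF (hfin _ hc₁) fun a' ha' => ?_
      refine ih _ (hpiece _ hc₁ a' ha') ?_
      have h1 := hdrop _ a.time a.crossing a.second _ a'.time a'.crossing a'.second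
        (hF.isFlowLine_flow hL c) ha.1 ha.2.1 (hF.isFlowLine_flow hL _) (hF.flow_zero hL _)
        ha'.1 ha'.2.1
      rw [hF.flow_zero hL] at h1
      push_cast at hlt
      linarith
  obtain ⟨n, hn⟩ := exists_nat_gt ((F c + B) / κ)
  rw [div_lt_iff₀ hκ] at hn
  exact key n c hc (by linarith)

end Histories

/-! ### Neighbourhoods of the diagonal and the critical points -/

theorem isInvariant_diagonal (L : ℝ) : IsInvariant L (diagonal L) := by
  rintro p ⟨k, hk⟩ v hv
  obtain ⟨⟨i, hi⟩, ⟨j, hj⟩⟩ := mem_lattice_iff.1 hv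
  refine ⟨k + j - i, ?_⟩
  simp only [PiLp.add_apply, hk, hi, hj]
  push_cast
  ring

theorem isClosed_diagonal {L : ℝ} (hL : 0 < L) : IsClosed (diagonal L) := by
  have h1 : diagonal L = (fun p : Plane => (!₂[0, p 1 - p 0] : Plane)) ⁻¹' lattice L := by
    ext p
    simp only [mem_preimage, SetLike.mem_coe, mem_lattice_iff]
    constructor
    · rintro ⟨k, hk⟩
      exact ⟨⟨0, by simp⟩, ⟨k, by simp [hk]⟩⟩
    · rintro ⟨-, k, hk⟩
      refine ⟨k, ?_⟩
      simp only [Matrix.cons_val_one, Matrix.cons_val_fin_one] at hk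
      linarith
  rw [h1]
  exact (isClosed_lattice hL).preimage
    (continuous_mk.comp (continuous_const.prodMk ((continuous_coord 1).sub (continuous_coord 0))))

theorem isInvariant_crit {L : ℝ} {F : Plane → ℝ} (hF : IsTorusFun L F) :
    IsInvariant L (Crit F) := fun p hp v hv => by
  show gradient F (p + v) = 0
  rw [hF.gradient_add_lattice hv]
  exact hp

theorem IsGenericKnot.disjoint_diagonal {L : ℝ} {γ : ℝ → Space} (hK : IsGenericKnot L γ) :
    Disjoint (closure (cordsMeetingKnot γ)) (diagonal L) := by
  obtain ⟨ℓ, hℓ, hlen⟩ := hK.exists_length_bound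
  have hγ := hK.toIsKnot.continuous
  have hcl : IsClosed {p : Plane | ℓ ≤ dist (γ (p 0)) (γ (p 1))} :=
    isClosed_le continuous_const
      ((hγ.comp (continuous_coord 0)).dist (hγ.comp (continuous_coord 1)))
  refine disjoint_left.2 fun p hp ⟨k, hk⟩ => ?_
  have hsub : cordsMeetingKnot γ ⊆ {p : Plane | ℓ ≤ dist (γ (p 0)) (γ (p 1))} :=
    fun q ⟨r, hr⟩ => hlen _ _ r (mem_crossings.1 hr)
  have h1 := closure_minimal hsub hcl hp
  simp only [mem_ofPred_eq, hk, hK.toIsKnot.periodic_int, dist_self] at h1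
  linarith

theorem exists_disjoint_thickening {L : ℝ} (hL : 0 < L) {S Z : Set Plane} (hS : IsInvariant L S)
    (hSc : IsClosed S) (hZ : IsInvariant L Z) (hZc : IsClosed Z) (h : Disjoint S Z) :
    ∃ η₀ > 0, ∀ η < η₀, Disjoint (closure (Metric.thickening η Z)) S := by
  obtain ⟨δ, hδ, hdisj⟩ := (h.mono_left inter_subset_left).exists_cthickenings
    ((isCompact_square L).inter_left hSc) hZc
  refine ⟨δ, hδ, fun η hη => disjoint_left.2 fun p hp hpS => ?_⟩
  obtain ⟨v, hv, hpv⟩ := exists_lattice_add_mem_fundamentalDomain hL p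
  refine disjoint_left.1 hdisj (Metric.self_subset_cthickening _
    ⟨hS p hpS v hv, fundamentalDomain_subset_square L hpv⟩) (Metric.cthickening_mono hη.le _ ?_)
  exact Metric.closure_thickening_subset_cthickening _ _ ((hZ.thickening η).closure p hp v hv)

/-! ### The splitting process for generic perturbations -/

theorem Perturbation.small_mono {L : ℝ} {N : Set Plane} {ε ε' : ℝ} (h : ε ≤ ε') :
    Perturbation.small L N ε ⊆ Perturbation.small L N ε' :=
  fun _ ⟨e, he, h'⟩ => ⟨e, he.trans_le h, h'⟩

/-- The splitting process is finite for generic small perturbations of a Morse function close to the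
energy. -/
theorem IsGenericKnot.eventually_residual_finite_histories {L : ℝ} {γ : ℝ → Space}
    (hK : IsGenericKnot L γ) : ∃ θ > 0, ∀ F₀, IsTorusFun L F₀ → IsMorse F₀ →
      (∀ p, |F₀ p - energy γ p| ≤ θ) → (∀ p, ‖gradient F₀ p - gradient (energy γ) p‖ ≤ θ) →
        ∃ η₀ > 0, ∀ η, 0 < η → η < η₀ → ∃ ε > 0,
          ∀ᶠ g in residual (Perturbation L (Metric.thickening η (diagonal L ∪ Crit F₀))),
            g ∈ Perturbation.small L _ ε → ∀ c ∈ unstableUnion (F₀ + g.1),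
              {h | IsHistory L γ (F₀ + g.1) c h}.Finite := by
  have hL := hK.pos
  obtain ⟨c, hc, hgrad⟩ := hK.exists_gradient_bound
  obtain ⟨θ, hθ, κ, hκ, hdrop⟩ := hK.exists_two_step_drop
  have hgrad' : ∀ p ∈ closure (cordsMeetingKnot γ), c ≤ ‖gradient (energy γ) p‖ := by
    have hcl : IsClosed {p | c ≤ ‖gradient (energy γ) p‖} := isClosed_le continuous_const
      (contDiff_gradient hK.toIsKnot.contDiff_energy).continuous.norm
    exact closure_minimal hgrad hcl
  obtain ⟨μ, hμ, hμθ, hμc⟩ : ∃ μ > 0, 2 * μ ≤ θ ∧ 2 * μ < c :=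
    ⟨min θ c / 3, by positivity, by linarith [min_le_left θ c], by linarith [min_le_right θ c]⟩
  have hreg : ∀ F : Plane → ℝ, (∀ p, ‖gradient F p - gradient (energy γ) p‖ ≤ 2 * μ) →
      ∀ p ∈ closure (cordsMeetingKnot γ), gradient F p ≠ 0 := by
    intro F hF p hp h0
    have h1 := hF p
    rw [h0, zero_sub, norm_neg] at h1
    linarith [hgrad' p hp]
  refine ⟨μ, hμ, fun F₀ hF hM h0 h1 => ?_⟩
  have hS := (isInvariant_cordsMeetingKnot hK.toIsKnot).closure
  have hZ : IsInvariant L (diagonal L ∪ Crit F₀) :=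
    (isInvariant_diagonal L).union (isInvariant_crit hF)
  have hdisj : Disjoint (closure (cordsMeetingKnot γ)) (diagonal L ∪ Crit F₀) :=
    disjoint_union_right.2 ⟨hK.disjoint_diagonal, disjoint_left.2 fun p hp hcr =>
      hreg F₀ (fun p => (h1 p).trans (by linarith)) p hp hcr⟩
  obtain ⟨η₀, hη₀, hη⟩ := exists_disjoint_thickening hL hS isClosed_closure hZ
    ((isClosed_diagonal hL).union (isClosed_crit hF.smooth)) hdisj
  refine ⟨η₀, hη₀, fun η hη0 hηlt => ?_⟩
  obtain ⟨B, hBc, hBN, ε₁, hε₁, hB⟩ :=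
    exists_countable_base_unstableUnion hL hF hM hZ subset_union_right hη0
  obtain ⟨ε, hε, hεε, hεμ⟩ : ∃ ε > 0, ε ≤ ε₁ ∧ ε ≤ μ :=
    ⟨min ε₁ μ, by positivity, min_le_left _ _, min_le_right _ _⟩
  refine ⟨ε, hε, ?_⟩
  obtain ⟨N, hN⟩ : ∃ N, N = Metric.thickening η (diagonal L ∪ Crit F₀) := ⟨_, rfl⟩
  rw [← hN] at hBN hB ⊢
  have hclose : ∀ g ∈ Perturbation.small L N ε,
      (∀ p, |(F₀ + g.1) p - energy γ p| ≤ θ) ∧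
        ∀ p, ‖gradient (F₀ + g.1) p - gradient (energy γ) p‖ ≤ 2 * μ := by
    intro g hg
    constructor
    · intro p
      have e : (F₀ + g.1) p - energy γ p = (F₀ p - energy γ p) + g.1 p := by
        simp only [Pi.add_apply]
        ring
      rw [e]
      have := abs_add_le (F₀ p - energy γ p) (g.1 p)
      linarith [h0 p, Perturbation.abs_lt_of_mem_small hg p]
    · intro p
      rw [Perturbation.gradient_add_eq hF, add_sub_right_comm]
      have := norm_add_le (gradient F₀ p - gradient (energy γ) p) (gradient g.1 p)
      linarith [h1 p, Perturbation.norm_gradient_lt_of_mem_small hg p]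
  obtain ⟨V, -, hV⟩ := hK.toIsKnot.isTorusFun_energy.exists_bound_gradient hL
  have hA : Admissible L γ F₀ N (Perturbation.small L N ε) :=
    { knot := hK
      torus := hF
      invariant := hN ▸ hZ.thickening η
      disjoint := hN ▸ hη η hηlt
      isOpen := Perturbation.isOpen_small ε
      speed := ⟨V + 2 * μ, fun g hg p => by
        have h2 := norm_le_norm_add_norm_sub' (gradient (F₀ + g.1) p) (gradient (energy γ) p)
        linarith [hV p, (hclose g hg).2 p]⟩
      regular := fun g hg => hreg _ (hclose g hg).2 }
  obtain ⟨𝒞, h𝒞, h𝒞T, hiso⟩ := exists_countable_isolating hA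
  filter_upwards [eventually_residual_avoids hA h𝒞 h𝒞T hBc hBN] with g hg hgε c hc
  have hFg := g.isTorusFun_add hF
  obtain ⟨b, hb, t, ht, rfl⟩ := hB g (Perturbation.small_mono hεε hgε) c hc
  refine finite_histories hL hFg hκ (hdrop _ hFg (hclose g hgε).1
    fun p => ((hclose g hgε).2 p).trans hμθ) (P := Avoids γ F₀ 𝒞 g) ?_ ?_
    ((hg hgε b hb).flow hL hF ht)
  · intro c hc
    exact finite_firstSteps hK.toIsKnot hFg (hA.regular g hgε) fun t ht r hr =>
      hiso g _ (hFg.isFlowLine_flow hL c) t r hr fun C hC => hc.notMem hC ht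
  · intro c hc a ha
    exact hc.piece ha.1 ha.2 a.second

end CordSplitting

end

theorem mainTheorem5 (L : ℝ) (γ : ℝ → CordSplitting.Space)
    (hK : CordSplitting.IsGenericKnot L γ) :
    ∃ n₀ : ℕ, ∃ δ > 0, ∀ f : CordSplitting.Plane → ℝ,
      CordSplitting.IsMorsification L γ δ f → CordSplitting.CnSmall n₀ δ f →
      ∃ η₀ > 0, ∀ η : ℝ, 0 < η → η < η₀ →
        ∃ n : ℕ, ∃ ε > 0,
          ∀ᶠ g in residual (CordSplitting.Perturbation L (Metric.thickening η
              (CordSplitting.diagonal L ∪ CordSplitting.Crit (CordSplitting.energy γ + f)))),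
            CordSplitting.CnSmall n ε g.1 →
              ∀ c ∈ CordSplitting.unstableUnion (CordSplitting.energy γ + f + g.1),
                {h : List CordSplitting.SplitStep |
                  CordSplitting.IsHistory L γ (CordSplitting.energy γ + f + g.1) c h}.Finite := by
  obtain ⟨θ, hθ, h⟩ := hK.eventually_residual_finite_histories
  have hE := hK.toIsKnot.isTorusFun_energy
  refine ⟨1, θ, hθ, fun f hf hsmall => ?_⟩
  have hfT : CordSplitting.IsTorusFun L f := ⟨hf.smooth, hf.periodic⟩
  obtain ⟨η₀, hη₀, h'⟩ := h _ (hE.add hfT) hf.morse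
    (fun p => by
      have := hsmall 0 zero_le_one p
      rw [norm_iteratedFDeriv_zero] at this
      simpa using this.le)
    (fun p => by
      have := hsmall 1 le_rfl p
      rw [norm_iteratedFDeriv_one, ← CordSplitting.norm_gradient] at this
      rw [CordSplitting.gradient_add (hE.smooth.differentiable (by simp) p)
        (hfT.smooth.differentiable (by simp) p), add_sub_cancel_left]
      exact this.le)
  refine ⟨η₀, hη₀, fun η hη hη' => ?_⟩
  obtain ⟨ε, hε, hres⟩ := h' η hη hη'
  refine ⟨1, ε / 2, half_pos hε, ?_⟩
  filter_upwards [hres] with g hg hgs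
  exact hg (CordSplitting.Perturbation.mem_small_of_cnSmall hε hgs)
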